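/- Let $(M^5,g)$ be a connected, complete, noncompact, five-dimensional smooth Riemannian manifold and let $f\in C^\infty(M)$ satisfy the gradient shrinking Ricci soliton equation $\mathrm{Ric}+\nabla^2 f=\tfrac12 g$. Assume that the scalar curvature is constant, $R=\tfrac32$, and that $f$ is normalized by $|\nabla f|^2=f$. Let $\lambda_1\le\lambda_2\le\lambda_3\le\lambda_4\le\lambda_5$ be the eigenvalues of the Ricci tensor, put $u=\lambda_1+\lambda_2$, and write $\Delta_f=\Delta-\nabla f\cdot\nabla$ and $D(a)=\{x\in M: f(x)\le a\}$. Then there is $a>0$ such that $u$ is continuous on $M\setminus D(a)$ and the inequality $$ \begin{aligned} \Delta_f u\le{}&-u+2u^2+\frac{3}{2f}\nabla f\cdot\nabla u-\frac1f\nabla f\cdot\nabla (u^2)\\ &+\frac2f\,u\,(1-u)\left(\frac32-u\right)-2\sum_{\alpha=3}^5W^{\Sigma}_{2\alpha}\lambda_\alpha \end{aligned} $$ holds on $M\setminus D(a)$ in the barrier sense. Precisely, for every $x\in M\setminus D(a)$: (1) there is an orthonormal basis $e_1,\dots,e_5$ of $T_xM$ with $e_1=\nabla f/|\nabla f|$ and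 $\mathrm{Ric}(e_i,\cdot)=\lambda_i(x)\,g(e_i,\cdot)$ for $i=1,\dots,5$; (2) for every such basis there is a smooth function $v$ on a neighbourhood $U$ of $x$ with $v(x)=u(x)$, $u\le v$ on $U$, and, at the point $x$, $$ \begin{aligned} \Delta_f v\le{}&-u+2u^2+\frac{3}{2f}\nabla f\cdot\nabla v-\frac1f\nabla f\cdot\nabla (v^2)\\ &+\frac2f\,u\,(1-u)\left(\frac32-u\right)-2\sum_{\alpha=3}^5W^{\Sigma}_{2\alpha}\lambda_\alpha . \end{aligned} $$ Here $W^\Sigma$ is the Weyl curvature tensor of the level set $\Sigma=\{f=f(x)\}$ with its induced metric, and $W^\Sigma_{2\alpha}=W^\Sigma(e_2,e_\alpha,e_2,e_\alpha)$, with the sign convention in which $R(e_i,e_j,e_i,e_j)$ is the sectional curvature of the plane spanned by the orthonormal vectors $e_i,e_j$. (If $u$ is differentiable at $x$, then $\nabla v(x)=\nabla u(x)$.) -/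

import Mathlib

open Bundle
open scoped Manifold ContDiff Topology

noncomputable section

/-! ### Riemannian geometry of a metric in local coordinates

A metric near a point of `ℝⁿ` is given by its matrix `g y = (g_{ij}(y))`.
Curvature conventions: `R_{ijkl} = g(R(∂_i, ∂_j) ∂_l, ∂_k)`, so that `R_{ijij}` is the sectional
curvature of the plane of the orthonormal vectors `∂_i, ∂_j`. -/

namespace Coord

variable {n : ℕ}

/-- The partial derivative `∂_i h` at `y`. -/
def pd (i : Fin n) (h : EuclideanSpace ℝ (Fin n) → ℝ) (y : EuclideanSpace ℝ (Fin n)) : ℝ :=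
  fderiv ℝ h y (EuclideanSpace.single i 1)

/-- The Christoffel symbol `Γ^k_{ij}` of the Levi-Civita connection of `g`. -/
def christoffel (g : EuclideanSpace ℝ (Fin n) → Matrix (Fin n) (Fin n) ℝ)
    (y : EuclideanSpace ℝ (Fin n)) (k i j : Fin n) : ℝ :=
  (1 / 2) * ∑ l, (g y)⁻¹ k l *
    (pd i (fun z => g z j l) y + pd j (fun z => g z i l) y - pd l (fun z => g z i j) y)

/-- The component `R^l_{k i j}` of `R(∂_i, ∂_j) ∂_k = R^l_{k i j} ∂_l`, where
`R(X, Y) = ∇_X ∇_Y - ∇_Y ∇_X - ∇_[X, Y]`. -/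
def riemannUp (g : EuclideanSpace ℝ (Fin n) → Matrix (Fin n) (Fin n) ℝ)
    (y : EuclideanSpace ℝ (Fin n)) (l k i j : Fin n) : ℝ :=
  pd i (fun z => christoffel g z l j k) y - pd j (fun z => christoffel g z l i k) y
    + ∑ m, (christoffel g y l i m * christoffel g y m j k
      - christoffel g y l j m * christoffel g y m i k)

/-- The Riemann curvature tensor `R_{ijkl} = g(R(∂_i, ∂_j) ∂_l, ∂_k)`. -/
def riemann (g : EuclideanSpace ℝ (Fin n) → Matrix (Fin n) (Fin n) ℝ)
    (y : EuclideanSpace ℝ (Fin n)) (i j k l : Fin n) : ℝ :=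
  ∑ m, g y k m * riemannUp g y m l i j

/-- The Ricci tensor `R_{jl} = g^{ik} R_{ijkl}`. -/
def ricci (g : EuclideanSpace ℝ (Fin n) → Matrix (Fin n) (Fin n) ℝ)
    (y : EuclideanSpace ℝ (Fin n)) (j l : Fin n) : ℝ :=
  ∑ i, ∑ k, (g y)⁻¹ i k * riemann g y i j k l

/-- The scalar curvature `R = g^{jl} R_{jl}`. -/
def scalar (g : EuclideanSpace ℝ (Fin n) → Matrix (Fin n) (Fin n) ℝ)
    (y : EuclideanSpace ℝ (Fin n)) : ℝ :=
  ∑ j, ∑ l, (g y)⁻¹ j l * ricci g y j l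

/-- The Weyl curvature tensor `W_{ijkl}` (meaningful for `n ≥ 3`). -/
def weyl (g : EuclideanSpace ℝ (Fin n) → Matrix (Fin n) (Fin n) ℝ)
    (y : EuclideanSpace ℝ (Fin n)) (i j k l : Fin n) : ℝ :=
  riemann g y i j k l
    - (1 / ((n : ℝ) - 2)) * (g y i k * ricci g y j l - g y i l * ricci g y j k
      - g y j k * ricci g y i l + g y j l * ricci g y i k)
    + (1 / (((n : ℝ) - 1) * ((n : ℝ) - 2))) * scalar g y * (g y i k * g y j l - g y i l * g y j k)

/-- The Hessian `(∇²h)_{ij} = ∂_i ∂_j h - Γ^k_{ij} ∂_k h`. -/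
def hessian (g : EuclideanSpace ℝ (Fin n) → Matrix (Fin n) (Fin n) ℝ)
    (h : EuclideanSpace ℝ (Fin n) → ℝ) (y : EuclideanSpace ℝ (Fin n)) (i j : Fin n) : ℝ :=
  pd i (pd j h) y - ∑ k, christoffel g y k i j * pd k h y

/-- The Laplacian `Δh = g^{ij} (∇²h)_{ij}`. -/
def laplacian (g : EuclideanSpace ℝ (Fin n) → Matrix (Fin n) (Fin n) ℝ)
    (h : EuclideanSpace ℝ (Fin n) → ℝ) (y : EuclideanSpace ℝ (Fin n)) : ℝ :=
  ∑ i, ∑ j, (g y)⁻¹ i j * hessian g h y i j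

end Coord

/-! ### Riemannian geometry of a manifold -/

namespace Riem

variable {n : ℕ} {M : Type*} [TopologicalSpace M] [ChartedSpace (EuclideanSpace ℝ (Fin n)) M]

section metric

variable [RiemannianBundle (fun x : M => TangentSpace (𝓡 n) x)]

/-- For a map `φ : ℝᵐ → M`, the matrix `g(∂_i φ, ∂_j φ)` of the pulled back metric `φ^* g`. -/
def pullbackMetric {m : ℕ} (φ : EuclideanSpace ℝ (Fin m) → M) (y : EuclideanSpace ℝ (Fin m)) :
    Matrix (Fin m) (Fin m) ℝ :=
  Matrix.of fun i j =>
    inner ℝ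
      (mfderiv (𝓡 m) (𝓡 n) φ y (EuclideanSpace.single i (1 : ℝ)) : TangentSpace (𝓡 n) (φ y))
      (mfderiv (𝓡 m) (𝓡 n) φ y (EuclideanSpace.single j (1 : ℝ)) : TangentSpace (𝓡 n) (φ y))

/-- The metric of `M` in the preferred chart at `x`. -/
def chartMetric (x : M) : EuclideanSpace ℝ (Fin n) → Matrix (Fin n) (Fin n) ℝ :=
  pullbackMetric (n := n) (extChartAt (𝓡 n) x).symm

/-- The components of a tangent vector at `x` in the preferred chart at `x`. -/
def comp (x : M) (v : TangentSpace (𝓡 n) x) (i : Fin n) : ℝ :=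
  let w : EuclideanSpace ℝ (Fin n) := mfderiv (𝓡 n) (𝓡 n) (extChartAt (𝓡 n) x) x v
  w i

/-- The Ricci curvature `Ric(v, w)` at `x`. -/
def ricciForm (x : M) (v w : TangentSpace (𝓡 n) x) : ℝ :=
  ∑ i, ∑ j, Coord.ricci (chartMetric (n := n) x) (extChartAt (𝓡 n) x x) i j
    * comp x v i * comp x w j

/-- The scalar curvature at `x`. -/
def scalarCurvature (n : ℕ) {M : Type*} [TopologicalSpace M]
    [ChartedSpace (EuclideanSpace ℝ (Fin n)) M]
    [RiemannianBundle (fun x : M => TangentSpace (𝓡 n) x)] (x : M) : ℝ :=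
  Coord.scalar (chartMetric (n := n) x) (extChartAt (𝓡 n) x x)

/-- The Hessian `∇²h(v, w)` at `x`. -/
def hessianForm (h : M → ℝ) (x : M) (v w : TangentSpace (𝓡 n) x) : ℝ :=
  ∑ i, ∑ j, Coord.hessian (chartMetric (n := n) x) (h ∘ (extChartAt (𝓡 n) x).symm)
    (extChartAt (𝓡 n) x x) i j * comp x v i * comp x w j

/-- The Laplacian `Δh` at `x`. -/
def laplacian (n : ℕ) {M : Type*} [TopologicalSpace M]
    [ChartedSpace (EuclideanSpace ℝ (Fin n)) M]
    [RiemannianBundle (fun x : M => TangentSpace (𝓡 n) x)] (h : M → ℝ) (x : M) : ℝ :=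
  Coord.laplacian (chartMetric (n := n) x) (h ∘ (extChartAt (𝓡 n) x).symm)
    (extChartAt (𝓡 n) x x)

/-- The gradient `∇h` at `x`: the tangent vector with `⟨∇h, v⟩ = dh(v)`. -/
def grad (n : ℕ) {M : Type*} [TopologicalSpace M]
    [ChartedSpace (EuclideanSpace ℝ (Fin n)) M]
    [RiemannianBundle (fun x : M => TangentSpace (𝓡 n) x)] (h : M → ℝ) (x : M) :
    TangentSpace (𝓡 n) x :=
  haveI : FiniteDimensional ℝ (TangentSpace (𝓡 n) x) :=
    inferInstanceAs (FiniteDimensional ℝ (EuclideanSpace ℝ (Fin n)))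
  haveI : CompleteSpace (TangentSpace (𝓡 n) x) := FiniteDimensional.complete ℝ _
  (InnerProductSpace.toDual ℝ (TangentSpace (𝓡 n) x)).symm (mfderiv (𝓡 n) 𝓘(ℝ, ℝ) h x)

/-- The weighted Laplacian `Δ_F h = Δh - ⟨∇F, ∇h⟩` at `x`. -/
def weightedLaplacian (n : ℕ) {M : Type*} [TopologicalSpace M]
    [ChartedSpace (EuclideanSpace ℝ (Fin n)) M]
    [RiemannianBundle (fun x : M => TangentSpace (𝓡 n) x)] (F h : M → ℝ) (x : M) : ℝ :=
  laplacian n h x - inner ℝ (grad n F x) (grad n h x)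

/-- The Ricci eigenvalues at `x`, counted with multiplicity and listed in nondecreasing order:
`ricciEigenvalue n i x` is the eigenvalue `λ_{i+1}(x)` of the endomorphism `g^{ik} R_{kj}`. -/
def ricciEigenvalue (n : ℕ) {M : Type*} [TopologicalSpace M]
    [ChartedSpace (EuclideanSpace ℝ (Fin n)) M]
    [RiemannianBundle (fun x : M => TangentSpace (𝓡 n) x)] (i : Fin n) (x : M) : ℝ :=
  (((chartMetric (n := n) x (extChartAt (𝓡 n) x x))⁻¹ *
    Matrix.of (Coord.ricci (chartMetric (n := n) x) (extChartAt (𝓡 n) x x))).charpoly.roots.sort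
      (· ≤ ·)).getD i 0

end metric

/-- Near a point `x` with `dh(x) ≠ 0`: `φ` is a local smooth parametrization, around `x`, of the
level set `Σ = {h = h(x)}` by `ℝᵐ`
(with `m = n - 1`), with `φ(0) = x` and with coordinate vectors at `x` equal to the given linearly
independent tangent vectors `e`. -/
structure IsLevelParametrization {m : ℕ} (h : M → ℝ) (x : M)
    (e : Fin m → TangentSpace (𝓡 n) x) (φ : EuclideanSpace ℝ (Fin m) → M) : Prop where
  dim : m + 1 = n
  linearIndependent : LinearIndependent ℝ e
  map_zero : φ 0 = x
  smooth_level : ∃ U : Set (EuclideanSpace ℝ (Fin m)), IsOpen U ∧ (0 : EuclideanSpace ℝ (Fin m)) ∈ U ∧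
    ContMDiffOn (𝓡 m) (𝓡 n) ∞ φ U ∧ ∀ y ∈ U, h (φ y) = h x
  deriv : ∀ i : Fin m,
    (mfderiv (𝓡 m) (𝓡 n) φ 0 (EuclideanSpace.single i (1 : ℝ)) : EuclideanSpace ℝ (Fin n)) = e i

open Classical in
/-- The components `W^Σ_{ijkl}`, in the basis `e` of `T_xΣ`, of the (intrinsic) Weyl curvature tensor
at `x` of the level set `Σ = {h = h(x)}` with its induced metric, computed in local coordinates of
`Σ` whose coordinate vectors at `x` are `e` (the result does not depend on their choice). -/
def levelWeyl [RiemannianBundle (fun x : M => TangentSpace (𝓡 n) x)] {m : ℕ} (h : M → ℝ) (x : M)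
    (e : Fin m → TangentSpace (𝓡 n) x) (i j k l : Fin m) : ℝ :=
  if H : ∃ φ : EuclideanSpace ℝ (Fin m) → M, IsLevelParametrization h x e φ then
    Coord.weyl (pullbackMetric (n := n) H.choose) 0 i j k l
  else 0

/-- `v` is a smooth upper barrier for `u` at `x`: it is smooth in a neighbourhood `U` of `x`, with
`u(x) = v(x)` and `u ≤ v` on `U`. -/
def IsUpperBarrierAt (n : ℕ) {M : Type*} [TopologicalSpace M]
    [ChartedSpace (EuclideanSpace ℝ (Fin n)) M] (u v : M → ℝ) (x : M) : Prop :=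
  ∃ U : Set M, IsOpen U ∧ x ∈ U ∧ ContMDiffOn (𝓡 n) 𝓘(ℝ, ℝ) ∞ v U ∧
    u x = v x ∧ ∀ y ∈ U, u y ≤ v y

/-- `e₁, …, e₅` is an orthonormal basis of `T_xM` of Ricci eigenvectors belonging to the eigenvalues
`λ₁ ≤ … ≤ λ₅`, with `e₁ = ∇f / |∇f|`; the indices are shifted to `0, …, 4`. -/
structure IsAdaptedFrame {M : Type*} [TopologicalSpace M]
    [ChartedSpace (EuclideanSpace ℝ (Fin 5)) M]
    [RiemannianBundle (fun x : M => TangentSpace (𝓡 5) x)] (f : M → ℝ) (x : M)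
    (e : Fin 5 → TangentSpace (𝓡 5) x) : Prop where
  orthonormal : Orthonormal ℝ e
  eigenvector : ∀ (i : Fin 5) (w : TangentSpace (𝓡 5) x),
    ricciForm x (e i) w = ricciEigenvalue 5 i x * inner ℝ (e i) w
  normal : e 0 = (‖grad 5 f x‖)⁻¹ • grad 5 f x

end Riem

end

namespace Coord

variable {n m : ℕ}

/-- A real function is smooth on a set, in the sense of smoothness at each of its points. -/
def SmoothOn (U : Set (EuclideanSpace ℝ (Fin n))) (h : EuclideanSpace ℝ (Fin n) → ℝ) : Prop :=
  ∀ y ∈ U, ContDiffAt ℝ ∞ h y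

section calculus

variable {U : Set (EuclideanSpace ℝ (Fin n))} {h k : EuclideanSpace ℝ (Fin n) → ℝ}
  {y : EuclideanSpace ℝ (Fin n)}

lemma SmoothOn.differentiableAt (hh : SmoothOn U h) (hy : y ∈ U) : DifferentiableAt ℝ h y :=
  (hh y hy).differentiableAt (by simp)

lemma SmoothOn.mono {V : Set (EuclideanSpace ℝ (Fin n))} (hh : SmoothOn U h) (hV : V ⊆ U) :
    SmoothOn V h := fun y hy => hh y (hV hy)

lemma SmoothOn.const (c : ℝ) : SmoothOn U (fun _ => c) := fun _ _ => contDiffAt_const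

lemma SmoothOn.add (hh : SmoothOn U h) (hk : SmoothOn U k) : SmoothOn U (fun y => h y + k y) :=
  fun y hy => (hh y hy).add (hk y hy)

lemma SmoothOn.sub (hh : SmoothOn U h) (hk : SmoothOn U k) : SmoothOn U (fun y => h y - k y) :=
  fun y hy => (hh y hy).sub (hk y hy)

lemma SmoothOn.mul (hh : SmoothOn U h) (hk : SmoothOn U k) : SmoothOn U (fun y => h y * k y) :=
  fun y hy => (hh y hy).mul (hk y hy)

lemma SmoothOn.pow (hh : SmoothOn U h) (p : ℕ) : SmoothOn U (fun y => h y ^ p) :=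
  fun y hy => (hh y hy).pow p

lemma SmoothOn.div (hh : SmoothOn U h) (hk : SmoothOn U k) (h0 : ∀ y ∈ U, k y ≠ 0) :
    SmoothOn U (fun y => h y / k y) :=
  fun y hy => (hh y hy).div (hk y hy) (h0 y hy)

lemma SmoothOn.sum {ι : Type*} {s : Finset ι} {F : ι → EuclideanSpace ℝ (Fin n) → ℝ}
    (hF : ∀ i, SmoothOn U (F i)) : SmoothOn U (fun y => ∑ i ∈ s, F i y) :=
  fun y hy => ContDiffAt.sum fun i _ => hF i y hy

lemma SmoothOn.prod {ι : Type*} {s : Finset ι} {F : ι → EuclideanSpace ℝ (Fin n) → ℝ}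
    (hF : ∀ i, SmoothOn U (F i)) : SmoothOn U (fun y => ∏ i ∈ s, F i y) :=
  fun y hy => contDiffAt_prod fun i _ => hF i y hy

lemma SmoothOn.pd (hh : SmoothOn U h) (i : Fin n) : SmoothOn U (pd i h) := fun y hy =>
  ((hh y hy).fderiv_right (m := ∞) (by simp)).clm_apply contDiffAt_const

lemma SmoothOn.comp {V : Set (EuclideanSpace ℝ (Fin m))}
    {ψ : EuclideanSpace ℝ (Fin m) → EuclideanSpace ℝ (Fin n)}
    (hh : SmoothOn U h) (hψ : ∀ a, SmoothOn V (fun z => ψ z a)) (hm : ∀ z ∈ V, ψ z ∈ U) :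
    SmoothOn V (fun z => h (ψ z)) := fun z hz =>
  ContDiffAt.comp z (hh _ (hm z hz)) (contDiffAt_euclidean.2 fun a => hψ a z hz)

lemma SmoothOn.coord (i : Fin n) : SmoothOn U (fun y => y i) := fun y _ => by
  have := (contDiffAt_id (𝕜 := ℝ) (n := ∞) (x := y))
  exact contDiffAt_euclidean.1 this i

lemma pd_congr_of_eventuallyEq (i : Fin n) (e : h =ᶠ[𝓝 y] k) : pd i h y = pd i k y := by
  unfold pd; rw [e.fderiv_eq]

lemma pd_congr (hU : IsOpen U) (hy : y ∈ U) (e : ∀ z ∈ U, h z = k z) (i : Fin n) :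
    pd i h y = pd i k y :=
  pd_congr_of_eventuallyEq i (by filter_upwards [hU.mem_nhds hy] with z hz using e z hz)

lemma pd_const (c : ℝ) (i : Fin n) : pd i (fun _ => c) y = 0 := by
  simp [pd]

lemma pd_add (hh : SmoothOn U h) (hk : SmoothOn U k) (hy : y ∈ U) (i : Fin n) :
    pd i (fun z => h z + k z) y = pd i h y + pd i k y := by
  unfold pd; rw [fderiv_fun_add (hh.differentiableAt hy) (hk.differentiableAt hy)]; rfl

lemma pd_sub (hh : SmoothOn U h) (hk : SmoothOn U k) (hy : y ∈ U) (i : Fin n) :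
    pd i (fun z => h z - k z) y = pd i h y - pd i k y := by
  unfold pd; rw [fderiv_fun_sub (hh.differentiableAt hy) (hk.differentiableAt hy)]; rfl

lemma pd_mul (hh : SmoothOn U h) (hk : SmoothOn U k) (hy : y ∈ U) (i : Fin n) :
    pd i (fun z => h z * k z) y = pd i h y * k y + h y * pd i k y := by
  unfold pd; rw [fderiv_fun_mul (hh.differentiableAt hy) (hk.differentiableAt hy)]
  simp; ring

lemma pd_const_mul (c : ℝ) (hh : SmoothOn U h) (hy : y ∈ U) (i : Fin n) :
    pd i (fun z => c * h z) y = c * pd i h y := by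
  rw [pd_mul (SmoothOn.const c) hh hy, pd_const]; ring

lemma pd_sum {ι : Type*} {s : Finset ι} {F : ι → EuclideanSpace ℝ (Fin n) → ℝ}
    (hF : ∀ j, SmoothOn U (F j)) (hy : y ∈ U) (i : Fin n) :
    pd i (fun z => ∑ j ∈ s, F j z) y = ∑ j ∈ s, pd i (F j) y := by
  unfold pd; rw [fderiv_fun_sum fun j _ => (hF j).differentiableAt hy]; simp

lemma pd_comm (hh : SmoothOn U h) (hy : y ∈ U) (i j : Fin n) :
    pd i (pd j h) y = pd j (pd i h) y := by
  have hs := (hh y hy).isSymmSndFDerivAt (by simpa using WithTop.coe_le_coe.2 (le_top : (2 : ℕ∞) ≤ ⊤))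
  have hd : DifferentiableAt ℝ (fderiv ℝ h) y :=
    ((hh y hy).fderiv_right (m := ∞) (by simp)).differentiableAt (by simp)
  have key : ∀ a b : Fin n, pd a (pd b h) y
      = fderiv ℝ (fderiv ℝ h) y (EuclideanSpace.single a 1) (EuclideanSpace.single b 1) := by
    intro a b
    unfold pd
    rw [fderiv_clm_apply hd (by fun_prop)]
    simp
  rw [key, key, hs.eq]

lemma fderiv_apply_eq_sum_pd (h : EuclideanSpace ℝ (Fin n) → ℝ) (y v : EuclideanSpace ℝ (Fin n)) :
    fderiv ℝ h y v = ∑ a, v a * pd a h y := by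
  have hv : v = ∑ a, v a • EuclideanSpace.single a (1 : ℝ) := by
    ext b; simp [Pi.single_apply]
  conv_lhs => rw [hv]
  simp [pd]

lemma fderiv_coord {V : Set (EuclideanSpace ℝ (Fin m))}
    {ψ : EuclideanSpace ℝ (Fin m) → EuclideanSpace ℝ (Fin n)}
    (hψ : ∀ a, SmoothOn V (fun z => ψ z a)) {z : EuclideanSpace ℝ (Fin m)} (hz : z ∈ V)
    (v : EuclideanSpace ℝ (Fin m)) (a : Fin n) :
    (fderiv ℝ ψ z v) a = fderiv ℝ (fun z => ψ z a) z v := by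
  have hd : HasFDerivAt ψ (fderiv ℝ ψ z) z :=
    (differentiableAt_euclidean.2 fun a => (hψ a).differentiableAt hz).hasFDerivAt
  have := (((EuclideanSpace.proj a : EuclideanSpace ℝ (Fin n) →L[ℝ] ℝ).hasFDerivAt).comp z hd).fderiv
  exact (congrArg (fun L => L v) this).symm

lemma pd_comp {V : Set (EuclideanSpace ℝ (Fin m))}
    {ψ : EuclideanSpace ℝ (Fin m) → EuclideanSpace ℝ (Fin n)}
    (hh : SmoothOn U h) (hψ : ∀ a, SmoothOn V (fun z => ψ z a)) (hm : ∀ z ∈ V, ψ z ∈ U)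
    {z : EuclideanSpace ℝ (Fin m)} (hz : z ∈ V) (i : Fin m) :
    pd i (fun z => h (ψ z)) z = ∑ a, pd a h (ψ z) * pd i (fun z => ψ z a) z := by
  have hd : DifferentiableAt ℝ ψ z :=
    differentiableAt_euclidean.2 fun a => (hψ a).differentiableAt hz
  have : fderiv ℝ (fun z => h (ψ z)) z = (fderiv ℝ h (ψ z)).comp (fderiv ℝ ψ z) :=
    fderiv_comp z (hh.differentiableAt (hm z hz)) hd
  unfold pd
  rw [this, ContinuousLinearMap.comp_apply, fderiv_apply_eq_sum_pd]
  refine Finset.sum_congr rfl fun a _ => ?_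
  rw [fderiv_coord hψ hz, mul_comm]; rfl

lemma pd_coord (i j : Fin n) : pd i (fun y => y j) y = if j = i then 1 else 0 := by
  have : HasFDerivAt (fun y : EuclideanSpace ℝ (Fin n) => y j) (EuclideanSpace.proj j : _ →L[ℝ] ℝ) y :=
    (EuclideanSpace.proj j : EuclideanSpace ℝ (Fin n) →L[ℝ] ℝ).hasFDerivAt
  simp [pd, this.fderiv]

end calculus

section det

variable {U : Set (EuclideanSpace ℝ (Fin n))} {A : EuclideanSpace ℝ (Fin n) → Matrix (Fin m) (Fin m) ℝ}

lemma SmoothOn.det (hA : ∀ i j, SmoothOn U (fun y => A y i j)) : SmoothOn U (fun y => (A y).det) := by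
  simp only [Matrix.det_apply']
  exact SmoothOn.sum fun σ => (SmoothOn.const _).mul (SmoothOn.prod fun i => hA _ _)

lemma SmoothOn.matrix_inv (hA : ∀ i j, SmoothOn U (fun y => A y i j)) (h0 : ∀ y ∈ U, (A y).det ≠ 0)
    (i j : Fin m) : SmoothOn U (fun y => (A y)⁻¹ i j) := by
  have : (fun y => (A y)⁻¹ i j)
      = fun y => ((A y).updateRow j (Pi.single i 1)).det / (A y).det := by
    funext y
    rw [Matrix.inv_def, Matrix.smul_apply, Matrix.adjugate_apply, smul_eq_mul, Ring.inverse_eq_inv',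
      div_eq_inv_mul]
  rw [this]
  refine SmoothOn.div (SmoothOn.det fun a b => ?_) (SmoothOn.det hA) h0
  by_cases hab : a = j
  · subst hab; simpa using SmoothOn.const _
  · simpa [Matrix.updateRow_ne hab] using hA a b

end det

end Coord

namespace Coord

variable {n m : ℕ}

/-- A smooth field of nondegenerate symmetric matrices on an open set. -/
structure IsMetricOn (U : Set (EuclideanSpace ℝ (Fin n)))
    (g : EuclideanSpace ℝ (Fin n) → Matrix (Fin n) (Fin n) ℝ) : Prop where
  isOpen : IsOpen U
  smooth : ∀ i j, SmoothOn U (fun y => g y i j)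
  symm : ∀ y ∈ U, ∀ i j, g y i j = g y j i
  det_ne : ∀ y ∈ U, (g y).det ≠ 0

/-- The Christoffel symbol of the first kind. -/
noncomputable def christoffelLow (g : EuclideanSpace ℝ (Fin n) → Matrix (Fin n) (Fin n) ℝ)
    (k i j : Fin n) (y : EuclideanSpace ℝ (Fin n)) : ℝ :=
  (1 / 2) * (pd i (fun z => g z j k) y + pd j (fun z => g z i k) y - pd k (fun z => g z i j) y)

variable {U : Set (EuclideanSpace ℝ (Fin n))}
  {g : EuclideanSpace ℝ (Fin n) → Matrix (Fin n) (Fin n) ℝ} {y : EuclideanSpace ℝ (Fin n)}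

lemma christoffel_eq (k i j : Fin n) :
    christoffel g y k i j = ∑ l, (g y)⁻¹ k l * christoffelLow g l i j y := by
  simp only [christoffel, christoffelLow, Finset.mul_sum]
  exact Finset.sum_congr rfl fun _ _ => by ring

namespace IsMetricOn

lemma mono (hg : IsMetricOn U g) {V : Set (EuclideanSpace ℝ (Fin n))} (hV : IsOpen V)
    (h : V ⊆ U) : IsMetricOn V g :=
  ⟨hV, fun i j => (hg.smooth i j).mono h, fun y hy => hg.symm y (h hy),
    fun y hy => hg.det_ne y (h hy)⟩

lemma pd_symm (hg : IsMetricOn U g) (hy : y ∈ U) (k i j : Fin n) :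
    pd k (fun z => g z i j) y = pd k (fun z => g z j i) y :=
  pd_congr hg.isOpen hy (fun z hz => hg.symm z hz i j) k

lemma mul_inv (hg : IsMetricOn U g) (hy : y ∈ U) : g y * (g y)⁻¹ = 1 :=
  Matrix.mul_nonsing_inv _ (isUnit_iff_ne_zero.2 (hg.det_ne y hy))

lemma inv_mul (hg : IsMetricOn U g) (hy : y ∈ U) : (g y)⁻¹ * g y = 1 :=
  Matrix.nonsing_inv_mul _ (isUnit_iff_ne_zero.2 (hg.det_ne y hy))

lemma sum_mul_inv (hg : IsMetricOn U g) (hy : y ∈ U) (i j : Fin n) :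
    ∑ m, g y i m * (g y)⁻¹ m j = if i = j then 1 else 0 := by
  rw [← Matrix.mul_apply, hg.mul_inv hy, Matrix.one_apply]

lemma sum_inv_mul (hg : IsMetricOn U g) (hy : y ∈ U) (i j : Fin n) :
    ∑ m, (g y)⁻¹ i m * g y m j = if i = j then 1 else 0 := by
  rw [← Matrix.mul_apply, hg.inv_mul hy, Matrix.one_apply]

lemma inv_symm (hg : IsMetricOn U g) (hy : y ∈ U) (i j : Fin n) :
    (g y)⁻¹ i j = (g y)⁻¹ j i := by
  have ht : (g y).transpose = g y := by ext a b; exact hg.symm y hy b a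
  have : ((g y)⁻¹).transpose = (g y)⁻¹ := by rw [Matrix.transpose_nonsing_inv, ht]
  exact congrFun (congrFun this j) i

lemma smooth_inv (hg : IsMetricOn U g) (i j : Fin n) : SmoothOn U (fun y => (g y)⁻¹ i j) :=
  SmoothOn.matrix_inv hg.smooth hg.det_ne i j

lemma smooth_christoffelLow (hg : IsMetricOn U g) (k i j : Fin n) :
    SmoothOn U (christoffelLow g k i j) :=
  (SmoothOn.const _).mul
    ((((hg.smooth _ _).pd _).add ((hg.smooth _ _).pd _)).sub ((hg.smooth _ _).pd _))

lemma smooth_christoffel (hg : IsMetricOn U g) (k i j : Fin n) :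
    SmoothOn U (fun y => christoffel g y k i j) := by
  simp only [christoffel_eq]
  exact SmoothOn.sum fun l => (hg.smooth_inv _ _).mul (hg.smooth_christoffelLow _ _ _)

lemma smooth_riemannUp (hg : IsMetricOn U g) (l k i j : Fin n) :
    SmoothOn U (fun y => riemannUp g y l k i j) :=
  (((hg.smooth_christoffel _ _ _).pd _).sub ((hg.smooth_christoffel _ _ _).pd _)).add
    (SmoothOn.sum fun _ => ((hg.smooth_christoffel _ _ _).mul (hg.smooth_christoffel _ _ _)).sub
      ((hg.smooth_christoffel _ _ _).mul (hg.smooth_christoffel _ _ _)))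

lemma smooth_riemann (hg : IsMetricOn U g) (i j k l : Fin n) :
    SmoothOn U (fun y => riemann g y i j k l) :=
  SmoothOn.sum fun _ => (hg.smooth _ _).mul (hg.smooth_riemannUp _ _ _ _)

lemma smooth_ricci (hg : IsMetricOn U g) (j l : Fin n) : SmoothOn U (fun y => ricci g y j l) :=
  SmoothOn.sum fun _ => SmoothOn.sum fun _ => (hg.smooth_inv _ _).mul (hg.smooth_riemann _ _ _ _)

lemma christoffelLow_symm (hg : IsMetricOn U g) (hy : y ∈ U) (k i j : Fin n) :
    christoffelLow g k i j y = christoffelLow g k j i y := by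
  simp only [christoffelLow, hg.pd_symm hy k i j]; ring

lemma christoffel_symm (hg : IsMetricOn U g) (hy : y ∈ U) (k i j : Fin n) :
    christoffel g y k i j = christoffel g y k j i := by
  simp only [christoffel_eq, hg.christoffelLow_symm hy _ i j]

lemma sum_mul_christoffel (hg : IsMetricOn U g) (hy : y ∈ U) (k i j : Fin n) :
    ∑ m, g y k m * christoffel g y m i j = christoffelLow g k i j y := by
  simp only [christoffel_eq, Finset.mul_sum]
  rw [Finset.sum_comm]
  simp only [← mul_assoc, ← Finset.sum_mul, hg.sum_mul_inv hy]
  simp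

lemma pd_metric (hg : IsMetricOn U g) (hy : y ∈ U) (a i j : Fin n) :
    pd a (fun z => g z i j) y = christoffelLow g j a i y + christoffelLow g i a j y := by
  rw [christoffelLow, christoffelLow, hg.pd_symm hy a j i]
  ring

/-- The quadratic expression `⟨Γ_{ij}, Γ_{kl}⟩`. -/
lemma sum_christoffel_mul_christoffelLow_symm (hg : IsMetricOn U g) (hy : y ∈ U)
    (i j k l : Fin n) :
    ∑ m, christoffel g y m i j * christoffelLow g m k l y
      = ∑ m, christoffel g y m k l * christoffelLow g m i j y := by
  simp only [← hg.sum_mul_christoffel hy, Finset.mul_sum]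
  rw [Finset.sum_comm]
  refine Finset.sum_congr rfl fun a _ => Finset.sum_congr rfl fun b _ => ?_
  rw [hg.symm y hy a b]; ring

lemma riemann_eq (hg : IsMetricOn U g) (hy : y ∈ U) (i j k l : Fin n) :
    riemann g y i j k l = pd i (christoffelLow g k j l) y - pd j (christoffelLow g k i l) y
      - ∑ m, christoffel g y m j l * christoffelLow g m i k y
      + ∑ m, christoffel g y m i l * christoffelLow g m j k y := by
  have key : ∀ i j : Fin n, ∑ m, g y k m * pd i (fun z => christoffel g z m j l) y
      = pd i (christoffelLow g k j l) y - ∑ m, (christoffel g y m j l * christoffelLow g m i k y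
          + christoffel g y m j l * christoffelLow g k i m y) := by
    intro i j
    have h1 : pd i (christoffelLow g k j l) y
        = pd i (fun z => ∑ m, g z k m * christoffel g z m j l) y :=
      pd_congr hg.isOpen hy (fun z hz => (hg.sum_mul_christoffel hz k j l).symm) i
    rw [h1, pd_sum (fun m => (hg.smooth k m).mul (hg.smooth_christoffel m j l)) hy,
      ← Finset.sum_sub_distrib]
    refine Finset.sum_congr rfl fun m _ => ?_
    rw [pd_mul (hg.smooth k m) (hg.smooth_christoffel m j l) hy, hg.pd_metric hy]
    ring
  have key2 : ∀ i j : Fin n, ∑ m, g y k m * ∑ p, christoffel g y m i p * christoffel g y p j l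
      = ∑ p, christoffel g y p j l * christoffelLow g k i p y := by
    intro i j
    simp only [Finset.mul_sum, ← hg.sum_mul_christoffel hy]
    rw [Finset.sum_comm]
    exact Finset.sum_congr rfl fun a _ => Finset.sum_congr rfl fun b _ => by ring
  simp only [riemann, riemannUp, mul_add, mul_sub, Finset.sum_add_distrib, Finset.sum_sub_distrib]
  rw [key, key, key2, key2]
  simp only [Finset.sum_add_distrib]
  ring

lemma pd_christoffelLow (hg : IsMetricOn U g) (hy : y ∈ U) (a k i j : Fin n) :
    pd a (christoffelLow g k i j) y = (1 / 2) * (pd a (pd i (fun z => g z j k)) y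
      + pd a (pd j (fun z => g z i k)) y - pd a (pd k (fun z => g z i j)) y) := by
  have h1 := fun i j k => (hg.smooth j k).pd i
  have : christoffelLow g k i j = fun z => (1 / 2) * (pd i (fun z => g z j k) z
      + pd j (fun z => g z i k) z - pd k (fun z => g z i j) z) := rfl
  rw [this, pd_const_mul _ (((h1 _ _ _).add (h1 _ _ _)).sub (h1 _ _ _)) hy,
    pd_sub ((h1 _ _ _).add (h1 _ _ _)) (h1 _ _ _) hy, pd_add (h1 _ _ _) (h1 _ _ _) hy]

lemma riemann_eq_second_derivatives (hg : IsMetricOn U g) (hy : y ∈ U) (i j k l : Fin n) :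
    riemann g y i j k l = (1 / 2) * (pd i (pd l (fun z => g z j k)) y
        - pd i (pd k (fun z => g z j l)) y - pd j (pd l (fun z => g z i k)) y
        + pd j (pd k (fun z => g z i l)) y)
      - ∑ m, christoffel g y m j l * christoffelLow g m i k y
      + ∑ m, christoffel g y m i l * christoffelLow g m j k y := by
  rw [hg.riemann_eq hy, hg.pd_christoffelLow hy, hg.pd_christoffelLow hy,
    pd_comm (hg.smooth l k) hy i j]
  ring

lemma pd_pd_symm (hg : IsMetricOn U g) (hy : y ∈ U) (a b i j : Fin n) :
    pd a (pd b (fun z => g z i j)) y = pd a (pd b (fun z => g z j i)) y :=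
  pd_congr hg.isOpen hy (fun _ hz => hg.pd_symm hz b i j) a

lemma riemann_pair_symm (hg : IsMetricOn U g) (hy : y ∈ U) (i j k l : Fin n) :
    riemann g y i j k l = riemann g y k l i j := by
  have h1 : ∑ m, christoffel g y m l j * christoffelLow g m k i y
      = ∑ m, christoffel g y m j l * christoffelLow g m i k y :=
    Finset.sum_congr rfl fun m _ => by
      rw [hg.christoffel_symm hy m l j, hg.christoffelLow_symm hy m k i]
  have h2 : ∑ m, christoffel g y m k j * christoffelLow g m l i y
      = ∑ m, christoffel g y m i l * christoffelLow g m j k y := by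
    rw [hg.sum_christoffel_mul_christoffelLow_symm hy]
    exact Finset.sum_congr rfl fun m _ => by
      rw [hg.christoffel_symm hy m l i, hg.christoffelLow_symm hy m k j]
  rw [hg.riemann_eq_second_derivatives hy, hg.riemann_eq_second_derivatives hy,
    pd_comm (hg.smooth _ _) hy i l, pd_comm (hg.smooth _ _) hy i k,
    pd_comm (hg.smooth _ _) hy j l, pd_comm (hg.smooth _ _) hy j k,
    hg.pd_pd_symm hy l i j k, hg.pd_pd_symm hy k i j l, hg.pd_pd_symm hy l j i k,
    hg.pd_pd_symm hy k j i l, h1, h2]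
  ring

lemma riemann_antisymm_left (i j k l : Fin n) :
    riemann g y i j k l = - riemann g y j i k l := by
  simp only [riemann, ← Finset.sum_neg_distrib]
  refine Finset.sum_congr rfl fun m _ => ?_
  simp only [riemannUp, Finset.sum_sub_distrib]
  ring

lemma riemann_antisymm_right (hg : IsMetricOn U g) (hy : y ∈ U) (i j k l : Fin n) :
    riemann g y i j k l = - riemann g y i j l k := by
  rw [hg.riemann_pair_symm hy, riemann_antisymm_left, hg.riemann_pair_symm hy]

lemma ricci_eq (hg : IsMetricOn U g) (hy : y ∈ U) (j l : Fin n) :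
    ricci g y j l = ∑ i, riemannUp g y i l i j := by
  simp only [ricci, riemann, Finset.mul_sum, ← mul_assoc]
  refine Finset.sum_congr rfl fun i _ => ?_
  rw [Finset.sum_comm]
  simp only [← Finset.sum_mul, hg.sum_inv_mul hy]
  simp

lemma ricci_symm (hg : IsMetricOn U g) (hy : y ∈ U) (j l : Fin n) :
    ricci g y j l = ricci g y l j := by
  simp only [ricci]
  rw [Finset.sum_comm]
  refine Finset.sum_congr rfl fun a _ => Finset.sum_congr rfl fun b _ => ?_
  rw [hg.inv_symm hy, hg.riemann_pair_symm hy]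

end IsMetricOn

end Coord

namespace Coord

variable {n m : ℕ}

/-- The bilinear form of a matrix. -/
def form (A : Matrix (Fin n) (Fin n) ℝ) (u v : Fin n → ℝ) : ℝ := ∑ a, ∑ b, A a b * u a * v b

lemma form_add_left (A : Matrix (Fin n) (Fin n) ℝ) (u u' v : Fin n → ℝ) :
    form A (fun a => u a + u' a) v = form A u v + form A u' v := by
  simp only [form, ← Finset.sum_add_distrib]
  exact Finset.sum_congr rfl fun a _ => Finset.sum_congr rfl fun b _ => by ring

lemma form_sub_left (A : Matrix (Fin n) (Fin n) ℝ) (u u' v : Fin n → ℝ) :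
    form A (fun a => u a - u' a) v = form A u v - form A u' v := by
  simp only [form, ← Finset.sum_sub_distrib]
  exact Finset.sum_congr rfl fun a _ => Finset.sum_congr rfl fun b _ => by ring

lemma form_sum_left {ι : Type*} (s : Finset ι) (A : Matrix (Fin n) (Fin n) ℝ) (c : ι → ℝ)
    (u : ι → Fin n → ℝ) (v : Fin n → ℝ) :
    form A (fun a => ∑ i ∈ s, c i * u i a) v = ∑ i ∈ s, c i * form A (u i) v := by
  simp only [form, Finset.mul_sum, Finset.sum_mul]
  calc _ = ∑ a, ∑ i ∈ s, ∑ b, A a b * (c i * u i a) * v b :=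
        Finset.sum_congr rfl fun a _ => Finset.sum_comm
    _ = ∑ i ∈ s, ∑ a, ∑ b, A a b * (c i * u i a) * v b := Finset.sum_comm
    _ = _ := Finset.sum_congr rfl fun i _ => Finset.sum_congr rfl fun a _ =>
        Finset.sum_congr rfl fun b _ => by ring

lemma form_symm {A : Matrix (Fin n) (Fin n) ℝ} (hA : ∀ i j, A i j = A j i) (u v : Fin n → ℝ) :
    form A u v = form A v u := by
  simp only [form]
  rw [Finset.sum_comm]
  exact Finset.sum_congr rfl fun a _ => Finset.sum_congr rfl fun b _ => by rw [hA]; ring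

lemma form_eq_dotProduct (A : Matrix (Fin n) (Fin n) ℝ) (u v : Fin n → ℝ) :
    form A u v = u ⬝ᵥ A.mulVec v := by
  simp only [form, dotProduct, Matrix.mulVec, Finset.mul_sum]
  exact Finset.sum_congr rfl fun a _ => Finset.sum_congr rfl fun b _ => by ring

/-- The curvature as a quadrilinear form. -/
noncomputable def riemannForm (g : EuclideanSpace ℝ (Fin n) → Matrix (Fin n) (Fin n) ℝ)
    (y : EuclideanSpace ℝ (Fin n)) (u v w x : Fin n → ℝ) : ℝ :=
  ∑ a, ∑ b, ∑ c, ∑ d, riemann g y a b c d * u a * v b * w c * x d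

/-- The entries `∂_i ψ^a` of the Jacobian matrix of `ψ`. -/
noncomputable def jac (ψ : EuclideanSpace ℝ (Fin m) → EuclideanSpace ℝ (Fin n)) (i : Fin m) (a : Fin n)
    (z : EuclideanSpace ℝ (Fin m)) : ℝ := pd i (fun z => ψ z a) z

/-- The covariant derivative, in the direction of the `i`-th coordinate, of a vector field along `ψ`. -/
noncomputable def covAlong (G : EuclideanSpace ℝ (Fin n) → Matrix (Fin n) (Fin n) ℝ)
    (ψ : EuclideanSpace ℝ (Fin m) → EuclideanSpace ℝ (Fin n)) (i : Fin m)
    (X : Fin n → EuclideanSpace ℝ (Fin m) → ℝ) (a : Fin n) (z : EuclideanSpace ℝ (Fin m)) : ℝ :=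
  pd i (X a) z + ∑ b, ∑ c, christoffel G (ψ z) a b c * jac ψ i b z * X c z

/-- The metric `g` on `V` is the pullback of the metric `G` on `U` under `ψ`. -/
structure IsPullback (U : Set (EuclideanSpace ℝ (Fin n)))
    (G : EuclideanSpace ℝ (Fin n) → Matrix (Fin n) (Fin n) ℝ)
    (V : Set (EuclideanSpace ℝ (Fin m)))
    (g : EuclideanSpace ℝ (Fin m) → Matrix (Fin m) (Fin m) ℝ)
    (ψ : EuclideanSpace ℝ (Fin m) → EuclideanSpace ℝ (Fin n)) : Prop where
  metric : IsMetricOn U G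
  metric' : IsMetricOn V g
  smooth : ∀ a, SmoothOn V (fun z => ψ z a)
  mapsTo : ∀ z ∈ V, ψ z ∈ U
  eq : ∀ z ∈ V, ∀ i j, g z i j = form (G (ψ z)) (fun a => jac ψ i a z) (fun a => jac ψ j a z)

namespace IsPullback

variable {U : Set (EuclideanSpace ℝ (Fin n))}
  {G : EuclideanSpace ℝ (Fin n) → Matrix (Fin n) (Fin n) ℝ} {V : Set (EuclideanSpace ℝ (Fin m))}
  {g : EuclideanSpace ℝ (Fin m) → Matrix (Fin m) (Fin m) ℝ}
  {ψ : EuclideanSpace ℝ (Fin m) → EuclideanSpace ℝ (Fin n)} {z : EuclideanSpace ℝ (Fin m)}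

lemma smooth_jac (H : IsPullback U G V g ψ) (i : Fin m) (a : Fin n) : SmoothOn V (jac ψ i a) :=
  (H.smooth a).pd i

lemma smooth_comp (H : IsPullback U G V g ψ) {h : EuclideanSpace ℝ (Fin n) → ℝ}
    (hh : SmoothOn U h) : SmoothOn V (fun z => h (ψ z)) := hh.comp H.smooth H.mapsTo

lemma pd_comp (H : IsPullback U G V g ψ) {h : EuclideanSpace ℝ (Fin n) → ℝ}
    (hh : SmoothOn U h) (hz : z ∈ V) (i : Fin m) :
    pd i (fun z => h (ψ z)) z = ∑ a, pd a h (ψ z) * jac ψ i a z :=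
  Coord.pd_comp hh H.smooth H.mapsTo hz i

lemma smooth_covAlong (H : IsPullback U G V g ψ) {X : Fin n → EuclideanSpace ℝ (Fin m) → ℝ}
    (hX : ∀ a, SmoothOn V (X a)) (i : Fin m) (a : Fin n) : SmoothOn V (covAlong G ψ i X a) :=
  ((hX a).pd i).add (SmoothOn.sum fun _ => SmoothOn.sum fun _ =>
    ((H.smooth_comp (H.metric.smooth_christoffel _ _ _)).mul (H.smooth_jac _ _)).mul (hX _))

/-- The product rule for the metric along `ψ`. -/
lemma pd_form (H : IsPullback U G V g ψ) {X Y : Fin n → EuclideanSpace ℝ (Fin m) → ℝ}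
    (hX : ∀ a, SmoothOn V (X a)) (hY : ∀ a, SmoothOn V (Y a)) (hz : z ∈ V) (i : Fin m) :
    pd i (fun z => form (G (ψ z)) (fun a => X a z) (fun a => Y a z)) z
      = form (G (ψ z)) (fun a => covAlong G ψ i X a z) (fun a => Y a z)
        + form (G (ψ z)) (fun a => X a z) (fun a => covAlong G ψ i Y a z) := by
  have hG := fun a b => H.smooth_comp (H.metric.smooth a b)
  have h1 : pd i (fun z => form (G (ψ z)) (fun a => X a z) (fun a => Y a z)) z
      = ∑ a, ∑ b, ((∑ c, pd c (fun y => G y a b) (ψ z) * jac ψ i c z) * X a z * Y b z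
          + G (ψ z) a b * pd i (X a) z * Y b z + G (ψ z) a b * X a z * pd i (Y b) z) := by
    simp only [form]
    rw [pd_sum (fun a => SmoothOn.sum fun b => ((hG a b).mul (hX a)).mul (hY b)) hz]
    refine Finset.sum_congr rfl fun a _ => ?_
    rw [pd_sum (fun b => ((hG a b).mul (hX a)).mul (hY b)) hz]
    refine Finset.sum_congr rfl fun b _ => ?_
    rw [pd_mul ((hG a b).mul (hX a)) (hY b) hz, pd_mul (hG a b) (hX a) hz,
      H.pd_comp (H.metric.smooth a b) hz]
    ring
  have hc : ∀ a b, ∑ c, pd c (fun y => G y a b) (ψ z) * jac ψ i c z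
      = ∑ d, G (ψ z) d b * ∑ c, christoffel G (ψ z) d c a * jac ψ i c z
        + ∑ d, G (ψ z) a d * ∑ c, christoffel G (ψ z) d c b * jac ψ i c z := by
    intro a b
    simp only [H.metric.pd_metric (H.mapsTo z hz), ← H.metric.sum_mul_christoffel (H.mapsTo z hz),
      add_mul, Finset.sum_add_distrib, Finset.sum_mul, Finset.mul_sum]
    congr 1 <;> rw [Finset.sum_comm] <;>
    refine Finset.sum_congr rfl fun d _ => Finset.sum_congr rfl fun c _ => ?_
    · rw [H.metric.symm _ (H.mapsTo z hz) b d]; ring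
    · ring
  have e1 : ∀ X Y : Fin n → EuclideanSpace ℝ (Fin m) → ℝ,
      form (G (ψ z)) (fun a => ∑ b, ∑ c, christoffel G (ψ z) a b c * jac ψ i b z * X c z)
      (fun a => Y a z) = ∑ a, ∑ b, (∑ d, G (ψ z) d b *
        ∑ c, christoffel G (ψ z) d c a * jac ψ i c z) * X a z * Y b z := by
    intro X Y
    have : (fun a => ∑ b, ∑ c, christoffel G (ψ z) a b c * jac ψ i b z * X c z)
        = fun a => ∑ c, X c z * ∑ b, christoffel G (ψ z) a b c * jac ψ i b z := by
      funext a
      rw [Finset.sum_comm]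
      refine Finset.sum_congr rfl fun c _ => ?_
      rw [Finset.mul_sum]
      exact Finset.sum_congr rfl fun b _ => by ring
    rw [this, form_sum_left]
    refine Finset.sum_congr rfl fun a _ => ?_
    simp only [form]
    rw [Finset.sum_comm, Finset.mul_sum]
    refine Finset.sum_congr rfl fun b _ => ?_
    rw [← Finset.sum_mul]; ring
  have e2 : form (G (ψ z)) (fun a => X a z)
      (fun a => ∑ b, ∑ c, christoffel G (ψ z) a b c * jac ψ i b z * Y c z)
      = ∑ a, ∑ b, (∑ d, G (ψ z) a d *
        ∑ c, christoffel G (ψ z) d c b * jac ψ i c z) * X a z * Y b z := by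
    rw [form_symm (H.metric.symm _ (H.mapsTo z hz)), e1 Y X, Finset.sum_comm]
    refine Finset.sum_congr rfl fun a _ => Finset.sum_congr rfl fun b _ => ?_
    simp only [H.metric.symm _ (H.mapsTo z hz) _ a]
    ring
  have hsym := form_symm (H.metric.symm _ (H.mapsTo z hz))
  rw [h1]
  simp only [covAlong]
  rw [form_add_left, hsym (fun a => X a z), form_add_left, hsym _ (fun a => X a z),
    hsym _ (fun a => X a z), e1 X Y, e2]
  simp only [hc, form, ← Finset.sum_add_distrib]
  refine Finset.sum_congr rfl fun a _ => Finset.sum_congr rfl fun b _ => ?_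
  rw [Finset.sum_add_distrib]
  ring

end IsPullback
end Coord

namespace Coord

variable {n m : ℕ}

lemma sum_comm₃ {ι κ τ : Type*} (s : Finset ι) (t : Finset κ) (r : Finset τ) (F : ι → κ → τ → ℝ) :
    ∑ a ∈ s, ∑ b ∈ t, ∑ c ∈ r, F a b c = ∑ c ∈ r, ∑ a ∈ s, ∑ b ∈ t, F a b c := by
  rw [Finset.sum_comm (s := r)]
  exact Finset.sum_congr rfl fun a _ => Finset.sum_comm

namespace IsPullback

variable {U : Set (EuclideanSpace ℝ (Fin n))}
  {G : EuclideanSpace ℝ (Fin n) → Matrix (Fin n) (Fin n) ℝ} {V : Set (EuclideanSpace ℝ (Fin m))}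
  {g : EuclideanSpace ℝ (Fin m) → Matrix (Fin m) (Fin m) ℝ}
  {ψ : EuclideanSpace ℝ (Fin m) → EuclideanSpace ℝ (Fin n)} {z : EuclideanSpace ℝ (Fin m)}

lemma jac_symm (H : IsPullback U G V g ψ) (hz : z ∈ V) (i j : Fin m) (a : Fin n) :
    pd i (jac ψ j a) z = pd j (jac ψ i a) z := pd_comm (H.smooth a) hz i j

lemma covAlong_jac_symm (H : IsPullback U G V g ψ) (hz : z ∈ V) (i j : Fin m) (a : Fin n) :
    covAlong G ψ i (jac ψ j) a z = covAlong G ψ j (jac ψ i) a z := by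
  simp only [covAlong]
  rw [H.jac_symm hz, Finset.sum_comm]
  congr 1
  refine Finset.sum_congr rfl fun b _ => Finset.sum_congr rfl fun c _ => ?_
  rw [H.metric.christoffel_symm (H.mapsTo z hz)]; ring

lemma pd_covAlong (H : IsPullback U G V g ψ) {X : Fin n → EuclideanSpace ℝ (Fin m) → ℝ}
    (hX : ∀ a, SmoothOn V (X a)) (hz : z ∈ V) (i j : Fin m) (a : Fin n) :
    pd i (covAlong G ψ j X a) z = pd i (pd j (X a)) z
      + ∑ b, ∑ c, ((∑ d, pd d (fun y => christoffel G y a b c) (ψ z) * jac ψ i d z)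
            * jac ψ j b z * X c z
          + christoffel G (ψ z) a b c * pd i (jac ψ j b) z * X c z
          + christoffel G (ψ z) a b c * jac ψ j b z * pd i (X c) z) := by
  have hC := fun b c => H.smooth_comp (H.metric.smooth_christoffel a b c)
  have h1 := fun b c => ((hC b c).mul (H.smooth_jac j b)).mul (hX c)
  have : covAlong G ψ j X a = fun z => pd j (X a) z
      + ∑ b, ∑ c, christoffel G (ψ z) a b c * jac ψ j b z * X c z := rfl
  rw [this, pd_add ((hX a).pd j) (SmoothOn.sum fun b => SmoothOn.sum fun c => h1 b c) hz,
    pd_sum (fun b => SmoothOn.sum fun c => h1 b c) hz]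
  congr 1
  refine Finset.sum_congr rfl fun b _ => ?_
  rw [pd_sum (fun c => h1 b c) hz]
  refine Finset.sum_congr rfl fun c _ => ?_
  rw [pd_mul ((hC b c).mul (H.smooth_jac j b)) (hX c) hz, pd_mul (hC b c) (H.smooth_jac j b) hz,
    H.pd_comp (H.metric.smooth_christoffel a b c) hz]
  ring

/-- The commutator of covariant derivatives along `ψ`. -/
lemma covAlong_comm (H : IsPullback U G V g ψ) {X : Fin n → EuclideanSpace ℝ (Fin m) → ℝ}
    (hX : ∀ a, SmoothOn V (X a)) (hz : z ∈ V) (i j : Fin m) (a : Fin n) :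
    covAlong G ψ i (covAlong G ψ j X) a z - covAlong G ψ j (covAlong G ψ i X) a z
      = ∑ d, ∑ b, ∑ c, riemannUp G (ψ z) a d b c * X d z * jac ψ i b z * jac ψ j c z := by
  set Γ := christoffel G (ψ z)
  set P := fun d b c => pd d (fun y => christoffel G y a b c) (ψ z)
  set J := fun i a => jac ψ i a z
  set x := fun a => X a z
  have T1 : ∀ i j, ∑ b, ∑ c, (∑ d, P d b c * J i d) * J j b * x c
      = ∑ d, ∑ b, ∑ c, P b c d * x d * J i b * J j c := by
    intro i j
    rw [Finset.sum_comm]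
    refine Finset.sum_congr rfl fun d _ => ?_
    simp only [Finset.sum_mul]
    rw [Finset.sum_comm]
    exact Finset.sum_congr rfl fun b _ => Finset.sum_congr rfl fun c _ => by ring
  have T2 : ∀ i j, ∑ b, ∑ c, Γ a b c * J i b * ∑ d, ∑ e, Γ c d e * J j d * x e
      = ∑ d, ∑ b, ∑ c, (∑ m, Γ a b m * Γ m c d) * x d * J i b * J j c := by
    intro i j
    simp only [Finset.sum_mul, Finset.mul_sum]
    calc _ = ∑ b, ∑ d, ∑ m, ∑ c, Γ a b m * J i b * (Γ m c d * J j c * x d) :=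
          Finset.sum_congr rfl fun b _ => sum_comm₃ _ _ _ _
      _ = ∑ d, ∑ b, ∑ m, ∑ c, Γ a b m * J i b * (Γ m c d * J j c * x d) := Finset.sum_comm
      _ = ∑ d, ∑ b, ∑ c, ∑ m, Γ a b m * J i b * (Γ m c d * J j c * x d) :=
          Finset.sum_congr rfl fun d _ => Finset.sum_congr rfl fun b _ => Finset.sum_comm
      _ = _ := Finset.sum_congr rfl fun d _ => Finset.sum_congr rfl fun b _ =>
          Finset.sum_congr rfl fun c _ => Finset.sum_congr rfl fun m _ => by ring
  have T1' : ∑ d, ∑ b, ∑ c, P c b d * x d * J i b * J j c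
      = ∑ b, ∑ c, (∑ d, P d b c * J j d) * J i b * x c := by
    rw [T1]
    refine Finset.sum_congr rfl fun d _ => ?_
    rw [Finset.sum_comm]
    exact Finset.sum_congr rfl fun b _ => Finset.sum_congr rfl fun c _ => by ring
  have T2' : ∑ d, ∑ b, ∑ c, (∑ m, Γ a c m * Γ m b d) * x d * J i b * J j c
      = ∑ b, ∑ c, Γ a b c * J j b * ∑ d, ∑ e, Γ c d e * J i d * x e := by
    rw [T2]
    refine Finset.sum_congr rfl fun d _ => ?_
    rw [Finset.sum_comm]
    exact Finset.sum_congr rfl fun b _ => Finset.sum_congr rfl fun c _ => by ring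
  have hR : ∑ d, ∑ b, ∑ c, riemannUp G (ψ z) a d b c * X d z * jac ψ i b z * jac ψ j c z
      = ∑ d, ∑ b, ∑ c, P b c d * x d * J i b * J j c
        - ∑ d, ∑ b, ∑ c, P c b d * x d * J i b * J j c
        + ∑ d, ∑ b, ∑ c, (∑ m, Γ a b m * Γ m c d) * x d * J i b * J j c
        - ∑ d, ∑ b, ∑ c, (∑ m, Γ a c m * Γ m b d) * x d * J i b * J j c := by
    simp only [← Finset.sum_add_distrib, ← Finset.sum_sub_distrib]
    refine Finset.sum_congr rfl fun d _ => Finset.sum_congr rfl fun b _ =>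
      Finset.sum_congr rfl fun c _ => ?_
    simp only [riemannUp, Finset.sum_sub_distrib, P, x, J, Γ]
    ring
  have hL : ∀ i j, covAlong G ψ i (covAlong G ψ j X) a z = pd i (pd j (X a)) z
      + (∑ b, ∑ c, (∑ d, P d b c * J i d) * J j b * x c
      + ∑ b, ∑ c, Γ a b c * pd i (jac ψ j b) z * x c
      + ∑ b, ∑ c, Γ a b c * J j b * pd i (X c) z)
      + (∑ b, ∑ c, Γ a b c * J i b * pd j (X c) z
      + ∑ b, ∑ c, Γ a b c * J i b * ∑ d, ∑ e, Γ c d e * J j d * x e) := by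
    intro i j
    rw [covAlong, H.pd_covAlong hX hz]
    simp only [← Finset.sum_add_distrib]
    congr 1
    refine Finset.sum_congr rfl fun b _ => Finset.sum_congr rfl fun c _ => ?_
    rw [covAlong]
    simp only [x, J, Γ]
    ring
  rw [hR, T1', T2', hL, hL, ← T1 i j, ← T2 i j, pd_comm (hX a) hz i j]
  simp only [H.jac_symm hz i j]
  ring

end IsPullback
end Coord

namespace Coord

variable {n m : ℕ}

/-- The second fundamental form `∇_i ∂_j ψ - Γ^k_{ij} ∂_k ψ` of an isometric immersion `ψ` from
the metric `g` to the metric `G`. -/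
noncomputable def secondFund (G : EuclideanSpace ℝ (Fin n) → Matrix (Fin n) (Fin n) ℝ)
    (g : EuclideanSpace ℝ (Fin m) → Matrix (Fin m) (Fin m) ℝ)
    (ψ : EuclideanSpace ℝ (Fin m) → EuclideanSpace ℝ (Fin n)) (z : EuclideanSpace ℝ (Fin m))
    (i j : Fin m) (a : Fin n) : ℝ :=
  covAlong G ψ i (jac ψ j) a z - ∑ k, christoffel g z k i j * jac ψ k a z

namespace IsPullback

variable {U : Set (EuclideanSpace ℝ (Fin n))}
  {G : EuclideanSpace ℝ (Fin n) → Matrix (Fin n) (Fin n) ℝ} {V : Set (EuclideanSpace ℝ (Fin m))}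
  {g : EuclideanSpace ℝ (Fin m) → Matrix (Fin m) (Fin m) ℝ}
  {ψ : EuclideanSpace ℝ (Fin m) → EuclideanSpace ℝ (Fin n)} {z : EuclideanSpace ℝ (Fin m)}

lemma form_comm (H : IsPullback U G V g ψ) (hz : z ∈ V) (u v : Fin n → ℝ) :
    form (G (ψ z)) u v = form (G (ψ z)) v u :=
  form_symm (H.metric.symm _ (H.mapsTo z hz)) u v

lemma christoffelLow_eq (H : IsPullback U G V g ψ) (hz : z ∈ V) (k i j : Fin m) :
    christoffelLow g k i j z
      = form (G (ψ z)) (fun a => covAlong G ψ i (jac ψ j) a z) (fun a => jac ψ k a z) := by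
  have h : ∀ i j k, pd i (fun z => g z j k) z
      = form (G (ψ z)) (fun a => covAlong G ψ i (jac ψ j) a z) (fun a => jac ψ k a z)
        + form (G (ψ z)) (fun a => covAlong G ψ i (jac ψ k) a z) (fun a => jac ψ j a z) := by
    intro i j k
    rw [pd_congr H.metric'.isOpen hz (fun z hz => H.eq z hz j k),
      H.pd_form (H.smooth_jac j) (H.smooth_jac k) hz, H.form_comm hz (fun a => jac ψ j a z)]
  rw [christoffelLow, h, h, h]
  simp only [H.covAlong_jac_symm hz j i, H.covAlong_jac_symm hz k i, H.covAlong_jac_symm hz k j]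
  ring

lemma form_secondFund_jac (H : IsPullback U G V g ψ) (hz : z ∈ V) (i j k : Fin m) :
    form (G (ψ z)) (secondFund G g ψ z i j) (fun a => jac ψ k a z) = 0 := by
  have : secondFund G g ψ z i j = fun a => covAlong G ψ i (jac ψ j) a z
    - ∑ k, christoffel g z k i j * jac ψ k a z := rfl
  rw [this, form_sub_left, form_sum_left _ _ _ (fun k a => jac ψ k a z),
    ← H.christoffelLow_eq hz, ← H.metric'.sum_mul_christoffel hz]
  simp only [← H.eq z hz]
  rw [sub_eq_zero]
  exact Finset.sum_congr rfl fun l _ => by rw [H.metric'.symm z hz k l, mul_comm]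

lemma form_secondFund (H : IsPullback U G V g ψ) (hz : z ∈ V) (i j k l : Fin m) :
    form (G (ψ z)) (secondFund G g ψ z i j) (secondFund G g ψ z k l)
      = form (G (ψ z)) (fun a => covAlong G ψ i (jac ψ j) a z)
          (fun a => covAlong G ψ k (jac ψ l) a z)
        - ∑ p, christoffel g z p i j * christoffelLow g p k l z := by
  have e : ∀ i j, secondFund G g ψ z i j = fun a => covAlong G ψ i (jac ψ j) a z
    - ∑ k, christoffel g z k i j * jac ψ k a z := fun _ _ => rfl
  rw [H.form_comm hz, e k l, form_sub_left, form_sum_left _ _ _ (fun k a => jac ψ k a z)]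
  simp only [H.form_comm hz _ (secondFund G g ψ z i j), H.form_secondFund_jac hz]
  rw [e i j, form_sub_left, form_sum_left _ _ _ (fun k a => jac ψ k a z)]
  simp only [H.christoffelLow_eq hz _ k l, H.form_comm hz _ (fun a => covAlong G ψ k (jac ψ l) a z)]
  simp

/-- The Gauss equation. -/
theorem riemann_eq (H : IsPullback U G V g ψ) (hz : z ∈ V) (i j k l : Fin m) :
    riemann g z i j k l
      = riemannForm G (ψ z) (fun a => jac ψ i a z) (fun a => jac ψ j a z) (fun a => jac ψ k a z)
          (fun a => jac ψ l a z)
        + form (G (ψ z)) (secondFund G g ψ z j l) (secondFund G g ψ z i k)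
        - form (G (ψ z)) (secondFund G g ψ z i l) (secondFund G g ψ z j k) := by
  have hS := fun (i j : Fin m) => fun a => H.smooth_covAlong (H.smooth_jac j) i a
  have hd : ∀ i j, pd i (christoffelLow g k j l) z
      = form (G (ψ z)) (fun a => covAlong G ψ i (covAlong G ψ j (jac ψ l)) a z)
          (fun a => jac ψ k a z)
        + form (G (ψ z)) (fun a => covAlong G ψ j (jac ψ l) a z)
          (fun a => covAlong G ψ i (jac ψ k) a z) := by
    intro i j
    rw [pd_congr H.metric'.isOpen hz (fun z hz => H.christoffelLow_eq hz k j l),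
      H.pd_form (hS j l) (H.smooth_jac k) hz]
  have hR : form (G (ψ z)) (fun a => covAlong G ψ i (covAlong G ψ j (jac ψ l)) a z)
          (fun a => jac ψ k a z) - form (G (ψ z))
            (fun a => covAlong G ψ j (covAlong G ψ i (jac ψ l)) a z) (fun a => jac ψ k a z)
      = riemannForm G (ψ z) (fun a => jac ψ i a z) (fun a => jac ψ j a z) (fun a => jac ψ k a z)
          (fun a => jac ψ l a z) := by
    rw [← form_sub_left]
    simp only [H.covAlong_comm (H.smooth_jac l) hz]
    rw [H.form_comm hz]
    simp only [form, riemannForm, riemann, Finset.sum_mul, Finset.mul_sum]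
    calc _ = ∑ c, ∑ a, ∑ b, ∑ d, ∑ p, G (ψ z) c p * riemannUp G (ψ z) p d a b * jac ψ i a z
          * jac ψ j b z * jac ψ k c z * jac ψ l d z := by
          refine Finset.sum_congr rfl fun c _ => ?_
          rw [Finset.sum_comm]
          calc _ = ∑ d, ∑ a, ∑ b, ∑ p, G (ψ z) c p * riemannUp G (ψ z) p d a b * jac ψ i a z
                * jac ψ j b z * jac ψ k c z * jac ψ l d z := by
                refine Finset.sum_congr rfl fun d _ => ?_
                rw [← sum_comm₃]
                exact Finset.sum_congr rfl fun _ _ => Finset.sum_congr rfl fun _ _ =>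
                  Finset.sum_congr rfl fun _ _ => by ring
            _ = _ := (sum_comm₃ _ _ _ _).symm
      _ = _ := (sum_comm₃ _ _ _ _).symm
  rw [H.form_secondFund hz, H.form_secondFund hz, ← hR, H.metric'.riemann_eq hz, hd, hd]
  ring

/-- The Hessian of a function under pullback. -/
theorem hessian_eq (H : IsPullback U G V g ψ) (hz : z ∈ V) {h : EuclideanSpace ℝ (Fin n) → ℝ}
    (hh : SmoothOn U h) (i j : Fin m) :
    hessian g (fun z => h (ψ z)) z i j
      = form (Matrix.of (hessian G h (ψ z))) (fun a => jac ψ i a z) (fun a => jac ψ j a z)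
        + ∑ a, pd a h (ψ z) * secondFund G g ψ z i j a := by
  have h1 : ∀ z ∈ V, pd j (fun z => h (ψ z)) z = ∑ a, pd a h (ψ z) * jac ψ j a z :=
    fun z hz => H.pd_comp hh hz j
  have h2 : pd i (pd j (fun z => h (ψ z))) z = ∑ b, ((∑ a, pd a (pd b h) (ψ z) * jac ψ i a z)
      * jac ψ j b z + pd b h (ψ z) * pd i (jac ψ j b) z) := by
    rw [pd_congr H.metric'.isOpen hz h1,
      pd_sum (fun a => (H.smooth_comp (hh.pd a)).mul (H.smooth_jac j a)) hz]
    refine Finset.sum_congr rfl fun b _ => ?_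
    rw [pd_mul (H.smooth_comp (hh.pd b)) (H.smooth_jac j b) hz, H.pd_comp (hh.pd b) hz]
  rw [hessian, h2]
  simp only [H.pd_comp hh hz, secondFund, covAlong, form, hessian, Matrix.of_apply, mul_sub, mul_add,
    Finset.sum_add_distrib, Finset.sum_sub_distrib, sub_mul, Finset.sum_mul, Finset.mul_sum]
  have e1 : ∑ b, ∑ a, pd a (pd b h) (ψ z) * jac ψ i a z * jac ψ j b z
      = ∑ a, ∑ b, pd a (pd b h) (ψ z) * jac ψ i a z * jac ψ j b z := Finset.sum_comm
  have e2 : ∑ k, ∑ a, christoffel g z k i j * (pd a h (ψ z) * jac ψ k a z)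
      = ∑ a, ∑ k, pd a h (ψ z) * (christoffel g z k i j * jac ψ k a z) := by
    rw [Finset.sum_comm]
    exact Finset.sum_congr rfl fun _ _ => Finset.sum_congr rfl fun _ _ => by ring
  have e3 : ∑ a, ∑ b, ∑ c, christoffel G (ψ z) c a b * pd c h (ψ z) * jac ψ i a z * jac ψ j b z
      = ∑ c, ∑ a, ∑ b, pd c h (ψ z) * (christoffel G (ψ z) c a b * jac ψ i a z * jac ψ j b z) := by
    rw [sum_comm₃]
    exact Finset.sum_congr rfl fun _ _ => Finset.sum_congr rfl fun _ _ =>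
      Finset.sum_congr rfl fun _ _ => by ring
  rw [e1, e2, e3]
  ring

end IsPullback

/-! ### Changes of coordinates -/

/-- The Jacobian matrix of `ψ`. -/
noncomputable def jacMatrix (ψ : EuclideanSpace ℝ (Fin n) → EuclideanSpace ℝ (Fin n))
    (z : EuclideanSpace ℝ (Fin n)) : Matrix (Fin n) (Fin n) ℝ :=
  Matrix.of fun a i => jac ψ i a z

namespace IsPullback

variable {U : Set (EuclideanSpace ℝ (Fin n))}
  {G : EuclideanSpace ℝ (Fin n) → Matrix (Fin n) (Fin n) ℝ} {V : Set (EuclideanSpace ℝ (Fin n))}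
  {g : EuclideanSpace ℝ (Fin n) → Matrix (Fin n) (Fin n) ℝ}
  {ψ : EuclideanSpace ℝ (Fin n) → EuclideanSpace ℝ (Fin n)} {z : EuclideanSpace ℝ (Fin n)}

lemma form_jac (A : Matrix (Fin n) (Fin n) ℝ) (i j : Fin n) :
    form A (fun a => jac ψ i a z) (fun a => jac ψ j a z)
      = ((jacMatrix ψ z).transpose * A * jacMatrix ψ z) i j := by
  simp only [form, jacMatrix, Matrix.mul_apply, Matrix.transpose_apply, Matrix.of_apply,
    Finset.sum_mul]
  rw [Finset.sum_comm]
  exact Finset.sum_congr rfl fun _ _ => Finset.sum_congr rfl fun _ _ => by ring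

lemma eq_matrix (H : IsPullback U G V g ψ) (hz : z ∈ V) :
    g z = (jacMatrix ψ z).transpose * G (ψ z) * jacMatrix ψ z := by
  ext i j; rw [H.eq z hz, form_jac]

lemma det_jacMatrix_ne (H : IsPullback U G V g ψ) (hz : z ∈ V) : (jacMatrix ψ z).det ≠ 0 := by
  intro h0
  apply H.metric'.det_ne z hz
  rw [H.eq_matrix hz, Matrix.det_mul, h0, mul_zero]

lemma secondFund_eq_zero (H : IsPullback U G V g ψ) (hz : z ∈ V) (i j : Fin n) :
    secondFund G g ψ z i j = 0 := by
  have h : Matrix.vecMul (secondFund G g ψ z i j) (G (ψ z) * jacMatrix ψ z) = 0 := by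
    funext k
    rw [← Matrix.vecMul_vecMul]
    have := H.form_secondFund_jac hz i j k
    rw [form_eq_dotProduct, Matrix.dotProduct_mulVec] at this
    exact this
  refine Matrix.eq_zero_of_vecMul_eq_zero ?_ h
  rw [Matrix.det_mul]
  exact mul_ne_zero (H.metric.det_ne _ (H.mapsTo z hz)) (H.det_jacMatrix_ne hz)

lemma riemann_eq_riemannForm (H : IsPullback U G V g ψ) (hz : z ∈ V) (i j k l : Fin n) :
    riemann g z i j k l = riemannForm G (ψ z) (fun a => jac ψ i a z) (fun a => jac ψ j a z)
      (fun a => jac ψ k a z) (fun a => jac ψ l a z) := by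
  rw [H.riemann_eq hz]
  simp [H.secondFund_eq_zero hz, form]

lemma hessian_eq_form (H : IsPullback U G V g ψ) (hz : z ∈ V) {h : EuclideanSpace ℝ (Fin n) → ℝ}
    (hh : SmoothOn U h) (i j : Fin n) :
    hessian g (fun z => h (ψ z)) z i j
      = form (Matrix.of (hessian G h (ψ z))) (fun a => jac ψ i a z) (fun a => jac ψ j a z) := by
  rw [H.hessian_eq hz hh]
  simp [H.secondFund_eq_zero hz]

lemma inv_eq (H : IsPullback U G V g ψ) (hz : z ∈ V) :
    (G (ψ z))⁻¹ = jacMatrix ψ z * (g z)⁻¹ * (jacMatrix ψ z).transpose := by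
  have hJ : IsUnit (jacMatrix ψ z).det := isUnit_iff_ne_zero.2 (H.det_jacMatrix_ne hz)
  have hJ' : IsUnit (jacMatrix ψ z).transpose.det := by rwa [Matrix.det_transpose]
  rw [H.eq_matrix hz, Matrix.mul_inv_rev, Matrix.mul_inv_rev]
  rw [← mul_assoc, ← mul_assoc, Matrix.mul_nonsing_inv _ hJ, one_mul, mul_assoc,
    Matrix.nonsing_inv_mul _ hJ', mul_one]

/-- Contractions with the inverse metric do not depend on the coordinates. -/
lemma contract_eq (H : IsPullback U G V g ψ) (hz : z ∈ V) (A : Matrix (Fin n) (Fin n) ℝ) :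
    ∑ i, ∑ k, (g z)⁻¹ i k * form A (fun a => jac ψ i a z) (fun a => jac ψ k a z)
      = ∑ a, ∑ b, (G (ψ z))⁻¹ a b * A a b := by
  have hinv : ∀ a c, (G (ψ z))⁻¹ a c = ∑ i, ∑ k, (g z)⁻¹ i k * jac ψ i a z * jac ψ k c z := by
    intro a c
    rw [H.inv_eq hz]
    simp only [jacMatrix, Matrix.mul_apply, Matrix.transpose_apply, Matrix.of_apply,
      Finset.sum_mul]
    rw [Finset.sum_comm]
    exact Finset.sum_congr rfl fun _ _ => Finset.sum_congr rfl fun _ _ => by ring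
  simp only [form, hinv, Finset.sum_mul, Finset.mul_sum]
  calc _ = ∑ i, ∑ a, ∑ b, ∑ k, (g z)⁻¹ i k * (A a b * jac ψ i a z * jac ψ k b z) :=
        Finset.sum_congr rfl fun i _ => (sum_comm₃ _ _ _ _).symm
    _ = ∑ a, ∑ b, ∑ i, ∑ k, (g z)⁻¹ i k * (A a b * jac ψ i a z * jac ψ k b z) :=
        (sum_comm₃ _ _ _ _).symm
    _ = _ := Finset.sum_congr rfl fun _ _ => Finset.sum_congr rfl fun _ _ =>
        Finset.sum_congr rfl fun _ _ => Finset.sum_congr rfl fun _ _ => by ring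

lemma ricci_eq_form (H : IsPullback U G V g ψ) (hz : z ∈ V) (j l : Fin n) :
    ricci g z j l
      = form (Matrix.of (ricci G (ψ z))) (fun a => jac ψ j a z) (fun a => jac ψ l a z) := by
  have h : ∀ i k, riemann g z i j k l = form (Matrix.of fun a c =>
      ∑ b, ∑ d, riemann G (ψ z) a b c d * jac ψ j b z * jac ψ l d z)
        (fun a => jac ψ i a z) (fun a => jac ψ k a z) := by
    intro i k
    rw [H.riemann_eq_riemannForm hz]
    simp only [riemannForm, form, Matrix.of_apply, Finset.sum_mul]
    refine Finset.sum_congr rfl fun a _ => ?_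
    rw [Finset.sum_comm]
    exact Finset.sum_congr rfl fun _ _ => Finset.sum_congr rfl fun _ _ =>
      Finset.sum_congr rfl fun _ _ => by ring
  rw [ricci]
  simp only [h, H.contract_eq hz]
  simp only [form, ricci, Matrix.of_apply, Finset.sum_mul, Finset.mul_sum]
  calc _ = ∑ a, ∑ b, ∑ d, ∑ c, (G (ψ z))⁻¹ a c
        * (riemann G (ψ z) a b c d * jac ψ j b z * jac ψ l d z) :=
        Finset.sum_congr rfl fun i _ => (sum_comm₃ _ _ _ _).symm
    _ = ∑ b, ∑ d, ∑ a, ∑ c, (G (ψ z))⁻¹ a c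
        * (riemann G (ψ z) a b c d * jac ψ j b z * jac ψ l d z) := (sum_comm₃ _ _ _ _).symm
    _ = _ := Finset.sum_congr rfl fun _ _ => Finset.sum_congr rfl fun _ _ =>
        Finset.sum_congr rfl fun _ _ => Finset.sum_congr rfl fun _ _ => by ring

lemma scalar_eq (H : IsPullback U G V g ψ) (hz : z ∈ V) : scalar g z = scalar G (ψ z) := by
  simp only [scalar, H.ricci_eq_form hz, H.contract_eq hz, Matrix.of_apply]

lemma laplacian_eq (H : IsPullback U G V g ψ) (hz : z ∈ V) {h : EuclideanSpace ℝ (Fin n) → ℝ}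
    (hh : SmoothOn U h) : laplacian g (fun z => h (ψ z)) z = laplacian G h (ψ z) := by
  simp only [laplacian, H.hessian_eq_form hz hh, H.contract_eq hz, Matrix.of_apply]

/-- The Ricci endomorphisms in two coordinate systems are conjugate. -/
lemma ricci_endomorphism_eq (H : IsPullback U G V g ψ) (hz : z ∈ V) :
    (g z)⁻¹ * Matrix.of (ricci g z)
      = (jacMatrix ψ z)⁻¹ * ((G (ψ z))⁻¹ * Matrix.of (ricci G (ψ z))) * jacMatrix ψ z := by
  have hJ : IsUnit (jacMatrix ψ z).det := isUnit_iff_ne_zero.2 (H.det_jacMatrix_ne hz)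
  have hr : Matrix.of (ricci g z)
      = (jacMatrix ψ z).transpose * Matrix.of (ricci G (ψ z)) * jacMatrix ψ z := by
    ext i j; rw [Matrix.of_apply, H.ricci_eq_form hz, form_jac]
  rw [hr, H.inv_eq hz]
  simp only [← mul_assoc]
  rw [Matrix.nonsing_inv_mul _ hJ, one_mul]

lemma charpoly_eq (H : IsPullback U G V g ψ) (hz : z ∈ V) :
    ((g z)⁻¹ * Matrix.of (ricci g z)).charpoly
      = ((G (ψ z))⁻¹ * Matrix.of (ricci G (ψ z))).charpoly := by
  have hJ : IsUnit (jacMatrix ψ z).det := isUnit_iff_ne_zero.2 (H.det_jacMatrix_ne hz)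
  have hu : IsUnit (jacMatrix ψ z) := (Matrix.isUnit_iff_isUnit_det _).2 hJ
  obtain ⟨u, hu⟩ := hu
  rw [H.ricci_endomorphism_eq hz, ← hu, Matrix.charpoly_units_conj']

end IsPullback
end Coord

namespace Riem

set_option linter.unusedSectionVars false

open Coord

variable {n m : ℕ} {M : Type*} [TopologicalSpace M] [ChartedSpace (EuclideanSpace ℝ (Fin n)) M]

/-- A smooth immersion of an open subset of `ℝᵐ` in `M`. -/
structure IsParam (V : Set (EuclideanSpace ℝ (Fin m))) (Φ : EuclideanSpace ℝ (Fin m) → M) :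
    Prop where
  isOpen : IsOpen V
  smooth : ContMDiffOn (𝓡 m) (𝓡 n) ∞ Φ V
  injective : ∀ z ∈ V, Function.Injective (mfderiv (𝓡 m) (𝓡 n) Φ z)

/-- The `i`-th coordinate vector field of a parametrization. -/
noncomputable def coordVec (Φ : EuclideanSpace ℝ (Fin m) → M) (z : EuclideanSpace ℝ (Fin m))
    (i : Fin m) : TangentSpace (𝓡 n) (Φ z) :=
  mfderiv (𝓡 m) (𝓡 n) Φ z (EuclideanSpace.single i (1 : ℝ))

namespace IsParam

variable {V : Set (EuclideanSpace ℝ (Fin m))} {Φ : EuclideanSpace ℝ (Fin m) → M}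
  {z : EuclideanSpace ℝ (Fin m)}

lemma mono (H : IsParam (n := n) V Φ) {W : Set (EuclideanSpace ℝ (Fin m))} (hW : IsOpen W)
    (h : W ⊆ V) : IsParam (n := n) W Φ :=
  ⟨hW, H.smooth.mono h, fun z hz => H.injective z (h hz)⟩

lemma contMDiffAt (H : IsParam (n := n) V Φ) (hz : z ∈ V) : ContMDiffAt (𝓡 m) (𝓡 n) ∞ Φ z :=
  H.smooth.contMDiffAt (H.isOpen.mem_nhds hz)

lemma mdifferentiableAt (H : IsParam (n := n) V Φ) (hz : z ∈ V) :
    MDifferentiableAt (𝓡 m) (𝓡 n) Φ z := (H.contMDiffAt hz).mdifferentiableAt (by simp)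

lemma linearIndependent_coordVec (H : IsParam (n := n) V Φ) (hz : z ∈ V) :
    LinearIndependent ℝ (coordVec (n := n) Φ z) := by
  have hb : LinearIndependent ℝ (fun i : Fin m => EuclideanSpace.single i (1 : ℝ)) := by
    have e : (fun i : Fin m => EuclideanSpace.single i (1 : ℝ))
        = (EuclideanSpace.basisFun (Fin m) ℝ).toBasis := by funext i; simp
    rw [e]
    exact (EuclideanSpace.basisFun (Fin m) ℝ).toBasis.linearIndependent
  exact hb.map' (mfderiv (𝓡 m) (𝓡 n) Φ z).toLinearMap (LinearMap.ker_eq_bot.2 (H.injective z hz))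

section metric

variable [IsManifold (𝓡 n) ∞ M] [RiemannianBundle (fun x : M => TangentSpace (𝓡 n) x)]

lemma contMDiffAt_coordVec (H : IsParam (n := n) V Φ) (hz : z ∈ V) (i : Fin m) :
    ContMDiffAt (𝓡 m) ((𝓡 n).prod 𝓘(ℝ, EuclideanSpace ℝ (Fin n))) ∞
      (fun z => (⟨Φ z, coordVec (n := n) Φ z i⟩ : TangentBundle (𝓡 n) M)) z := by
  have h1 := H.smooth.contMDiffOn_tangentMapWithin (m := ∞) (by simp) H.isOpen.uniqueMDiffOn
  have h2 : ContMDiffOn (𝓡 m) ((𝓡 m).prod 𝓘(ℝ, EuclideanSpace ℝ (Fin m))) ∞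
      (fun z => (⟨z, EuclideanSpace.single i (1 : ℝ)⟩ :
        TangentBundle (𝓡 m) (EuclideanSpace ℝ (Fin m)))) V :=
    contMDiffOn_vectorSpace_iff_contDiffOn.2 contDiffOn_const
  have h3 := h1.comp h2 (fun z hz => hz)
  refine (h3.contMDiffAt (H.isOpen.mem_nhds hz)).congr_of_eventuallyEq ?_
  filter_upwards [H.isOpen.mem_nhds hz] with w hw
  simp only [Function.comp, tangentMapWithin, mfderivWithin_of_isOpen H.isOpen hw]
  rfl

lemma smooth_pullbackMetric
    [IsContMDiffRiemannianBundle (𝓡 n) ∞ (EuclideanSpace ℝ (Fin n))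
      (fun x : M => TangentSpace (𝓡 n) x)] (H : IsParam (n := n) V Φ) (i j : Fin m) :
    SmoothOn V (fun z => pullbackMetric (n := n) Φ z i j) := by
  intro z hz
  exact (ContMDiffAt.inner_bundle (H.contMDiffAt_coordVec hz i) (H.contMDiffAt_coordVec hz j)).contDiffAt

lemma inner_sum_coordVec (c : Fin m → ℝ) (w : Fin m → ℝ) :
    inner ℝ (∑ i, c i • coordVec (n := n) Φ z i) (∑ i, w i • coordVec (n := n) Φ z i)
      = form (pullbackMetric (n := n) Φ z) c w := by
  rw [sum_inner]
  refine Finset.sum_congr rfl fun a _ => ?_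
  rw [inner_sum]
  refine Finset.sum_congr rfl fun b _ => ?_
  rw [real_inner_smul_left, real_inner_smul_right]
  change _ = inner ℝ (coordVec (n := n) Φ z a) (coordVec (n := n) Φ z b) * c a * w b
  ring

lemma isMetricOn
    [IsContMDiffRiemannianBundle (𝓡 n) ∞ (EuclideanSpace ℝ (Fin n))
      (fun x : M => TangentSpace (𝓡 n) x)] (H : IsParam (n := n) V Φ) :
    IsMetricOn V (pullbackMetric (n := n) Φ) where
  isOpen := H.isOpen
  smooth := H.smooth_pullbackMetric
  symm y _ i j := real_inner_comm (coordVec (n := n) Φ y j) (coordVec (n := n) Φ y i)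
  det_ne y hy h0 := by
    obtain ⟨c, hc, h⟩ := Matrix.exists_mulVec_eq_zero_iff.2 h0
    have : inner ℝ (∑ i, c i • coordVec (n := n) Φ y i) (∑ i, c i • coordVec (n := n) Φ y i)
        = (0 : ℝ) := by
      rw [inner_sum_coordVec, form_eq_dotProduct, h, dotProduct_zero]
    rw [inner_self_eq_zero] at this
    exact hc (funext (Fintype.linearIndependent_iff.1 (H.linearIndependent_coordVec hy) c this))

end metric

end IsParam

end Riem

namespace Riem

set_option linter.unusedSectionVars false

open Coord

variable {n m : ℕ} {M : Type*} [TopologicalSpace M] [ChartedSpace (EuclideanSpace ℝ (Fin n)) M]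

/-- The metric at `p` as a function of vectors of the model space. -/
noncomputable def metricAt [RiemannianBundle (fun x : M => TangentSpace (𝓡 n) x)] (p : M)
    (v w : EuclideanSpace ℝ (Fin n)) : ℝ :=
  @inner ℝ (TangentSpace (𝓡 n) p) _ v w

section chart

variable [IsManifold (𝓡 n) ∞ M]

lemma isParam_extChartAt_symm (x : M) :
    IsParam (n := n) (extChartAt (𝓡 n) x).target (extChartAt (𝓡 n) x).symm where
  isOpen := isOpen_extChartAt_target x
  smooth := contMDiffOn_extChartAt_symm x
  injective z hz := by
    have h := (isInvertible_mfderivWithin_extChartAt_symm (I := 𝓡 n) hz).injective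
    simpa only [modelWithCornersSelf_coe, Set.range_id, mfderivWithin_univ] using h

namespace IsParam

variable {V : Set (EuclideanSpace ℝ (Fin m))} {Φ : EuclideanSpace ℝ (Fin m) → M}
  {z : EuclideanSpace ℝ (Fin m)}

lemma smooth_chart_comp (H : IsParam (n := n) V Φ) (x : M)
    (hV : ∀ z ∈ V, Φ z ∈ (chartAt (EuclideanSpace ℝ (Fin n)) x).source) (a : Fin n) :
    SmoothOn V (fun z => extChartAt (𝓡 n) x (Φ z) a) := by
  intro z hz
  have h1 := (contMDiffAt_extChartAt' (I := 𝓡 n) (n := ∞) (hV z hz)).comp z (H.contMDiffAt hz)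
  exact contDiffAt_euclidean.1 h1.contDiffAt a

lemma mfderiv_comp_eq {k : ℕ} {U : Set (EuclideanSpace ℝ (Fin k))}
    {Ψ : EuclideanSpace ℝ (Fin k) → M} (HΨ : IsParam (n := n) U Ψ) (hV : IsOpen V)
    {ψ : EuclideanSpace ℝ (Fin m) → EuclideanSpace ℝ (Fin k)}
    (hψ : ∀ a, SmoothOn V (fun z => ψ z a)) (hm : ∀ z ∈ V, ψ z ∈ U)
    (he : ∀ z ∈ V, Ψ (ψ z) = Φ z) (hz : z ∈ V) (v : EuclideanSpace ℝ (Fin m)) :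
    (mfderiv (𝓡 m) (𝓡 n) Φ z v : EuclideanSpace ℝ (Fin n))
      = (mfderiv (𝓡 k) (𝓡 n) Ψ (ψ z) (fderiv ℝ ψ z v) : EuclideanSpace ℝ (Fin n)) := by
  have hd : DifferentiableAt ℝ ψ z := differentiableAt_euclidean.2 fun a => (hψ a).differentiableAt hz
  have he : Φ =ᶠ[𝓝 z] Ψ ∘ ψ := by
    filter_upwards [hV.mem_nhds hz] with w hw using (he w hw).symm
  have h1 : (mfderiv (𝓡 m) (𝓡 n) Φ z : EuclideanSpace ℝ (Fin m) →L[ℝ] EuclideanSpace ℝ (Fin n))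
      = mfderiv (𝓡 m) (𝓡 n) (Ψ ∘ ψ) z := he.mfderiv_eq
  have h2 := mfderiv_comp z (HΨ.mdifferentiableAt (hm z hz)) hd.mdifferentiableAt
  have h3 : (mfderiv (𝓡 m) (𝓡 k) ψ z : EuclideanSpace ℝ (Fin m) →L[ℝ] EuclideanSpace ℝ (Fin k))
      = fderiv ℝ ψ z := mfderiv_eq_fderiv
  rw [← h3]
  exact (congrArg (fun L => L v) h1).trans (congrArg (fun L => L v) h2)

lemma coordVec_comp_eq {k : ℕ} {U : Set (EuclideanSpace ℝ (Fin k))}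
    {Ψ : EuclideanSpace ℝ (Fin k) → M} (HΨ : IsParam (n := n) U Ψ) (hV : IsOpen V)
    {ψ : EuclideanSpace ℝ (Fin m) → EuclideanSpace ℝ (Fin k)}
    (hψ : ∀ a, SmoothOn V (fun z => ψ z a)) (hm : ∀ z ∈ V, ψ z ∈ U)
    (he : ∀ z ∈ V, Ψ (ψ z) = Φ z) (hz : z ∈ V) (i : Fin m) :
    (coordVec (n := n) Φ z i : EuclideanSpace ℝ (Fin n))
      = (∑ a, jac ψ i a z • coordVec (n := n) Ψ (ψ z) a : TangentSpace (𝓡 n) (Ψ (ψ z))) := by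
  rw [coordVec, mfderiv_comp_eq HΨ hV hψ hm he hz]
  have : fderiv ℝ ψ z (EuclideanSpace.single i (1 : ℝ))
      = ∑ a, jac ψ i a z • EuclideanSpace.single a (1 : ℝ) := by
    ext b
    rw [fderiv_coord hψ hz]
    simp [jac, pd, Pi.single_apply]
  rw [this]
  exact (map_sum (mfderiv (𝓡 k) (𝓡 n) Ψ (ψ z)) _ _).trans
    (Finset.sum_congr rfl fun a _ => map_smul _ _ _)

lemma comp_coordVec (H : IsParam (n := n) V Φ)
    (hV : ∀ w ∈ V, Φ w ∈ (chartAt (EuclideanSpace ℝ (Fin n)) (Φ z)).source) (hz : z ∈ V)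
    (i : Fin m) (a : Fin n) :
    comp (Φ z) (coordVec (n := n) Φ z i) a
      = jac (fun w => extChartAt (𝓡 n) (Φ z) (Φ w)) i a z := by
  have hc : MDifferentiableAt (𝓡 n) (𝓡 n) (extChartAt (𝓡 n) (Φ z)) (Φ z) :=
    mdifferentiableAt_extChartAt (mem_chart_source _ _)
  have h2 := mfderiv_comp z hc (H.mdifferentiableAt hz)
  have h3 : (mfderiv (𝓡 m) (𝓡 n) (extChartAt (𝓡 n) (Φ z) ∘ Φ) z :
      EuclideanSpace ℝ (Fin m) →L[ℝ] EuclideanSpace ℝ (Fin n))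
      = fderiv ℝ (fun w => extChartAt (𝓡 n) (Φ z) (Φ w)) z := mfderiv_eq_fderiv
  have h4 := fderiv_coord (H.smooth_chart_comp (Φ z) hV) hz (EuclideanSpace.single i (1 : ℝ)) a
  rw [← h3] at h4
  rw [jac, pd, ← h4]
  exact congrArg (fun L : EuclideanSpace ℝ (Fin m) →L[ℝ] EuclideanSpace ℝ (Fin n) =>
    (L (EuclideanSpace.single i (1 : ℝ))) a) h2.symm

variable [RiemannianBundle (fun x : M => TangentSpace (𝓡 n) x)]
    [IsContMDiffRiemannianBundle (𝓡 n) ∞ (EuclideanSpace ℝ (Fin n))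
      (fun x : M => TangentSpace (𝓡 n) x)]

lemma isPullback_comp {k : ℕ} {U : Set (EuclideanSpace ℝ (Fin k))}
    {Ψ : EuclideanSpace ℝ (Fin k) → M} (HΨ : IsParam (n := n) U Ψ) (H : IsParam (n := n) V Φ)
    {ψ : EuclideanSpace ℝ (Fin m) → EuclideanSpace ℝ (Fin k)}
    (hψ : ∀ a, SmoothOn V (fun z => ψ z a)) (hm : ∀ z ∈ V, ψ z ∈ U)
    (he : ∀ z ∈ V, Ψ (ψ z) = Φ z) :
    IsPullback U (pullbackMetric (n := n) Ψ) V (pullbackMetric (n := n) Φ) ψ where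
  metric := HΨ.isMetricOn
  metric' := H.isMetricOn
  smooth := hψ
  mapsTo := hm
  eq z hz i j := by
    have e : pullbackMetric (n := n) Φ z i j
        = metricAt (Φ z) (coordVec (n := n) Φ z i) (coordVec (n := n) Φ z j) := by
      simp only [pullbackMetric, Matrix.of_apply]; rfl
    have hp : metricAt (n := n) (Φ z) = metricAt (Ψ (ψ z)) := by rw [he z hz]
    have h := inner_sum_coordVec (n := n) (Φ := Ψ) (z := ψ z)
      (fun a => jac ψ i a z) (fun a => jac ψ j a z)
    rw [e, hp]
    refine Eq.trans ?_ h
    exact congrArg₂ (metricAt (Ψ (ψ z))) (coordVec_comp_eq HΨ H.isOpen hψ hm he hz i)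
      (coordVec_comp_eq HΨ H.isOpen hψ hm he hz j)

lemma isPullback (H : IsParam (n := n) V Φ) (x : M)
    (hV : ∀ z ∈ V, Φ z ∈ (chartAt (EuclideanSpace ℝ (Fin n)) x).source) :
    IsPullback (extChartAt (𝓡 n) x).target (chartMetric (n := n) x) V (pullbackMetric (n := n) Φ)
      (fun z => extChartAt (𝓡 n) x (Φ z)) :=
  isPullback_comp (isParam_extChartAt_symm x) H (H.smooth_chart_comp x hV)
    (fun z hz => (extChartAt (𝓡 n) x).map_source (by rw [extChartAt_source]; exact hV z hz))
    (fun z hz => (extChartAt (𝓡 n) x).left_inv (by rw [extChartAt_source]; exact hV z hz))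

/-- Near each point a parametrization takes values in the preferred chart. -/
lemma exists_chart (H : IsParam (n := n) V Φ) (hz : z ∈ V) :
    ∃ W : Set (EuclideanSpace ℝ (Fin m)), W ⊆ V ∧ z ∈ W ∧ IsParam (n := n) W Φ ∧
      ∀ w ∈ W, Φ w ∈ (chartAt (EuclideanSpace ℝ (Fin n)) (Φ z)).source := by
  have ho : IsOpen (V ∩ Φ ⁻¹' (chartAt (EuclideanSpace ℝ (Fin n)) (Φ z)).source) :=
    H.smooth.continuousOn.isOpen_inter_preimage H.isOpen
      (chartAt (EuclideanSpace ℝ (Fin n)) (Φ z)).open_source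
  exact ⟨V ∩ Φ ⁻¹' (chartAt (EuclideanSpace ℝ (Fin n)) (Φ z)).source, Set.inter_subset_left,
    ⟨hz, mem_chart_source _ _⟩, H.mono ho Set.inter_subset_left,
    fun w hw => hw.2⟩

end IsParam
end chart

/-! ### Curvature in arbitrary coordinates -/

section coordinates

variable [IsManifold (𝓡 n) ∞ M] [RiemannianBundle (fun x : M => TangentSpace (𝓡 n) x)]
    [IsContMDiffRiemannianBundle (𝓡 n) ∞ (EuclideanSpace ℝ (Fin n))
      (fun x : M => TangentSpace (𝓡 n) x)]
  {V : Set (EuclideanSpace ℝ (Fin n))} {Φ : EuclideanSpace ℝ (Fin n) → M}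
  {z : EuclideanSpace ℝ (Fin n)}

lemma IsParam.ricciForm_eq (H : IsParam (n := n) V Φ) (hz : z ∈ V) (i j : Fin n) :
    ricciForm (Φ z) (coordVec (n := n) Φ z i) (coordVec (n := n) Φ z j)
      = Coord.ricci (pullbackMetric (n := n) Φ) z i j := by
  obtain ⟨W, -, hzW, HW, hW⟩ := H.exists_chart hz
  rw [(HW.isPullback _ hW).ricci_eq_form hzW, ricciForm]
  simp only [HW.comp_coordVec hW hzW]
  rfl

lemma IsParam.scalarCurvature_eq (H : IsParam (n := n) V Φ) (hz : z ∈ V) :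
    scalarCurvature n (Φ z) = Coord.scalar (pullbackMetric (n := n) Φ) z := by
  obtain ⟨W, -, hzW, HW, hW⟩ := H.exists_chart hz
  rw [(HW.isPullback _ hW).scalar_eq hzW, scalarCurvature]

lemma IsParam.charpoly_eq (H : IsParam (n := n) V Φ) (hz : z ∈ V) :
    ((chartMetric (n := n) (Φ z) (extChartAt (𝓡 n) (Φ z) (Φ z)))⁻¹ *
      Matrix.of (Coord.ricci (chartMetric (n := n) (Φ z)) (extChartAt (𝓡 n) (Φ z) (Φ z)))).charpoly
    = ((pullbackMetric (n := n) Φ z)⁻¹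
        * Matrix.of (Coord.ricci (pullbackMetric (n := n) Φ) z)).charpoly := by
  obtain ⟨W, -, hzW, HW, hW⟩ := H.exists_chart hz
  rw [(HW.isPullback _ hW).charpoly_eq hzW]

lemma IsParam.exists_pullback_smooth (H : IsParam (n := n) V Φ) (hz : z ∈ V) {h : M → ℝ}
    {O : Set M} (hO : IsOpen O) (hh : ContMDiffOn (𝓡 n) 𝓘(ℝ, ℝ) ∞ h O) (hzO : Φ z ∈ O) :
    ∃ U W : Set (EuclideanSpace ℝ (Fin n)), W ⊆ V ∧ z ∈ W ∧ IsParam (n := n) W Φ ∧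
      (∀ w ∈ W, Φ w ∈ (chartAt (EuclideanSpace ℝ (Fin n)) (Φ z)).source) ∧
      IsPullback U (chartMetric (n := n) (Φ z)) W (pullbackMetric (n := n) Φ)
        (fun z' => extChartAt (𝓡 n) (Φ z) (Φ z')) ∧
      SmoothOn U (h ∘ (extChartAt (𝓡 n) (Φ z)).symm) := by
  obtain ⟨W, hWV, hzW, HW, hW⟩ := H.exists_chart hz
  have hpb := HW.isPullback _ hW
  have hc := isParam_extChartAt_symm (n := n) (Φ z)
  have hU : IsOpen ((extChartAt (𝓡 n) (Φ z)).target ∩ (extChartAt (𝓡 n) (Φ z)).symm ⁻¹' O) :=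
    hc.smooth.continuousOn.isOpen_inter_preimage hc.isOpen hO
  have hW' : IsOpen (W ∩ Φ ⁻¹' O) := HW.smooth.continuousOn.isOpen_inter_preimage HW.isOpen hO
  have hl : ∀ w ∈ W, (extChartAt (𝓡 n) (Φ z)).symm (extChartAt (𝓡 n) (Φ z) (Φ w)) = Φ w :=
    fun w hw => (extChartAt (𝓡 n) (Φ z)).left_inv (by rw [extChartAt_source]; exact hW w hw)
  refine ⟨_, W ∩ Φ ⁻¹' O, Set.inter_subset_left.trans hWV, ⟨hzW, hzO⟩,
    HW.mono hW' Set.inter_subset_left, fun w hw => hW w hw.1,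
    ⟨hpb.metric.mono hU Set.inter_subset_left, hpb.metric'.mono hW' Set.inter_subset_left,
      fun a => (hpb.smooth a).mono Set.inter_subset_left, fun w hw => ⟨hpb.mapsTo w hw.1, ?_⟩,
      fun w hw => hpb.eq w hw.1⟩, fun y hy => ?_⟩
  · change (extChartAt (𝓡 n) (Φ z)).symm (extChartAt (𝓡 n) (Φ z) (Φ w)) ∈ O
    rw [hl w hw.1]; exact hw.2
  · have h1 : ContMDiffAt (𝓡 n) 𝓘(ℝ, ℝ) ∞ h ((extChartAt (𝓡 n) (Φ z)).symm y) :=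
      hh.contMDiffAt (hO.mem_nhds hy.2)
    exact (h1.comp y (hc.contMDiffAt hy.1)).contDiffAt

lemma hessian_congr {g : EuclideanSpace ℝ (Fin n) → Matrix (Fin n) (Fin n) ℝ}
    {h k : EuclideanSpace ℝ (Fin n) → ℝ} (e : h =ᶠ[𝓝 z] k) (i j : Fin n) :
    Coord.hessian g h z i j = Coord.hessian g k z i j := by
  simp only [Coord.hessian]
  rw [pd_congr_of_eventuallyEq i (e.eventually_nhds.mono fun y hy => pd_congr_of_eventuallyEq j hy)]
  simp only [pd_congr_of_eventuallyEq _ e]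

lemma IsParam.hessianForm_eq (H : IsParam (n := n) V Φ) (hz : z ∈ V) {h : M → ℝ}
    {O : Set M} (hO : IsOpen O) (hh : ContMDiffOn (𝓡 n) 𝓘(ℝ, ℝ) ∞ h O) (hzO : Φ z ∈ O)
    (i j : Fin n) :
    hessianForm h (Φ z) (coordVec (n := n) Φ z i) (coordVec (n := n) Φ z j)
      = Coord.hessian (pullbackMetric (n := n) Φ) (h ∘ Φ) z i j := by
  obtain ⟨U, W, -, hzW, HW, hW, hpb, hs⟩ := H.exists_pullback_smooth hz hO hh hzO
  have e : h ∘ Φ =ᶠ[𝓝 z] fun w => (h ∘ (extChartAt (𝓡 n) (Φ z)).symm)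
      (extChartAt (𝓡 n) (Φ z) (Φ w)) := by
    filter_upwards [HW.isOpen.mem_nhds hzW] with w hw
    simp only [Function.comp]
    rw [(extChartAt (𝓡 n) (Φ z)).left_inv (by rw [extChartAt_source]; exact hW w hw)]
  rw [hessian_congr e, hpb.hessian_eq_form hzW hs, hessianForm]
  simp only [HW.comp_coordVec hW hzW]
  rfl

lemma IsParam.laplacian_eq (H : IsParam (n := n) V Φ) (hz : z ∈ V) {h : M → ℝ}
    {O : Set M} (hO : IsOpen O) (hh : ContMDiffOn (𝓡 n) 𝓘(ℝ, ℝ) ∞ h O) (hzO : Φ z ∈ O) :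
    Riem.laplacian n h (Φ z) = Coord.laplacian (pullbackMetric (n := n) Φ) (h ∘ Φ) z := by
  obtain ⟨U, W, -, hzW, HW, hW, hpb, hs⟩ := H.exists_pullback_smooth hz hO hh hzO
  have e : h ∘ Φ =ᶠ[𝓝 z] fun w => (h ∘ (extChartAt (𝓡 n) (Φ z)).symm)
      (extChartAt (𝓡 n) (Φ z) (Φ w)) := by
    filter_upwards [HW.isOpen.mem_nhds hzW] with w hw
    simp only [Function.comp]
    rw [(extChartAt (𝓡 n) (Φ z)).left_inv (by rw [extChartAt_source]; exact hW w hw)]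
  have : Coord.laplacian (pullbackMetric (n := n) Φ) (h ∘ Φ) z
      = Coord.laplacian (pullbackMetric (n := n) Φ) (fun w =>
        (h ∘ (extChartAt (𝓡 n) (Φ z)).symm) (extChartAt (𝓡 n) (Φ z) (Φ w))) z := by
    simp only [Coord.laplacian, hessian_congr e]
  rw [this, hpb.laplacian_eq hzW hs, Riem.laplacian]

end coordinates

section gradient

variable [RiemannianBundle (fun x : M => TangentSpace (𝓡 n) x)]

lemma inner_grad (h : M → ℝ) (x : M) (v : TangentSpace (𝓡 n) x) :
    inner ℝ (grad n h x) v = mfderiv (𝓡 n) 𝓘(ℝ, ℝ) h x v := by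
  have : FiniteDimensional ℝ (TangentSpace (𝓡 n) x) :=
    inferInstanceAs (FiniteDimensional ℝ (EuclideanSpace ℝ (Fin n)))
  have : CompleteSpace (TangentSpace (𝓡 n) x) := FiniteDimensional.complete ℝ _
  exact InnerProductSpace.toDual_symm_apply (𝕜 := ℝ) (E := TangentSpace (𝓡 n) x)

lemma IsParam.inner_grad_coordVec {V : Set (EuclideanSpace ℝ (Fin m))}
    {Φ : EuclideanSpace ℝ (Fin m) → M} {z : EuclideanSpace ℝ (Fin m)}
    (H : IsParam (n := n) V Φ) (hz : z ∈ V) {h : M → ℝ}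
    (hh : MDifferentiableAt (𝓡 n) 𝓘(ℝ, ℝ) h (Φ z)) (i : Fin m) :
    inner ℝ (grad n h (Φ z)) (coordVec (n := n) Φ z i) = pd i (h ∘ Φ) z := by
  rw [inner_grad, pd]
  have h1 := mfderiv_comp z hh (H.mdifferentiableAt hz)
  have h2 : (mfderiv (𝓡 m) 𝓘(ℝ, ℝ) (h ∘ Φ) z : EuclideanSpace ℝ (Fin m) →L[ℝ] ℝ)
      = fderiv ℝ (h ∘ Φ) z := mfderiv_eq_fderiv
  rw [← h2]
  exact (congrArg (fun L : EuclideanSpace ℝ (Fin m) →L[ℝ] ℝ =>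
    L (EuclideanSpace.single i (1 : ℝ))) h1).symm

end gradient

end Riem

namespace Coord

variable {n : ℕ}

lemma pd_pd_mul {U : Set (EuclideanSpace ℝ (Fin n))} (hU : IsOpen U)
    {h k : EuclideanSpace ℝ (Fin n) → ℝ} {y : EuclideanSpace ℝ (Fin n)}
    (hh : SmoothOn U h) (hk : SmoothOn U k) (hy : y ∈ U) (i j : Fin n) :
    pd i (pd j (fun z => h z * k z)) y = pd i (pd j h) y * k y + pd j h y * pd i k y
      + pd i h y * pd j k y + h y * pd i (pd j k) y := by
  rw [pd_congr hU hy (fun z hz => pd_mul hh hk hz j),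
    pd_add ((hh.pd j).mul hk) (hh.mul (hk.pd j)) hy, pd_mul (hh.pd j) hk hy,
    pd_mul hh (hk.pd j) hy]
  ring

/-- The metric `g` on `V` is a gradient shrinking Ricci soliton with potential `h`, whose scalar
curvature is `3 / 2`, normalized by `|∇h|² = h`. -/
structure IsSoliton (V : Set (EuclideanSpace ℝ (Fin n)))
    (g : EuclideanSpace ℝ (Fin n) → Matrix (Fin n) (Fin n) ℝ) (h : EuclideanSpace ℝ (Fin n) → ℝ) :
    Prop where
  metric : IsMetricOn V g
  smooth : SmoothOn V h
  soliton : ∀ y ∈ V, ∀ i j, ricci g y i j + hessian g h y i j = (1 / 2) * g y i j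
  scalar : ∀ y ∈ V, scalar g y = 3 / 2
  norm : ∀ y ∈ V, ∑ i, ∑ j, (g y)⁻¹ i j * pd i h y * pd j h y = h y

/-- The components of the gradient of `h`. -/
noncomputable def gradUp (g : EuclideanSpace ℝ (Fin n) → Matrix (Fin n) (Fin n) ℝ)
    (h : EuclideanSpace ℝ (Fin n) → ℝ) (i : Fin n) (y : EuclideanSpace ℝ (Fin n)) : ℝ :=
  ∑ j, (g y)⁻¹ i j * pd j h y

namespace IsSoliton

variable {V : Set (EuclideanSpace ℝ (Fin n))}
  {g : EuclideanSpace ℝ (Fin n) → Matrix (Fin n) (Fin n) ℝ} {h : EuclideanSpace ℝ (Fin n) → ℝ}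
  {y : EuclideanSpace ℝ (Fin n)}

lemma smooth_gradUp (H : IsSoliton V g h) (i : Fin n) : SmoothOn V (gradUp g h i) :=
  SmoothOn.sum fun _ => (H.metric.smooth_inv _ _).mul (H.smooth.pd _)

lemma sum_metric_gradUp (H : IsSoliton V g h) (hy : y ∈ V) (i : Fin n) :
    ∑ j, g y i j * gradUp g h j y = pd i h y := by
  simp only [gradUp, Finset.mul_sum, ← mul_assoc]
  rw [Finset.sum_comm]
  simp only [← Finset.sum_mul, H.metric.sum_mul_inv hy]
  simp

/-- The Codazzi type equation `∇_i R_{jk} - ∇_j R_{ik} = R^l_{kij} ∇_l h`. -/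
lemma codazzi (H : IsSoliton V g h) (hy : y ∈ V) (i j k : Fin n) :
    pd i (fun z => ricci g z j k) y - pd j (fun z => ricci g z i k) y
      - ∑ m, christoffel g y m i k * ricci g y j m + ∑ m, christoffel g y m j k * ricci g y i m
      = ∑ l, riemannUp g y l k i j * pd l h y := by
  have hr : ∀ z ∈ V, ∀ j k, ricci g z j k = (1 / 2) * g z j k
      - (pd j (pd k h) z - ∑ m, christoffel g z m j k * pd m h z) := by
    intro z hz j k
    have := H.soliton z hz j k
    rw [hessian] at this
    linarith
  have hd : ∀ i j, pd i (fun z => ricci g z j k) y = (1 / 2) * pd i (fun z => g z j k) y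
      - (pd i (pd j (pd k h)) y - ∑ m, (pd i (fun z => christoffel g z m j k) y * pd m h y
          + christoffel g y m j k * pd i (pd m h) y)) := by
    intro i j
    have s1 := fun m => (H.metric.smooth_christoffel m j k).mul (H.smooth.pd m)
    have s2 := ((H.smooth.pd k).pd j)
    rw [pd_congr H.metric.isOpen hy (fun z hz => hr z hz j k),
      pd_sub ((SmoothOn.const _).mul (H.metric.smooth j k)) (s2.sub (SmoothOn.sum s1)) hy,
      pd_sub s2 (SmoothOn.sum s1) hy, pd_const_mul _ (H.metric.smooth j k) hy, pd_sum s1 hy]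
    simp only [pd_mul (H.metric.smooth_christoffel _ j k) (H.smooth.pd _) hy]
  have hq : ∀ i j, ∑ m, christoffel g y m i k * ricci g y j m
      = (1 / 2) * christoffelLow g j i k y - ∑ m, christoffel g y m i k * pd j (pd m h) y
        + ∑ l, (∑ m, christoffel g y l j m * christoffel g y m i k) * pd l h y := by
    intro i j
    rw [← H.metric.sum_mul_christoffel hy]
    simp only [hr y hy, mul_sub, Finset.sum_sub_distrib, Finset.mul_sum, Finset.sum_mul]
    rw [Finset.sum_comm (f := fun m p => christoffel g y m i k * (christoffel g y p j m * pd p h y))]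
    have e1 : ∑ m, christoffel g y m i k * ((1 / 2) * g y j m)
        = ∑ m, (1 / 2) * (g y j m * christoffel g y m i k) :=
      Finset.sum_congr rfl fun _ _ => by ring
    have e2 : ∑ p, ∑ m, christoffel g y m i k * (christoffel g y p j m * pd p h y)
        = ∑ p, ∑ m, christoffel g y p j m * christoffel g y m i k * pd p h y :=
      Finset.sum_congr rfl fun _ _ => Finset.sum_congr rfl fun _ _ => by ring
    rw [e1, e2]; ring
  have hR : ∑ l, riemannUp g y l k i j * pd l h y
      = ∑ l, pd i (fun z => christoffel g z l j k) y * pd l h y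
        - ∑ l, pd j (fun z => christoffel g z l i k) y * pd l h y
        + ∑ l, (∑ m, christoffel g y l i m * christoffel g y m j k) * pd l h y
        - ∑ l, (∑ m, christoffel g y l j m * christoffel g y m i k) * pd l h y := by
    simp only [← Finset.sum_add_distrib, ← Finset.sum_sub_distrib]
    refine Finset.sum_congr rfl fun l _ => ?_
    simp only [riemannUp, Finset.sum_sub_distrib]
    ring
  rw [hd, hd, hq, hq, hR, pd_comm (H.smooth.pd k) hy i j, H.metric.pd_metric hy,
    H.metric.pd_metric hy, H.metric.christoffelLow_symm hy k j i]
  simp only [Finset.sum_add_distrib]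
  ring

/-- The gradient lies in the kernel of the Ricci tensor. -/
lemma ricci_gradUp (H : IsSoliton V g h) (hy : y ∈ V) (k : Fin n) :
    ∑ i, ricci g y k i * gradUp g h i y = 0 := by
  set c := fun i => gradUp g h i y with hc
  have hn : ∀ z ∈ V, h z = ∑ i, gradUp g h i z * pd i h z := by
    intro z hz
    rw [← H.norm z hz, Finset.sum_comm]
    refine Finset.sum_congr rfl fun i _ => ?_
    rw [gradUp, Finset.sum_mul]
    refine Finset.sum_congr rfl fun j _ => ?_
    rw [H.metric.inv_symm hz]
  have h1 : pd k h y = ∑ i, pd k (gradUp g h i) y * pd i h y + ∑ i, c i * pd k (pd i h) y := by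
    conv_lhs => rw [pd_congr H.metric.isOpen hy hn]
    rw [pd_sum (fun i => (H.smooth_gradUp i).mul (H.smooth.pd i)) hy, ← Finset.sum_add_distrib]
    exact Finset.sum_congr rfl fun i _ => pd_mul (H.smooth_gradUp i) (H.smooth.pd i) hy k
  have h2 : ∀ i, pd k (pd i h) y = ∑ j, pd k (fun z => g z i j) y * c j
      + ∑ j, g y i j * pd k (gradUp g h j) y := by
    intro i
    rw [pd_congr H.metric.isOpen hy (fun z hz => (H.sum_metric_gradUp hz i).symm),
      pd_sum (fun j => (H.metric.smooth i j).mul (H.smooth_gradUp j)) hy, ← Finset.sum_add_distrib]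
    exact Finset.sum_congr rfl fun j _ => pd_mul (H.metric.smooth i j) (H.smooth_gradUp j) hy k
  have hg : ∀ j, ∑ i, c i * g y i j = pd j h y := by
    intro j
    rw [← H.sum_metric_gradUp hy]
    exact Finset.sum_congr rfl fun i _ => by rw [H.metric.symm y hy i j, mul_comm]
  have h3 : ∑ i, c i * pd k (pd i h) y = ∑ i, ∑ j, c i * c j * pd k (fun z => g z i j) y
      + ∑ j, pd k (gradUp g h j) y * pd j h y := by
    simp only [h2, mul_add, Finset.sum_add_distrib, ← hg, Finset.mul_sum]
    congr 1
    · exact Finset.sum_congr rfl fun _ _ => Finset.sum_congr rfl fun _ _ => by ring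
    · rw [Finset.sum_comm]
      exact Finset.sum_congr rfl fun _ _ => Finset.sum_congr rfl fun _ _ => by ring
  have h4 : ∑ i, ∑ j, c i * c j * christoffelLow g j k i y
      = ∑ i, c i * ∑ m, christoffel g y m k i * pd m h y := by
    refine Finset.sum_congr rfl fun i _ => ?_
    simp only [← H.metric.sum_mul_christoffel hy, ← hg, Finset.mul_sum]
    rw [Finset.sum_comm]
    exact Finset.sum_congr rfl fun _ _ => Finset.sum_congr rfl fun _ _ => by ring
  have h5 : ∑ i, ∑ j, c i * c j * pd k (fun z => g z i j) y
      = 2 * ∑ i, c i * ∑ m, christoffel g y m k i * pd m h y := by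
    simp only [H.metric.pd_metric hy, mul_add, Finset.sum_add_distrib]
    rw [h4, Finset.sum_comm (f := fun i j => c i * c j * christoffelLow g i k j y)]
    simp only [mul_comm (c _) (c _)] at h4 ⊢
    rw [← h4]
    have : ∑ i, ∑ j, c j * c i * christoffelLow g j k i y
        = ∑ i, ∑ j, c i * c j * christoffelLow g j k i y :=
      Finset.sum_congr rfl fun _ _ => Finset.sum_congr rfl fun _ _ => by ring
    linarith
  have h6 : ∑ i, ricci g y k i * c i = (1 / 2) * pd k h y - (∑ i, c i * pd k (pd i h) y
      - ∑ i, c i * ∑ m, christoffel g y m k i * pd m h y) := by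
    rw [← H.sum_metric_gradUp hy k, Finset.mul_sum, ← Finset.sum_sub_distrib,
      ← Finset.sum_sub_distrib]
    refine Finset.sum_congr rfl fun i _ => ?_
    have := H.soliton y hy k i
    rw [hessian] at this
    rw [eq_sub_of_add_eq this]; ring
  rw [h6]
  linarith

/-- The trace of the Codazzi type equation. -/
lemma trace_codazzi (H : IsSoliton V g h) (hy : y ∈ V) (i : Fin n) :
    ∑ j, ∑ k, (g y)⁻¹ j k * (pd i (fun z => ricci g z j k) y - pd j (fun z => ricci g z i k) y
      - ∑ m, christoffel g y m i k * ricci g y j m + ∑ m, christoffel g y m j k * ricci g y i m)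
      = 0 := by
  simp only [H.codazzi hy]
  have h1 : ∀ j k, ∑ l, riemannUp g y l k i j * pd l h y
      = ∑ p, riemann g y j i k p * gradUp g h p y := by
    intro j k
    have h2 : ∀ p, riemann g y j i k p = ∑ m, g y p m * riemannUp g y m k i j := by
      intro p
      rw [IsMetricOn.riemann_antisymm_left, H.metric.riemann_antisymm_right hy, neg_neg]; rfl
    simp only [h2, ← H.sum_metric_gradUp hy, Finset.mul_sum, Finset.sum_mul]
    rw [Finset.sum_comm]
    refine Finset.sum_congr rfl fun _ _ => Finset.sum_congr rfl fun _ _ => ?_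
    rw [H.metric.symm y hy]; ring
  simp only [h1]
  rw [← H.ricci_gradUp hy i]
  simp only [ricci, Finset.mul_sum, Finset.sum_mul]
  rw [sum_comm₃]
  exact Finset.sum_congr rfl fun _ _ => Finset.sum_congr rfl fun _ _ =>
    Finset.sum_congr rfl fun _ _ => by ring

end IsSoliton

end Coord

namespace Coord

variable {n : ℕ}

/-- `g` is Euclidean to first order at `o`. -/
structure IsNormalAt (g : EuclideanSpace ℝ (Fin n) → Matrix (Fin n) (Fin n) ℝ)
    (o : EuclideanSpace ℝ (Fin n)) : Prop where
  eq_one : g o = 1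
  pd_eq_zero : ∀ k i j, pd k (fun z => g z i j) o = 0

namespace IsNormalAt

variable {V : Set (EuclideanSpace ℝ (Fin n))}
  {g : EuclideanSpace ℝ (Fin n) → Matrix (Fin n) (Fin n) ℝ} {o : EuclideanSpace ℝ (Fin n)}

lemma christoffelLow_eq_zero (N : IsNormalAt g o) (k i j : Fin n) : christoffelLow g k i j o = 0 := by
  simp [christoffelLow, N.pd_eq_zero]

lemma christoffel_eq_zero (N : IsNormalAt g o) (k i j : Fin n) : christoffel g o k i j = 0 := by
  simp [christoffel_eq, N.christoffelLow_eq_zero]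

lemma inv_eq_one (N : IsNormalAt g o) : (g o)⁻¹ = 1 := by rw [N.eq_one, inv_one]

lemma riemann_eq (N : IsNormalAt g o) (i j k l : Fin n) :
    riemann g o i j k l = riemannUp g o k l i j := by
  simp [riemann, N.eq_one, Matrix.one_apply]

lemma riemannUp_eq (N : IsNormalAt g o) (l k i j : Fin n) :
    riemannUp g o l k i j = pd i (fun z => christoffel g z l j k) o
      - pd j (fun z => christoffel g z l i k) o := by
  simp [riemannUp, N.christoffel_eq_zero]

lemma pd_inv_eq_zero (N : IsNormalAt g o) (hg : IsMetricOn V g) (ho : o ∈ V) (a i j : Fin n) :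
    pd a (fun z => (g z)⁻¹ i j) o = 0 := by
  have h1 : pd a (fun z => ∑ k, (g z)⁻¹ i k * g z k j) o = 0 := by
    rw [pd_congr hg.isOpen ho (fun z hz => hg.sum_inv_mul hz i j), pd_const]
  rw [pd_sum (fun k => (hg.smooth_inv i k).mul (hg.smooth k j)) ho] at h1
  simp only [pd_mul (hg.smooth_inv i _) (hg.smooth _ j) ho, N.pd_eq_zero, N.eq_one] at h1
  simpa [Matrix.one_apply] using h1

lemma pd_pd_inv_eq (N : IsNormalAt g o) (hg : IsMetricOn V g) (ho : o ∈ V) (a b i j : Fin n) :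
    pd a (pd b (fun z => (g z)⁻¹ i j)) o = - pd a (pd b (fun z => g z i j)) o := by
  have h1 : pd a (pd b (fun z => ∑ k, (g z)⁻¹ i k * g z k j)) o = 0 := by
    rw [pd_congr hg.isOpen ho (fun z hz => (pd_congr hg.isOpen hz
      (fun w hw => hg.sum_inv_mul hw i j) b).trans (pd_const _ b)), pd_const]
  have hs := fun k => (hg.smooth_inv i k).mul (hg.smooth k j)
  rw [pd_congr hg.isOpen ho (fun z hz => pd_sum hs hz b), pd_sum (fun k => (hs k).pd b) ho] at h1
  simp only [pd_pd_mul hg.isOpen (hg.smooth_inv i _) (hg.smooth _ j) ho, N.pd_eq_zero, N.eq_one,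
    inv_one, Finset.sum_add_distrib] at h1
  simp only [Matrix.one_apply, mul_ite, mul_one, mul_zero, ite_mul, one_mul, zero_mul,
    Finset.sum_ite_eq, Finset.sum_ite_eq', Finset.mem_univ, if_true, Finset.sum_const_zero] at h1
  linarith

lemma pd_pd_metric (N : IsNormalAt g o) (hg : IsMetricOn V g) (ho : o ∈ V) (a b i j : Fin n) :
    pd a (pd b (fun z => g z i j)) o = pd a (fun z => christoffel g z j b i) o
      + pd a (fun z => christoffel g z i b j) o := by
  have h : ∀ k i j, pd a (christoffelLow g k i j) o = pd a (fun z => christoffel g z k i j) o := by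
    intro k i j
    rw [pd_congr hg.isOpen ho (fun z hz => (hg.sum_mul_christoffel hz k i j).symm),
      pd_sum (fun m => (hg.smooth k m).mul (hg.smooth_christoffel m i j)) ho]
    simp only [pd_mul (hg.smooth k _) (hg.smooth_christoffel _ i j) ho, N.pd_eq_zero, N.eq_one]
    simp [Matrix.one_apply]
  rw [pd_congr hg.isOpen ho (fun z hz => hg.pd_metric hz b i j),
    pd_add (hg.smooth_christoffelLow _ _ _) (hg.smooth_christoffelLow _ _ _) ho, h, h]

lemma pd_riemannUp (N : IsNormalAt g o) (hg : IsMetricOn V g) (ho : o ∈ V) (a l k i j : Fin n) :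
    pd a (fun z => riemannUp g z l k i j) o = pd a (pd i (fun z => christoffel g z l j k)) o
      - pd a (pd j (fun z => christoffel g z l i k)) o := by
  have s := hg.smooth_christoffel
  have s2 := fun m => ((s l i m).mul (s m j k)).sub ((s l j m).mul (s m i k))
  simp only [riemannUp]
  rw [pd_add (((s _ _ _).pd _).sub ((s _ _ _).pd _)) (SmoothOn.sum s2) ho,
    pd_sub ((s _ _ _).pd _) ((s _ _ _).pd _) ho, pd_sum s2 ho]
  simp [pd_sub ((s l i _).mul (s _ j k)) ((s l j _).mul (s _ i k)) ho, pd_mul (s _ _ _) (s _ _ _) ho,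
    N.christoffel_eq_zero]

lemma bianchi (N : IsNormalAt g o) (hg : IsMetricOn V g) (ho : o ∈ V) (a l k i j : Fin n) :
    pd a (fun z => riemannUp g z l k i j) o + pd i (fun z => riemannUp g z l k j a) o
      + pd j (fun z => riemannUp g z l k a i) o = 0 := by
  have s := hg.smooth_christoffel
  rw [N.pd_riemannUp hg ho, N.pd_riemannUp hg ho, N.pd_riemannUp hg ho,
    pd_comm (s _ _ _) ho a i, pd_comm (s _ _ _) ho a j, pd_comm (s _ _ _) ho i j]
  ring

/-- The contracted second Bianchi identity. -/
lemma contracted_bianchi (N : IsNormalAt g o) (hg : IsMetricOn V g) (ho : o ∈ V) (l e : Fin n) :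
    ∑ i, pd i (fun z => riemannUp g z l e i e) o
      = pd l (fun z => ricci g z e e) o - pd e (fun z => ricci g z l e) o := by
  have hlow : ∀ a i j k l, pd a (fun z => riemann g z i j k l) o
      = pd a (fun z => riemannUp g z k l i j) o := by
    intro a i j k l
    simp only [riemann]
    rw [pd_sum (fun m => (hg.smooth k m).mul (hg.smooth_riemannUp m l i j)) ho]
    simp only [pd_mul (hg.smooth k _) (hg.smooth_riemannUp _ l i j) ho, N.pd_eq_zero, N.eq_one]
    simp [Matrix.one_apply]
  have h1 : ∀ i, pd i (fun z => riemannUp g z l e i e) o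
      = pd i (fun z => riemannUp g z i e l e) o := by
    intro i
    rw [← hlow, ← hlow]
    exact pd_congr hg.isOpen ho (fun z hz => hg.riemann_pair_symm hz i e l e) i
  have hanti : ∀ a l k i j, pd a (fun z => riemannUp g z l k i j) o
      = - pd a (fun z => riemannUp g z l k j i) o := by
    intro a l k i j
    rw [N.pd_riemannUp hg ho, N.pd_riemannUp hg ho]; ring
  have hric : ∀ a j l, pd a (fun z => ricci g z j l) o
      = ∑ i, pd a (fun z => riemannUp g z i l i j) o := by
    intro a j l
    rw [pd_congr hg.isOpen ho (fun z hz => hg.ricci_eq hz j l),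
      pd_sum (fun i => hg.smooth_riemannUp i l i j) ho]
  rw [hric, hric, ← Finset.sum_sub_distrib]
  refine Finset.sum_congr rfl fun i _ => ?_
  have := N.bianchi hg ho i i e l e
  rw [hanti l i e e i] at this
  rw [h1]
  linarith

end IsNormalAt

/-- The Ricci tensor is diagonal at a point where the metric is Euclidean to first order. -/
structure IsAdaptedAt (g : EuclideanSpace ℝ (Fin n) → Matrix (Fin n) (Fin n) ℝ)
    (o : EuclideanSpace ℝ (Fin n)) (μ : Fin n → ℝ) : Prop extends IsNormalAt g o where
  ricci_eq : ∀ i j, ricci g o i j = if i = j then μ i else 0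

namespace IsSoliton

variable {V : Set (EuclideanSpace ℝ (Fin n))}
  {g : EuclideanSpace ℝ (Fin n) → Matrix (Fin n) (Fin n) ℝ} {h : EuclideanSpace ℝ (Fin n) → ℝ}
  {o : EuclideanSpace ℝ (Fin n)} {μ : Fin n → ℝ}

lemma pd_pd_eq (H : IsSoliton V g h) (A : IsAdaptedAt g o μ) (ho : o ∈ V) (i j : Fin n) :
    pd i (pd j h) o = if i = j then 1 / 2 - μ i else 0 := by
  have := H.soliton o ho i j
  rw [hessian, A.ricci_eq, A.eq_one] at this
  simp only [A.christoffel_eq_zero, zero_mul, Finset.sum_const_zero, Matrix.one_apply] at this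
  split_ifs with hij
  · simp only [hij, if_true] at this ⊢; linarith
  · simp only [hij, if_false] at this; linarith

lemma gradUp_eq (A : IsAdaptedAt g o μ) (i : Fin n) :
    gradUp g h i o = pd i h o := by
  simp [gradUp, A.inv_eq_one, Matrix.one_apply]

lemma pd_gradUp_eq (H : IsSoliton V g h) (A : IsAdaptedAt g o μ) (ho : o ∈ V) (a i : Fin n) :
    pd a (gradUp g h i) o = pd a (pd i h) o := by
  have h1 : pd a (gradUp g h i) o = pd a (fun z => ∑ j, (g z)⁻¹ i j * pd j h z) o := rfl
  rw [h1, pd_sum (fun j => (H.metric.smooth_inv i j).mul (H.smooth.pd j)) ho]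
  simp only [pd_mul (H.metric.smooth_inv i _) (H.smooth.pd _) ho,
    A.pd_inv_eq_zero H.metric ho, A.inv_eq_one]
  simp [Matrix.one_apply]

/-- Differentiating `Ric(∇h) = 0`. -/
lemma sum_pd_ricci_mul (H : IsSoliton V g h) (A : IsAdaptedAt g o μ) (ho : o ∈ V) (k : Fin n) :
    ∑ l, pd k (fun z => ricci g z l k) o * pd l h o = - (μ k * (1 / 2 - μ k)) := by
  have hs := fun i => (H.metric.smooth_ricci k i).mul (H.smooth_gradUp i)
  have h1 : pd k (fun z => ∑ i, ricci g z k i * gradUp g h i z) o = 0 := by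
    rw [pd_congr H.metric.isOpen ho (fun z hz => H.ricci_gradUp hz k), pd_const]
  rw [pd_sum hs ho] at h1
  simp only [pd_mul (H.metric.smooth_ricci k _) (H.smooth_gradUp _) ho, gradUp_eq A,
    H.pd_gradUp_eq A ho, A.ricci_eq, H.pd_pd_eq A ho, Finset.sum_add_distrib] at h1
  simp only [ite_mul, zero_mul, mul_ite, mul_zero, Finset.sum_ite_eq, Finset.mem_univ, if_true] at h1
  have h2 : ∑ l, pd k (fun z => ricci g z l k) o * pd l h o
      = ∑ l, pd k (fun z => ricci g z k l) o * pd l h o :=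
    Finset.sum_congr rfl fun l _ => by
      rw [pd_congr H.metric.isOpen ho (fun z hz => H.metric.ricci_symm hz l k)]
  rw [h2]; linarith

/-- The radial curvatures in terms of the radial derivative of the Ricci tensor. -/
lemma radial_curvature (H : IsSoliton V g h) (A : IsAdaptedAt g o μ) (ho : o ∈ V) (k : Fin n) :
    ∑ i, ∑ l, riemann g o i k l k * pd i h o * pd l h o
      = ∑ i, pd i h o * pd i (fun z => ricci g z k k) o + μ k * (1 / 2 - μ k) := by
  have h1 : ∀ i, ∑ l, riemann g o i k l k * pd i h o * pd l h o
      = pd i h o * (pd i (fun z => ricci g z k k) o - pd k (fun z => ricci g z i k) o) := by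
    intro i
    have := H.codazzi ho i k k
    simp only [A.christoffel_eq_zero, zero_mul, Finset.sum_const_zero, sub_zero, add_zero] at this
    rw [this, Finset.mul_sum]
    exact Finset.sum_congr rfl fun l _ => by rw [A.riemann_eq]; ring
  have h2 := H.sum_pd_ricci_mul A ho k
  simp only [mul_comm _ (pd _ h o)] at h2
  rw [Finset.sum_congr rfl fun i _ => h1 i]
  simp only [mul_sub (pd _ h o), Finset.sum_sub_distrib, h2]
  ring

lemma sum_sectional_eq (H : IsSoliton V g h) (A : IsAdaptedAt g o μ) (ho : o ∈ V) (e : Fin n) :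
    ∑ i, riemann g o i e i e = μ e := by
  have := H.metric.ricci_eq ho e e
  rw [A.ricci_eq, if_pos rfl] at this
  rw [this]
  exact Finset.sum_congr rfl fun i _ => A.riemann_eq i e i e

/-- The divergence of the Ricci tensor, differentiated once more. -/
lemma sum_pd_pd_ricci (H : IsSoliton V g h) (A : IsAdaptedAt g o μ) (ho : o ∈ V) (e : Fin n) :
    ∑ j, pd e (pd j (fun z => ricci g z e j)) o
      = ∑ j, μ j * pd e (fun z => christoffel g z j e j) o
        + μ e * ∑ j, pd e (fun z => christoffel g z e j j) o := by
  have sr := H.metric.smooth_ricci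
  have sq := H.metric.smooth_inv
  have sc := H.metric.smooth_christoffel
  -- the trace of the Codazzi equation
  have sT : ∀ j k, SmoothOn V (fun z => pd e (fun w => ricci g w j k) z
      - pd j (fun w => ricci g w e k) z - ∑ m, christoffel g z m e k * ricci g z j m
      + ∑ m, christoffel g z m j k * ricci g z e m) := fun j k =>
    ((((sr j k).pd e).sub ((sr e k).pd j)).sub
      (SmoothOn.sum fun m => (sc m e k).mul (sr j m))).add
      (SmoothOn.sum fun m => (sc m j k).mul (sr e m))
  have h1 := (pd_congr H.metric.isOpen ho (fun z hz => H.trace_codazzi hz e) e).trans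
    (pd_const (y := o) 0 e)
  rw [pd_sum (fun j => SmoothOn.sum fun k => (sq j k).mul (sT j k)) ho] at h1
  rw [Finset.sum_congr rfl fun j _ => pd_sum (fun k => (sq j k).mul (sT j k)) ho e] at h1
  simp only [fun j k => pd_mul (sq j k) (sT j k) ho e, A.pd_inv_eq_zero H.metric ho,
    A.inv_eq_one] at h1
  simp only [Matrix.one_apply, zero_mul, zero_add, ite_mul, one_mul, Finset.sum_ite_eq,
    Finset.mem_univ, if_true] at h1
  have h2 : ∀ j, pd e (fun z => pd e (fun w => ricci g w j j) z - pd j (fun w => ricci g w e j) z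
      - ∑ m, christoffel g z m e j * ricci g z j m + ∑ m, christoffel g z m j j * ricci g z e m) o
      = pd e (pd e (fun w => ricci g w j j)) o - pd e (pd j (fun w => ricci g w e j)) o
        - μ j * pd e (fun z => christoffel g z j e j) o
        + μ e * pd e (fun z => christoffel g z e j j) o := by
    intro j
    have s1 := fun m => (sc m e j).mul (sr j m)
    have s2 := fun m => (sc m j j).mul (sr e m)
    rw [pd_add ((((sr j j).pd e).sub ((sr e j).pd j)).sub (SmoothOn.sum s1)) (SmoothOn.sum s2) ho,
      pd_sub (((sr j j).pd e).sub ((sr e j).pd j)) (SmoothOn.sum s1) ho,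
      pd_sub ((sr j j).pd e) ((sr e j).pd j) ho, pd_sum s1 ho, pd_sum s2 ho]
    simp only [fun m => pd_mul (sc m e j) (sr j m) ho e, fun m => pd_mul (sc m j j) (sr e m) ho e,
      A.christoffel_eq_zero, A.ricci_eq]
    simp [mul_comm]
  simp only [h2, Finset.sum_add_distrib, Finset.sum_sub_distrib] at h1
  -- the second derivative of the scalar curvature
  have sS := fun j k => (sq j k).mul (sr j k)
  have hS : ∀ z ∈ V, ∑ j, ∑ k, (g z)⁻¹ j k * ricci g z j k = 3 / 2 := H.scalar
  have h3 : pd e (pd e (fun z => ∑ j, ∑ k, (g z)⁻¹ j k * ricci g z j k)) o = 0 := by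
    rw [pd_congr H.metric.isOpen ho (fun z hz => (pd_congr H.metric.isOpen hz
      (fun w hw => hS w hw) e).trans (pd_const _ e)), pd_const]
  rw [pd_congr H.metric.isOpen ho (fun z hz => pd_sum (fun j => SmoothOn.sum (sS j)) hz e),
    pd_sum (fun j => (SmoothOn.sum (sS j)).pd e) ho] at h3
  have h4 : ∀ j, pd e (pd e (fun z => ∑ k, (g z)⁻¹ j k * ricci g z j k)) o
      = pd e (pd e (fun z => ricci g z j j)) o
        - 2 * (μ j * pd e (fun z => christoffel g z j e j) o) := by
    intro j
    rw [pd_congr H.metric.isOpen ho (fun z hz => pd_sum (sS j) hz e),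
      pd_sum (fun k => (sS j k).pd e) ho]
    simp only [fun k => pd_pd_mul H.metric.isOpen (sq j k) (sr j k) ho e e,
      A.pd_inv_eq_zero H.metric ho, A.pd_pd_inv_eq H.metric ho, A.inv_eq_one, A.ricci_eq,
      A.pd_pd_metric H.metric ho]
    simp [Matrix.one_apply, Finset.sum_add_distrib]
    ring
  simp only [h4, Finset.sum_sub_distrib, ← Finset.mul_sum] at h3
  simp only [← Finset.mul_sum] at h1
  linarith

/-- The drift Laplacian of the Ricci tensor in the direction of an eigenvector. -/
lemma sum_pd_pd_ricci_eq (H : IsSoliton V g h) (A : IsAdaptedAt g o μ) (ho : o ∈ V) (e : Fin n) :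
    ∑ i, pd i (pd i (fun z => ricci g z e e)) o
      = μ e * ∑ i, pd i (pd i (fun z => g z e e)) o
        + ∑ l, pd l h o * pd l (fun z => ricci g z e e) o + μ e
        - 2 * ∑ i, riemann g o i e i e * μ i := by
  have sr := H.metric.smooth_ricci
  have sc := H.metric.smooth_christoffel
  have sR := H.metric.smooth_riemannUp
  have h1 : ∀ i, pd i (pd i (fun z => ricci g z e e)) o - pd i (pd e (fun z => ricci g z i e)) o
      - μ e * pd i (fun z => christoffel g z e i e) o
      + μ i * pd i (fun z => christoffel g z i e e) o
      = ∑ l, pd i (fun z => riemannUp g z l e i e) o * pd l h o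
        + riemann g o i e i e * (1 / 2 - μ i) := by
    intro i
    have s1 := fun m => (sc m i e).mul (sr e m)
    have s2 := fun m => (sc m e e).mul (sr i m)
    have h0 := pd_congr H.metric.isOpen ho (fun z hz => H.codazzi hz i e e) i
    rw [pd_add ((((sr e e).pd i).sub ((sr i e).pd e)).sub (SmoothOn.sum s1)) (SmoothOn.sum s2) ho,
      pd_sub (((sr e e).pd i).sub ((sr i e).pd e)) (SmoothOn.sum s1) ho,
      pd_sub ((sr e e).pd i) ((sr i e).pd e) ho, pd_sum s1 ho, pd_sum s2 ho,
      pd_sum (fun l => (sR l e i e).mul (H.smooth.pd l)) ho] at h0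
    simp only [fun m => pd_mul (sc m i e) (sr e m) ho i, fun m => pd_mul (sc m e e) (sr i m) ho i,
      fun l => pd_mul (sR l e i e) (H.smooth.pd l) ho i, A.christoffel_eq_zero, A.ricci_eq,
      H.pd_pd_eq A ho, Finset.sum_add_distrib, ← A.riemann_eq] at h0
    simp only [zero_mul, mul_ite, mul_zero, add_zero, Finset.sum_ite_eq,
      Finset.sum_const_zero, Finset.mem_univ, if_true] at h0
    rw [mul_comm (μ e), mul_comm (μ i)]
    linarith
  have h2 : ∑ i, ∑ l, pd i (fun z => riemannUp g z l e i e) o * pd l h o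
      = ∑ l, pd l h o * pd l (fun z => ricci g z e e) o + μ e * (1 / 2 - μ e) := by
    rw [Finset.sum_comm]
    simp only [← Finset.sum_mul, A.contracted_bianchi H.metric ho, sub_mul, Finset.sum_sub_distrib,
      H.sum_pd_ricci_mul A ho e]
    simp only [mul_comm (pd _ h o)]
    ring
  have h3 : ∀ i, pd i (pd e (fun z => ricci g z i e)) o = pd e (pd i (fun z => ricci g z e i)) o := by
    intro i
    rw [pd_comm (sr i e) ho i e]
    exact pd_congr H.metric.isOpen ho (fun z hz => pd_congr H.metric.isOpen hz
      (fun w hw => H.metric.ricci_symm hw i e) i) e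
  have h4 : ∀ i, riemann g o i e i e = pd e (fun z => christoffel g z e i i) o
      - pd i (fun z => christoffel g z e i e) o := by
    intro i
    rw [IsMetricOn.riemann_antisymm_left, H.metric.riemann_antisymm_right ho, neg_neg, A.riemann_eq,
      A.riemannUp_eq, pd_congr H.metric.isOpen ho (fun z hz => H.metric.christoffel_symm hz e e i)]
  have h5 : ∀ i, riemann g o i e i e = pd i (fun z => christoffel g z i e e) o
      - pd e (fun z => christoffel g z i e i) o := by
    intro i
    rw [A.riemann_eq, A.riemannUp_eq,
      pd_congr H.metric.isOpen ho (fun z hz => H.metric.christoffel_symm hz i i e)]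
  have h6 : ∀ i, pd i (pd i (fun z => g z e e)) o
      = 2 * pd i (fun z => christoffel g z e i e) o := by
    intro i; rw [A.pd_pd_metric H.metric ho]; ring
  have h7 := H.sum_pd_pd_ricci A ho e
  have h8 := H.sum_sectional_eq A ho e
  have h9 : ∑ i, pd e (fun z => christoffel g z e i i) o
      = μ e + ∑ i, pd i (fun z => christoffel g z e i e) o := by
    rw [← h8, ← Finset.sum_add_distrib]
    exact Finset.sum_congr rfl fun i _ => by rw [h4]; ring
  have h10 : ∑ i, μ i * pd i (fun z => christoffel g z i e e) o
      = ∑ i, riemann g o i e i e * μ i + ∑ i, μ i * pd e (fun z => christoffel g z i e i) o := by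
    rw [← Finset.sum_add_distrib]
    exact Finset.sum_congr rfl fun i _ => by rw [h5]; ring
  have h11 := Finset.sum_congr (rfl : (Finset.univ : Finset (Fin n)) = Finset.univ) fun i _ => h1 i
  simp only [Finset.sum_add_distrib, Finset.sum_sub_distrib, h3, h2, h7, ← Finset.mul_sum, h10, h9,
    mul_sub] at h11
  simp only [h6, ← Finset.mul_sum]
  have h12 : ∑ i, riemann g o i e i e * (1 / 2) = μ e * (1 / 2) := by rw [← Finset.sum_mul, h8]
  rw [h12] at h11
  linarith

end IsSoliton

end Coord

namespace Coord

variable {n : ℕ}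

lemma IsNormalAt.laplacian_eq {g : EuclideanSpace ℝ (Fin n) → Matrix (Fin n) (Fin n) ℝ}
    {o : EuclideanSpace ℝ (Fin n)} (N : IsNormalAt g o) (w : EuclideanSpace ℝ (Fin n) → ℝ) :
    laplacian g w o = ∑ i, pd i (pd i w) o := by
  simp [laplacian, hessian, N.inv_eq_one, N.christoffel_eq_zero, Matrix.one_apply]

/-- The Ricci curvature of the direction `∂_e`, as a quotient by the squared length of its component
orthogonal to `∇h`. -/
noncomputable def ricciQuotient (g : EuclideanSpace ℝ (Fin n) → Matrix (Fin n) (Fin n) ℝ)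
    (h : EuclideanSpace ℝ (Fin n) → ℝ) (e : Fin n) (y : EuclideanSpace ℝ (Fin n)) : ℝ :=
  ricci g y e e / (g y e e - pd e h y ^ 2 / h y)

namespace IsSoliton

variable {V : Set (EuclideanSpace ℝ (Fin n))}
  {g : EuclideanSpace ℝ (Fin n) → Matrix (Fin n) (Fin n) ℝ} {h : EuclideanSpace ℝ (Fin n) → ℝ}
  {o : EuclideanSpace ℝ (Fin n)} {μ : Fin n → ℝ}

lemma sum_eigenvalues (H : IsSoliton V g h) (A : IsAdaptedAt g o μ) (ho : o ∈ V) :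
    ∑ i, μ i = 3 / 2 := by
  rw [← H.scalar o ho]
  simp [Coord.scalar, A.inv_eq_one, A.ricci_eq, Matrix.one_apply]

lemma eigenvalue_mul_pd (H : IsSoliton V g h) (A : IsAdaptedAt g o μ) (ho : o ∈ V) (k : Fin n) :
    μ k * pd k h o = 0 := by
  have := H.ricci_gradUp ho k
  simpa [A.ricci_eq, gradUp_eq A] using this

lemma sum_pd_ricci_diag (H : IsSoliton V g h) (A : IsAdaptedAt g o μ) (ho : o ∈ V) (l : Fin n) :
    ∑ k, pd l (fun z => ricci g z k k) o = 0 := by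
  have sS := fun j k => (H.metric.smooth_inv j k).mul (H.metric.smooth_ricci j k)
  have hS : ∀ z ∈ V, ∑ j, ∑ k, (g z)⁻¹ j k * ricci g z j k = 3 / 2 := H.scalar
  have h1 := (pd_congr H.metric.isOpen ho hS l).trans (pd_const _ l)
  rw [pd_sum (fun j => SmoothOn.sum (sS j)) ho,
    Finset.sum_congr rfl fun j _ => pd_sum (sS j) ho l] at h1
  simp only [fun j k => pd_mul (H.metric.smooth_inv j k) (H.metric.smooth_ricci j k) ho l,
    A.pd_inv_eq_zero H.metric ho, A.inv_eq_one] at h1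
  simpa [Matrix.one_apply] using h1

lemma sum_eigenvalues_sq (H : IsSoliton V g h) (A : IsAdaptedAt g o μ) (ho : o ∈ V) :
    ∑ i, μ i ^ 2 = 3 / 4 := by
  have h1 := Finset.sum_congr (rfl : (Finset.univ : Finset (Fin n)) = Finset.univ)
    fun k _ => H.radial_curvature A ho k
  have h2 : ∑ k, ∑ i, ∑ l, riemann g o i k l k * pd i h o * pd l h o = 0 := by
    rw [← sum_comm₃]
    refine Finset.sum_eq_zero fun i _ => Finset.sum_eq_zero fun l _ => ?_
    have h3 : ∑ k, riemann g o i k l k = if i = l then μ i else 0 := by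
      rw [← A.ricci_eq, H.metric.ricci_symm ho, H.metric.ricci_eq ho]
      refine Finset.sum_congr rfl fun k _ => ?_
      rw [IsMetricOn.riemann_antisymm_left, H.metric.riemann_antisymm_right ho, neg_neg,
        H.metric.riemann_pair_symm ho, A.riemann_eq]
    simp only [mul_assoc]
    rw [← Finset.sum_mul, h3]
    split_ifs with hil
    · rw [← mul_assoc, H.eigenvalue_mul_pd A ho, zero_mul]
    · rw [zero_mul]
  rw [h2, Finset.sum_add_distrib, Finset.sum_comm] at h1
  simp only [← Finset.mul_sum, H.sum_pd_ricci_diag A ho, mul_zero, Finset.sum_const_zero,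
    mul_sub, Finset.sum_sub_distrib, ← Finset.sum_mul, H.sum_eigenvalues A ho] at h1
  simp only [pow_two]
  linarith

/-- The derivative of `|Ric|²`, which is assumed constant. -/
lemma sum_eigenvalue_mul_pd_ricci (H : IsSoliton V g h) (A : IsAdaptedAt g o μ) (ho : o ∈ V) {c : ℝ}
    (hc : ∀ y ∈ V, (((g y)⁻¹ * Matrix.of (ricci g y)) * ((g y)⁻¹ * Matrix.of (ricci g y))).trace = c)
    (l : Fin n) : ∑ k, μ k * pd l (fun z => ricci g z k k) o = 0 := by
  set B := fun (i j : Fin n) (y : EuclideanSpace ℝ (Fin n)) => ∑ k, (g y)⁻¹ i k * ricci g y k j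
  have sq := H.metric.smooth_inv
  have sr := H.metric.smooth_ricci
  have hB : ∀ i j, SmoothOn V (B i j) := fun i j => SmoothOn.sum fun k => (sq i k).mul (sr k j)
  have h1 : ∀ y ∈ V, ∑ i, ∑ j, B i j y * B j i y = c := fun y hy => by
    rw [← hc y hy, Matrix.trace]
    simp only [Matrix.diag_apply, Matrix.mul_apply, Matrix.of_apply, B]
  have hs := fun i j => (hB i j).mul (hB j i)
  have h2 := (pd_congr H.metric.isOpen ho h1 l).trans (pd_const _ l)
  have hpB : ∀ i j, pd l (B i j) o = pd l (fun z => ricci g z i j) o := by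
    intro i j
    rw [pd_sum (fun k => (sq i k).mul (sr k j)) ho]
    simp only [fun k => pd_mul (sq i k) (sr k j) ho l, A.pd_inv_eq_zero H.metric ho, A.inv_eq_one]
    simp [Matrix.one_apply]
  have hB0 : ∀ i j, B i j o = if i = j then μ i else 0 := by
    intro i j
    rw [← A.ricci_eq]
    simp [B, A.inv_eq_one, Matrix.one_apply]
  rw [pd_sum (fun i => SmoothOn.sum (hs i)) ho,
    Finset.sum_congr rfl fun i _ => pd_sum (hs i) ho l] at h2
  simp only [fun i j => pd_mul (hB i j) (hB j i) ho l, hpB, hB0, Finset.sum_add_distrib] at h2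
  simp only [mul_ite, mul_zero, ite_mul, zero_mul, Finset.sum_ite_eq, Finset.sum_ite_eq',
    Finset.mem_univ, if_true] at h2
  simp only [mul_comm (pd _ _ _)] at h2
  linarith

/-- The drift Laplacian of the quotient `ricciQuotient`. -/
lemma laplacian_ricciQuotient (H : IsSoliton V g h) (A : IsAdaptedAt g o μ) (ho : o ∈ V) (e : Fin n)
    (he : pd e h o = 0) (hpos : ∀ y ∈ V, h y ≠ 0)
    (hD : ∀ y ∈ V, g y e e - pd e h y ^ 2 / h y ≠ 0) :
    (∀ i, pd i (ricciQuotient g h e) o = pd i (fun z => ricci g z e e) o) ∧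
    laplacian g (ricciQuotient g h e) o - ∑ i, pd i h o * pd i (ricciQuotient g h e) o
      = μ e - 2 * ∑ i, riemann g o i e i e * μ i + 2 * μ e * (1 / 2 - μ e) ^ 2 / h o := by
  have hU := H.metric.isOpen
  set D := fun y => g y e e - pd e h y ^ 2 / h y with hDdef
  set W := ricciQuotient g h e with hW
  have sg := H.metric.smooth e e
  have sh := H.smooth
  have se := sh.pd e
  have sr := H.metric.smooth_ricci e e
  have sD : SmoothOn V D := sg.sub ((se.pow 2).div sh hpos)
  have sW : SmoothOn V W := sr.div sD hD
  have eD : ∀ y ∈ V, D y * h y = g y e e * h y - pd e h y * pd e h y := by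
    intro y hy
    have := hpos y hy
    simp only [hDdef]; field_simp
  have eW : ∀ y ∈ V, W y * D y = ricci g y e e := fun y hy => div_mul_cancel₀ _ (hD y hy)
  have h0 := hpos o ho
  have gee : g o e e = 1 := by rw [A.eq_one, Matrix.one_apply_eq]
  have D0 : D o = 1 := by simp [hDdef, gee, he]
  have W0 : W o = μ e := by rw [← mul_one (W o), ← D0, eW o ho, A.ricci_eq, if_pos rfl]
  have dD : ∀ i, pd i D o = 0 := by
    intro i
    have h1 := pd_congr hU ho eD i
    rw [pd_mul sD sh ho, pd_sub (sg.mul sh) (se.mul se) ho, pd_mul sg sh ho, pd_mul se se ho, D0,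
      gee, he, A.pd_eq_zero] at h1
    have h2 : pd i D o * h o = 0 := by linarith
    exact (mul_eq_zero.1 h2).resolve_right h0
  have ddD : ∀ i, pd i (pd i D) o = pd i (pd i (fun z => g z e e)) o
      - 2 * (if i = e then 1 / 2 - μ i else 0) ^ 2 / h o := by
    intro i
    have h1 := pd_congr hU ho (fun z hz => pd_congr hU hz eD i) i
    rw [pd_pd_mul hU sD sh ho, pd_congr hU ho (fun z hz => pd_sub (sg.mul sh) (se.mul se) hz i) i,
      pd_sub ((sg.mul sh).pd i) ((se.mul se).pd i) ho, pd_pd_mul hU sg sh ho,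
      pd_pd_mul hU se se ho, D0, dD, gee, he, A.pd_eq_zero] at h1
    rw [← H.pd_pd_eq A ho]
    have h2 : pd i (pd i D) o * h o
        = pd i (pd i (fun z => g z e e)) o * h o - 2 * pd i (pd e h) o ^ 2 := by linarith
    rw [eq_sub_iff_add_eq, ← mul_left_inj' h0, add_mul, h2, div_mul_cancel₀ _ h0]
    ring
  have dW : ∀ i, pd i W o = pd i (fun z => ricci g z e e) o := by
    intro i
    have h1 := pd_congr hU ho eW i
    rw [pd_mul sW sD ho, D0, dD] at h1
    linarith
  have ddW : ∀ i, pd i (pd i W) o = pd i (pd i (fun z => ricci g z e e)) o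
      - μ e * pd i (pd i D) o := by
    intro i
    have h1 := pd_congr hU ho (fun z hz => pd_congr hU hz eW i) i
    rw [pd_pd_mul hU sW sD ho, D0, dD, W0] at h1
    linarith
  refine ⟨dW, ?_⟩
  rw [A.laplacian_eq]
  simp only [ddW, dW, ddD, mul_sub, Finset.sum_sub_distrib, H.sum_pd_pd_ricci_eq A ho e]
  have h3 : ∑ i, μ e * (2 * (if i = e then 1 / 2 - μ i else 0) ^ 2 / h o)
      = μ e * (2 * (1 / 2 - μ e) ^ 2 / h o) := by
    rw [Finset.sum_eq_single e (fun b _ hb => by simp [hb]) (by simp)]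
    simp
  rw [h3, ← Finset.mul_sum]
  ring

end IsSoliton

end Coord

namespace Coord

variable {n m : ℕ}

section inverse

variable {V : Set (EuclideanSpace ℝ (Fin n))}
  {ψ : EuclideanSpace ℝ (Fin n) → EuclideanSpace ℝ (Fin n)} {z : EuclideanSpace ℝ (Fin n)}

lemma fderiv_eq_mulVec (hψ : ∀ a, SmoothOn V (fun z => ψ z a)) (hz : z ∈ V)
    (v : EuclideanSpace ℝ (Fin n)) (a : Fin n) :
    (fderiv ℝ ψ z v) a = (jacMatrix ψ z).mulVec v a := by
  rw [fderiv_coord hψ hz, fderiv_apply_eq_sum_pd]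
  simp only [Matrix.mulVec, dotProduct, jacMatrix, Matrix.of_apply, jac]
  exact Finset.sum_congr rfl fun _ _ => mul_comm _ _

lemma injective_fderiv (hψ : ∀ a, SmoothOn V (fun z => ψ z a)) (hz : z ∈ V)
    (hJ : (jacMatrix ψ z).det ≠ 0) : Function.Injective (fderiv ℝ ψ z) := by
  refine (injective_iff_map_eq_zero _).2 fun v hv => ?_
  have h : (jacMatrix ψ z).mulVec v = 0 := by
    funext a
    rw [← fderiv_eq_mulVec hψ hz, hv]; rfl
  have := Matrix.eq_zero_of_mulVec_eq_zero hJ h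
  ext a
  exact congrFun this a

lemma smooth_det_jacMatrix (hψ : ∀ a, SmoothOn V (fun z => ψ z a)) :
    SmoothOn V (fun z => (jacMatrix ψ z).det) :=
  SmoothOn.det fun a i => (hψ a).pd i

lemma SmoothOn.isOpen_ne {h : EuclideanSpace ℝ (Fin n) → ℝ} (hV : IsOpen V) (hh : SmoothOn V h)
    (c : ℝ) : IsOpen (V ∩ {y | h y ≠ c}) := by
  have : ContinuousOn h V := fun y hy => (hh y hy).continuousAt.continuousWithinAt
  exact this.isOpen_inter_preimage hV _root_.isOpen_ne

lemma SmoothOn.isOpen_gt {h : EuclideanSpace ℝ (Fin n) → ℝ} (hV : IsOpen V) (hh : SmoothOn V h)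
    (c : ℝ) : IsOpen (V ∩ {y | c < h y}) := by
  have : ContinuousOn h V := fun y hy => (hh y hy).continuousAt.continuousWithinAt
  exact this.isOpen_inter_preimage hV isOpen_Ioi

/-- The inverse function theorem. -/
lemma exists_local_inverse (hV : IsOpen V) (hψ : ∀ a, SmoothOn V (fun z => ψ z a)) (hz : z ∈ V)
    (hJ : (jacMatrix ψ z).det ≠ 0) :
    ∃ (W : Set (EuclideanSpace ℝ (Fin n))) (χ : EuclideanSpace ℝ (Fin n) → EuclideanSpace ℝ (Fin n)),
      IsOpen W ∧ ψ z ∈ W ∧ (∀ a, SmoothOn W (fun w => χ w a)) ∧ (∀ w ∈ W, χ w ∈ V) ∧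
      (∀ w ∈ W, ψ (χ w) = w) ∧ χ (ψ z) = z ∧ ∀ᶠ y in 𝓝 z, χ (ψ y) = y := by
  have hequiv : ∀ y ∈ V, (jacMatrix ψ y).det ≠ 0 →
      ∃ L : EuclideanSpace ℝ (Fin n) ≃L[ℝ] EuclideanSpace ℝ (Fin n), HasFDerivAt ψ (L : _ →L[ℝ] _) y := by
    intro y hy hJ
    have hd : DifferentiableAt ℝ ψ y := differentiableAt_euclidean.2 fun a => (hψ a).differentiableAt hy
    refine ⟨(LinearEquiv.ofInjectiveEndo (fderiv ℝ ψ y).toLinearMap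
      (injective_fderiv hψ hy hJ)).toContinuousLinearEquiv, ?_⟩
    convert hd.hasFDerivAt
    ext v; rfl
  have hc : ∀ y ∈ V, ContDiffAt ℝ ∞ ψ y := fun y hy => contDiffAt_euclidean.2 fun a => hψ a y hy
  obtain ⟨L, hL⟩ := hequiv z hz hJ
  set F := (hc z hz).toOpenPartialHomeomorph ψ hL (by simp)
  have hFz : z ∈ F.source := (hc z hz).mem_toOpenPartialHomeomorph_source hL (by simp)
  have hFc : ∀ y, F y = ψ y := fun _ => rfl
  have hsymm : F.symm (ψ z) = z := F.left_inv hFz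
  have hO := SmoothOn.isOpen_ne hV (smooth_det_jacMatrix hψ) 0
  have hmem : ψ z ∈ F.target := F.map_source hFz
  refine ⟨F.target ∩ F.symm ⁻¹' (V ∩ {y | (jacMatrix ψ y).det ≠ 0}), F.symm,
    F.symm.isOpen_inter_preimage hO, ⟨hmem, ?_⟩, ?_, fun w hw => hw.2.1,
    fun w hw => F.right_inv hw.1, hsymm, ?_⟩
  · rw [Set.mem_preimage, hsymm]; exact ⟨hz, hJ⟩
  · intro a w hw
    obtain ⟨L', hL'⟩ := hequiv _ hw.2.1 hw.2.2
    have := F.contDiffAt_symm (n := ∞) (f₀' := L') hw.1 hL' (hc _ hw.2.1)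
    exact contDiffAt_euclidean.1 this a
  · filter_upwards [F.open_source.mem_nhds hFz] with y hy
    exact F.left_inv hy

end inverse

end Coord

namespace Riem

set_option linter.unusedSectionVars false

open Coord

variable {n m : ℕ} {M : Type*} [TopologicalSpace M] [ChartedSpace (EuclideanSpace ℝ (Fin n)) M]
  [IsManifold (𝓡 n) ∞ M]

/-- Reparametrization. -/
lemma IsParam.comp {k : ℕ} {U : Set (EuclideanSpace ℝ (Fin k))}
    {Ψ : EuclideanSpace ℝ (Fin k) → M} (HΨ : IsParam (n := n) U Ψ)
    {V : Set (EuclideanSpace ℝ (Fin m))} (hV : IsOpen V)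
    {ψ : EuclideanSpace ℝ (Fin m) → EuclideanSpace ℝ (Fin k)}
    (hψ : ∀ a, SmoothOn V (fun z => ψ z a)) (hm : ∀ z ∈ V, ψ z ∈ U)
    (hi : ∀ z ∈ V, Function.Injective (fderiv ℝ ψ z)) :
    IsParam (n := n) V (fun z => Ψ (ψ z)) where
  isOpen := hV
  smooth z hz := by
    have h1 : ContDiffAt ℝ ∞ ψ z := contDiffAt_euclidean.2 fun a => hψ a z hz
    exact ((HΨ.contMDiffAt (hm z hz)).comp z h1.contMDiffAt).contMDiffWithinAt
  injective z hz := by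
    have h := fun v => IsParam.mfderiv_comp_eq HΨ hV hψ hm (Φ := fun z => Ψ (ψ z))
      (fun _ _ => rfl) hz v
    intro u v huv
    have h' : (mfderiv (𝓡 k) (𝓡 n) Ψ (ψ z) (fderiv ℝ ψ z u) : EuclideanSpace ℝ (Fin n))
      = mfderiv (𝓡 k) (𝓡 n) Ψ (ψ z) (fderiv ℝ ψ z v) := (h u).symm.trans (huv.trans (h v))
    exact hi z hz (HΨ.injective _ (hm z hz) h')

/-- A parametrization by an open subset of `ℝⁿ` has a smooth local inverse. -/
lemma IsParam.exists_local_inverse {V : Set (EuclideanSpace ℝ (Fin n))}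
    {Φ : EuclideanSpace ℝ (Fin n) → M} {z : EuclideanSpace ℝ (Fin n)}
    [RiemannianBundle (fun x : M => TangentSpace (𝓡 n) x)]
    [IsContMDiffRiemannianBundle (𝓡 n) ∞ (EuclideanSpace ℝ (Fin n))
      (fun x : M => TangentSpace (𝓡 n) x)]
    (H : IsParam (n := n) V Φ) (hz : z ∈ V) :
    ∃ (O : Set M) (χ : M → EuclideanSpace ℝ (Fin n)), IsOpen O ∧ Φ z ∈ O ∧
      ContMDiffOn (𝓡 n) (𝓡 n) ∞ χ O ∧ (∀ y ∈ O, χ y ∈ V) ∧ (∀ y ∈ O, Φ (χ y) = y) ∧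
      χ (Φ z) = z ∧ ∀ᶠ w in 𝓝 z, χ (Φ w) = w := by
  obtain ⟨W, hWV, hzW, HW, hW⟩ := H.exists_chart hz
  have hpb := HW.isPullback _ hW
  obtain ⟨T, χ, hT, hzT, hχ, hχm, hr, hl, hl'⟩ := Coord.exists_local_inverse HW.isOpen hpb.smooth hzW
    (hpb.det_jacMatrix_ne hzW)
  set c := extChartAt (𝓡 n) (Φ z)
  have hO : IsOpen (c.source ∩ c ⁻¹' T) :=
    (continuousOn_extChartAt (I := 𝓡 n) (Φ z)).isOpen_inter_preimage (isOpen_extChartAt_source _) hT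
  refine ⟨c.source ∩ c ⁻¹' T, fun y => χ (c y), hO, ⟨mem_extChartAt_source _, hzT⟩, ?_,
    fun y hy => hWV (hχm _ hy.2), ?_, hl, hl'⟩
  · intro y hy
    have h1 : ContMDiffAt (𝓡 n) (𝓡 n) ∞ c y :=
      contMDiffAt_extChartAt' (by rw [← extChartAt_source (𝓡 n)]; exact hy.1)
    have h2 : ContDiffAt ℝ ∞ χ (c y) := contDiffAt_euclidean.2 fun a => hχ a _ hy.2
    exact (h2.contMDiffAt.comp y h1).contMDiffWithinAt
  · intro y hy
    refine c.injOn ?_ hy.1 (hr _ hy.2)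
    have := hW _ (hχm _ hy.2)
    rwa [← extChartAt_source (𝓡 n)] at this

end Riem

namespace Coord

variable {n : ℕ}

/-- The quadratic polynomial map with value `p`, first derivatives `A` and second derivatives `-C`
at the origin. -/
noncomputable def quadraticMap (p : EuclideanSpace ℝ (Fin n)) (A : Fin n → Fin n → ℝ)
    (C : Fin n → Fin n → Fin n → ℝ) (z : EuclideanSpace ℝ (Fin n)) : EuclideanSpace ℝ (Fin n) :=
  WithLp.toLp 2 fun a => p a + ∑ i, A a i * z i - (1 / 2) * ∑ i, ∑ j, C a i j * (z i * z j)

variable {p : EuclideanSpace ℝ (Fin n)} {A : Fin n → Fin n → ℝ} {C : Fin n → Fin n → Fin n → ℝ}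
  {U : Set (EuclideanSpace ℝ (Fin n))} {z : EuclideanSpace ℝ (Fin n)}

lemma quadraticMap_zero : quadraticMap p A C 0 = p := by
  ext a; simp [quadraticMap]

lemma smooth_quadraticMap (a : Fin n) : SmoothOn U (fun z => quadraticMap p A C z a) :=
  ((SmoothOn.const _).add (SmoothOn.sum fun i => (SmoothOn.const _).mul (SmoothOn.coord i))).sub
    ((SmoothOn.const _).mul (SmoothOn.sum fun i => SmoothOn.sum fun j =>
      (SmoothOn.const _).mul ((SmoothOn.coord i).mul (SmoothOn.coord j))))

lemma jac_quadraticMap (hC : ∀ a i j, C a i j = C a j i) (k a : Fin n) :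
    jac (quadraticMap p A C) k a = fun z => A a k - ∑ j, C a k j * z j := by
  funext z
  have sc := fun i => SmoothOn.coord (U := Set.univ) (n := n) i
  have hz : z ∈ (Set.univ : Set (EuclideanSpace ℝ (Fin n))) := Set.mem_univ z
  have s1 : ∀ i, SmoothOn Set.univ (fun z : EuclideanSpace ℝ (Fin n) => A a i * z i) :=
    fun i => (SmoothOn.const _).mul (sc i)
  have s2 : ∀ i j, SmoothOn Set.univ (fun z : EuclideanSpace ℝ (Fin n) => C a i j * (z i * z j)) :=
    fun i j => (SmoothOn.const _).mul ((sc i).mul (sc j))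
  have s3 := fun i => SmoothOn.sum (s := Finset.univ) (s2 i)
  have e : jac (quadraticMap p A C) k a z = pd k (fun z : EuclideanSpace ℝ (Fin n) =>
    p a + ∑ i, A a i * z i - (1 / 2) * ∑ i, ∑ j, C a i j * (z i * z j)) z := rfl
  rw [e, pd_sub ((SmoothOn.const _).add (SmoothOn.sum s1)) ((SmoothOn.const _).mul (SmoothOn.sum s3)) hz,
    pd_add (SmoothOn.const _) (SmoothOn.sum s1) hz, pd_const, pd_sum s1 hz,
    pd_const_mul _ (SmoothOn.sum s3) hz, pd_sum s3 hz,
    Finset.sum_congr rfl fun i _ => pd_sum (s2 i) hz k]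
  simp only [fun i => pd_const_mul (A a i) (sc i) hz k, fun i j =>
    pd_const_mul (C a i j) ((sc i).mul (sc j)) hz k, fun i j => pd_mul (sc i) (sc j) hz k, pd_coord]
  simp only [mul_ite, mul_one, mul_zero, mul_add, ite_mul, zero_mul, Finset.sum_add_distrib,
    Finset.sum_ite_eq', Finset.mem_univ, if_true, one_mul, zero_add]
  have h : ∑ i, ∑ j, (if i = k then C a i j * z j else 0) = ∑ j, C a k j * z j := by
    rw [Finset.sum_comm]; simp
  have h' : ∑ i, C a i k * z i = ∑ j, C a k j * z j :=
    Finset.sum_congr rfl fun i _ => by rw [hC]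
  rw [h, h']; ring

lemma pd_jac_quadraticMap (hC : ∀ a i j, C a i j = C a j i) (i k a : Fin n) :
    pd i (jac (quadraticMap p A C) k a) z = - C a i k := by
  have sc := fun i => SmoothOn.coord (U := Set.univ) (n := n) i
  have hz : z ∈ (Set.univ : Set (EuclideanSpace ℝ (Fin n))) := Set.mem_univ z
  have s1 : ∀ j, SmoothOn Set.univ (fun z : EuclideanSpace ℝ (Fin n) => C a k j * z j) :=
    fun i => (SmoothOn.const _).mul (sc i)
  rw [jac_quadraticMap hC, pd_sub (SmoothOn.const _) (SmoothOn.sum s1) hz, pd_const, pd_sum s1 hz]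
  simp only [fun j => pd_const_mul (C a k j) (sc j) hz i, pd_coord]
  simp [hC a k i]

end Coord

namespace Riem

set_option linter.unusedSectionVars false

open Coord

variable {n : ℕ} {M : Type*} [TopologicalSpace M] [ChartedSpace (EuclideanSpace ℝ (Fin n)) M]
  [IsManifold (𝓡 n) ∞ M]

lemma coordVec_extChartAt_symm (x : M) (a : Fin n) :
    (coordVec (n := n) (extChartAt (𝓡 n) x).symm (extChartAt (𝓡 n) x x) a : EuclideanSpace ℝ (Fin n))
      = EuclideanSpace.single a (1 : ℝ) := by
  have h := mfderivWithin_range_extChartAt_symm (I := 𝓡 n) (x := x)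
  rw [modelWithCornersSelf_coe, Set.range_id, mfderivWithin_univ] at h
  exact congrArg (fun L : EuclideanSpace ℝ (Fin n) →L[ℝ] EuclideanSpace ℝ (Fin n) =>
    L (EuclideanSpace.single a (1 : ℝ))) h

variable [RiemannianBundle (fun x : M => TangentSpace (𝓡 n) x)]
    [IsContMDiffRiemannianBundle (𝓡 n) ∞ (EuclideanSpace ℝ (Fin n))
      (fun x : M => TangentSpace (𝓡 n) x)]

lemma form_chartMetric (x : M) (v w : EuclideanSpace ℝ (Fin n)) :
    form (chartMetric (n := n) x (extChartAt (𝓡 n) x x)) (fun a => v a) (fun a => w a)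
      = metricAt x v w := by
  have hv : ∀ v : EuclideanSpace ℝ (Fin n), (∑ a, v a •
      coordVec (n := n) (extChartAt (𝓡 n) x).symm (extChartAt (𝓡 n) x x) a :
        TangentSpace (𝓡 n) ((extChartAt (𝓡 n) x).symm (extChartAt (𝓡 n) x x))) = v := by
    intro v
    have h1 : ∀ a, (v a • coordVec (n := n) (extChartAt (𝓡 n) x).symm (extChartAt (𝓡 n) x x) a :
        TangentSpace (𝓡 n) ((extChartAt (𝓡 n) x).symm (extChartAt (𝓡 n) x x)))
        = (v a • EuclideanSpace.single a (1 : ℝ) : EuclideanSpace ℝ (Fin n)) := fun a =>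
      congrArg (fun w : EuclideanSpace ℝ (Fin n) => v a • w) (coordVec_extChartAt_symm x a)
    rw [Finset.sum_congr rfl fun a _ => h1 a]
    have h2 : (∑ a, v a • EuclideanSpace.single a (1 : ℝ) : EuclideanSpace ℝ (Fin n)) = v := by
      ext b; simp [Pi.single_apply]
    exact h2
  have h := IsParam.inner_sum_coordVec (n := n) (Φ := (extChartAt (𝓡 n) x).symm)
    (z := extChartAt (𝓡 n) x x) (fun a => v a) (fun a => w a)
  rw [hv, hv] at h
  have hp : metricAt (n := n) ((extChartAt (𝓡 n) x).symm (extChartAt (𝓡 n) x x)) = metricAt x := by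
    rw [extChartAt_to_inv]
  refine Eq.trans h.symm ?_
  exact congrFun (congrFun hp v) w

/-- Coordinates with prescribed orthonormal coordinate vectors at `x` in which the metric is Euclidean
to first order at `x`. -/
lemma exists_normal_coordinates (x : M) (e : Fin n → TangentSpace (𝓡 n) x) (he : Orthonormal ℝ e) :
    ∃ (V : Set (EuclideanSpace ℝ (Fin n))) (Φ : EuclideanSpace ℝ (Fin n) → M),
      IsParam (n := n) V Φ ∧ 0 ∈ V ∧ Φ 0 = x ∧
      (∀ i, (coordVec (n := n) Φ 0 i : EuclideanSpace ℝ (Fin n)) = e i) ∧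
      IsNormalAt (pullbackMetric (n := n) Φ) 0 := by
  set p := extChartAt (𝓡 n) x x with hp
  set G := chartMetric (n := n) x with hG
  obtain ⟨e', he'⟩ : ∃ e' : Fin n → EuclideanSpace ℝ (Fin n), ∀ i, e' i = e i := ⟨e, fun _ => rfl⟩
  set A : Fin n → Fin n → ℝ := fun a i => e' i a with hA
  set C : Fin n → Fin n → Fin n → ℝ := fun a i j =>
    ∑ b, ∑ c, christoffel G p a b c * A b i * A c j with hCdef
  have hparam := isParam_extChartAt_symm (n := n) x
  have hpt : p ∈ (extChartAt (𝓡 n) x).target := mem_extChartAt_target x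
  have hC : ∀ a i j, C a i j = C a j i := by
    intro a i j
    simp only [hCdef]
    rw [Finset.sum_comm]
    refine Finset.sum_congr rfl fun b _ => Finset.sum_congr rfl fun c _ => ?_
    have h := hparam.isMetricOn.christoffel_symm hpt a b c
    change christoffel G p a b c = christoffel G p a c b at h
    rw [h]; ring
  set ψ := quadraticMap p A C with hψdef
  have hψ0 : ψ 0 = p := quadraticMap_zero
  have hjac0 : ∀ i a, jac ψ i a 0 = A a i := by
    intro i a; rw [hψdef, jac_quadraticMap hC]; simp
  have hAA : ∀ i j, form (G p) (fun a => A a i) (fun a => A a j) = if i = j then 1 else 0 := by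
    intro i j
    rw [← orthonormal_iff_ite.1 he i j]
    refine (form_chartMetric x (e' i) (e' j)).trans ?_
    rw [he', he']; rfl
  have hdet : (jacMatrix ψ 0).det ≠ 0 := by
    intro h0
    have h1 : (jacMatrix ψ 0).transpose * G p * jacMatrix ψ 0 = 1 := by
      ext i j
      rw [← IsPullback.form_jac, Matrix.one_apply, ← hAA]
      simp only [hjac0]
    have h2 := congrArg Matrix.det h1
    rw [Matrix.det_mul, h0, mul_zero, Matrix.det_one] at h2
    exact zero_ne_one h2
  have hsm : ∀ a, SmoothOn Set.univ (fun z => ψ z a) := fun a => smooth_quadraticMap a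
  have hcont : Continuous ψ := continuous_iff_continuousAt.2 fun z =>
    (contDiffAt_euclidean.2 fun a => hsm a z (Set.mem_univ z)).continuousAt
  have hO1 : IsOpen (ψ ⁻¹' (extChartAt (𝓡 n) x).target) := hparam.isOpen.preimage hcont
  set V := ψ ⁻¹' (extChartAt (𝓡 n) x).target ∩ {z | (jacMatrix ψ z).det ≠ 0}
  have hsm' : ∀ (W : Set (EuclideanSpace ℝ (Fin n))) a, SmoothOn W (fun z => ψ z a) :=
    fun W a => (hsm a).mono (Set.subset_univ W)
  have hV : IsOpen V := SmoothOn.isOpen_ne hO1 (smooth_det_jacMatrix (hsm' _)) 0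
  have h0V : (0 : EuclideanSpace ℝ (Fin n)) ∈ V := ⟨by rw [Set.mem_preimage, hψ0]; exact hpt, hdet⟩
  have hm : ∀ z ∈ V, ψ z ∈ (extChartAt (𝓡 n) x).target := fun z hz => hz.1
  have HΦ : IsParam (n := n) V (fun z => (extChartAt (𝓡 n) x).symm (ψ z)) :=
    hparam.comp hV (hsm' V) hm fun z hz => injective_fderiv (hsm' V) hz hz.2
  have hpb := IsParam.isPullback_comp hparam HΦ (hsm' V) hm (fun _ _ => rfl)
  refine ⟨V, _, HΦ, h0V, ?_, ?_, ?_, ?_⟩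
  · rw [hψ0, hp, extChartAt_to_inv]
  · intro i
    rw [IsParam.coordVec_comp_eq hparam hV (hsm' V) hm (fun _ _ => rfl) h0V i]
    have hs : ∀ q : EuclideanSpace ℝ (Fin n), q = p → ∀ a,
        (coordVec (n := n) (extChartAt (𝓡 n) x).symm q a : EuclideanSpace ℝ (Fin n))
          = EuclideanSpace.single a (1 : ℝ) := by
      rintro q rfl a; exact coordVec_extChartAt_symm x a
    have h1 : ∀ a, (jac ψ i a 0 • coordVec (n := n) (extChartAt (𝓡 n) x).symm (ψ 0) a :
        TangentSpace (𝓡 n) ((extChartAt (𝓡 n) x).symm (ψ 0)))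
        = (A a i • EuclideanSpace.single a (1 : ℝ) : EuclideanSpace ℝ (Fin n)) := by
      intro a
      rw [hjac0]
      exact congrArg (fun w : EuclideanSpace ℝ (Fin n) => A a i • w) (hs _ hψ0 a)
    rw [Finset.sum_congr rfl fun a _ => h1 a]
    have h2 : (∑ a, A a i • EuclideanSpace.single a (1 : ℝ) : EuclideanSpace ℝ (Fin n)) = e' i := by
      ext b; simp [Pi.single_apply, hA]
    exact h2.trans (he' i)
  · ext i j
    rw [hpb.eq 0 h0V, hψ0, Matrix.one_apply, ← hAA]
    simp only [hjac0]; rfl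
  · intro k i j
    have hΓ : ∀ i j l, christoffel (pullbackMetric (n := n)
        (fun z => (extChartAt (𝓡 n) x).symm (ψ z))) 0 l i j = 0 := by
      intro i j
      have h1 : ∀ a, ∑ l, christoffel (pullbackMetric (n := n)
          (fun z => (extChartAt (𝓡 n) x).symm (ψ z))) 0 l i j * jac ψ l a 0 = 0 := by
        intro a
        have h2 := congrFun (hpb.secondFund_eq_zero h0V i j) a
        have h3 : covAlong (pullbackMetric (n := n) (extChartAt (𝓡 n) x).symm) ψ i (jac ψ j) a 0 = 0 := by
          rw [covAlong, hψdef, pd_jac_quadraticMap hC, ← hψdef, hψ0]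
          simp only [hjac0, hCdef]
          exact neg_add_cancel _
        rw [secondFund, h3, Pi.zero_apply, zero_sub, neg_eq_zero] at h2
        exact h2
      have h4 : (jacMatrix ψ 0).mulVec (fun l => christoffel (pullbackMetric (n := n)
          (fun z => (extChartAt (𝓡 n) x).symm (ψ z))) 0 l i j) = 0 := by
        funext a
        rw [Pi.zero_apply, ← h1 a]
        simp only [Matrix.mulVec, dotProduct, jacMatrix, Matrix.of_apply]
        exact Finset.sum_congr rfl fun _ _ => mul_comm _ _
      exact congrFun (Matrix.eq_zero_of_mulVec_eq_zero hdet h4)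
    rw [HΦ.isMetricOn.pd_metric h0V, ← HΦ.isMetricOn.sum_mul_christoffel h0V,
      ← HΦ.isMetricOn.sum_mul_christoffel h0V]
    simp only [hΓ, mul_zero, Finset.sum_const_zero, add_zero]

end Riem

/-- A symmetric bilinear form with a unit vector in its kernel has an orthonormal eigenbasis that
begins with this vector. -/
lemma exists_orthonormal_eigenbasis_cons {E : Type*} [NormedAddCommGroup E] [InnerProductSpace ℝ E]
    [FiniteDimensional ℝ E] {n : ℕ} (hn : Module.finrank ℝ E = n + 1) (B : E →ₗ[ℝ] E →ₗ[ℝ] ℝ)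
    (hB : ∀ v w, B v w = B w v) (N : E) (hN : ‖N‖ = 1) (hBN : ∀ w, B N w = 0) :
    ∃ (e : Fin (n + 1) → E) (d : Fin n → ℝ), Orthonormal ℝ e ∧ e 0 = N ∧ Monotone d ∧
      ∀ i w, B (e i) w = (Fin.cons 0 d : Fin (n + 1) → ℝ) i * inner ℝ (e i) w := by
  set F : Submodule ℝ E := (Submodule.span ℝ {N})ᗮ with hF
  have hN0 : N ≠ 0 := by rintro rfl; simp at hN
  have hF' : Module.finrank ℝ F = n := by
    have : Fact (Module.finrank ℝ E = n + 1) := ⟨hn⟩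
    exact Submodule.finrank_orthogonal_span_singleton hN0
  set b := stdOrthonormalBasis ℝ F
  set T : F →ₗ[ℝ] F := ∑ i, ((B.flip (b i : E)).comp F.subtype).smulRight (b i) with hTdef
  have hT : ∀ v w : F, inner ℝ (T v) w = B v w := by
    intro v w
    have h1 : T v = ∑ i, B v (b i) • b i := by simp [hTdef]
    have h2 : (w : E) = ∑ i, inner ℝ (b i) w • (b i : E) := by
      conv_lhs => rw [← b.sum_repr' w]
      simp
    rw [h1, sum_inner]
    conv_rhs => rw [h2, map_sum]
    refine Finset.sum_congr rfl fun i _ => ?_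
    rw [real_inner_smul_left, map_smul, smul_eq_mul, mul_comm]
  have hs : T.IsSymmetric := fun v w => by
    rw [hT, hB, ← hT, real_inner_comm]
  set f := hs.eigenvectorBasis hF'
  have hNf : ∀ v : F, inner ℝ N (v : E) = 0 := fun v =>
    Submodule.mem_orthogonal_singleton_iff_inner_right.1 v.2
  refine ⟨Fin.cons N fun i => (f (Fin.rev i) : E), fun i => hs.eigenvalues hF' (Fin.rev i), ?_, rfl,
    fun i j h => hs.eigenvalues_antitone hF' (Fin.rev_le_rev.2 h), ?_⟩
  · rw [orthonormal_iff_ite]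
    have hff := orthonormal_iff_ite.1 f.orthonormal
    intro i j
    refine Fin.cases ?_ (fun i => ?_) i <;> refine Fin.cases ?_ (fun j => ?_) j
    · simp [hN]
    · simp [hNf, (Fin.succ_ne_zero j).symm]
    · simp [real_inner_comm, hNf]
    · have := hff (Fin.rev i) (Fin.rev j)
      simp only [Fin.cons_succ, Fin.succ_inj]
      rw [← Submodule.coe_inner, this]
      simp [Fin.rev_inj]
  · intro i w
    refine Fin.cases ?_ (fun i => ?_) i
    · simp [hBN]
    · simp only [Fin.cons_succ]
      set v := f (Fin.rev i)
      have hv : T v = hs.eigenvalues hF' (Fin.rev i) • v := hs.apply_eigenvectorBasis hF' _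
      have hw : ∃ w' : F, ∃ c : ℝ, w = c • N + w' := by
        have hm : w - inner ℝ N w • N ∈ F := by
          rw [hF, Submodule.mem_orthogonal_singleton_iff_inner_right, inner_sub_right,
            real_inner_smul_right, real_inner_self_eq_norm_sq, hN]
          ring
        exact ⟨⟨_, hm⟩, inner ℝ N w, by simp⟩
      obtain ⟨w', c, rfl⟩ := hw
      rw [map_add, map_smul, hB (v : E) N, hBN, smul_zero, zero_add, ← hT, hv, real_inner_smul_left,
        inner_add_right, real_inner_smul_right, real_inner_comm N (v : E), hNf, mul_zero, zero_add,
        Submodule.coe_inner]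

namespace Riem

set_option linter.unusedSectionVars false

open Coord

variable {n : ℕ} {M : Type*} [TopologicalSpace M] [ChartedSpace (EuclideanSpace ℝ (Fin n)) M]

instance finiteDimensional_tangentSpace (x : M) : FiniteDimensional ℝ (TangentSpace (𝓡 n) x) :=
  inferInstanceAs (FiniteDimensional ℝ (EuclideanSpace ℝ (Fin n)))

lemma finrank_tangentSpace (x : M) : Module.finrank ℝ (TangentSpace (𝓡 n) x) = n :=
  (finrank_euclideanSpace_fin : Module.finrank ℝ (EuclideanSpace ℝ (Fin n)) = n)

lemma comp_add (x : M) (v w : TangentSpace (𝓡 n) x) (i : Fin n) :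
    comp x (v + w) i = comp x v i + comp x w i := by
  simp only [comp, map_add]; rfl

lemma comp_smul (x : M) (c : ℝ) (v : TangentSpace (𝓡 n) x) (i : Fin n) :
    comp x (c • v) i = c * comp x v i := by
  simp only [comp, map_smul]; rfl

variable [RiemannianBundle (fun x : M => TangentSpace (𝓡 n) x)]

/-- The Ricci curvature as a bilinear map. -/
noncomputable def ricciBilin (x : M) :
    TangentSpace (𝓡 n) x →ₗ[ℝ] TangentSpace (𝓡 n) x →ₗ[ℝ] ℝ :=
  LinearMap.mk₂ ℝ (ricciForm x)
    (fun v v' w => by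
      simp only [ricciForm, comp_add, ← Finset.sum_add_distrib]
      exact Finset.sum_congr rfl fun _ _ => Finset.sum_congr rfl fun _ _ => by ring)
    (fun c v w => by
      simp only [ricciForm, comp_smul, smul_eq_mul, Finset.mul_sum]
      exact Finset.sum_congr rfl fun _ _ => Finset.sum_congr rfl fun _ _ => by ring)
    (fun v w w' => by
      simp only [ricciForm, comp_add, ← Finset.sum_add_distrib]
      exact Finset.sum_congr rfl fun _ _ => Finset.sum_congr rfl fun _ _ => by ring)
    (fun c v w => by
      simp only [ricciForm, comp_smul, smul_eq_mul, Finset.mul_sum]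
      exact Finset.sum_congr rfl fun _ _ => Finset.sum_congr rfl fun _ _ => by ring)

lemma ricciBilin_apply (x : M) (v w : TangentSpace (𝓡 n) x) : ricciBilin x v w = ricciForm x v w :=
  rfl

variable [IsManifold (𝓡 n) ∞ M] [IsContMDiffRiemannianBundle (𝓡 n) ∞ (EuclideanSpace ℝ (Fin n))
      (fun x : M => TangentSpace (𝓡 n) x)]

lemma ricciForm_symm (x : M) (v w : TangentSpace (𝓡 n) x) : ricciForm x v w = ricciForm x w v := by
  simp only [ricciForm]
  rw [Finset.sum_comm]
  have hp := isParam_extChartAt_symm (n := n) x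
  refine Finset.sum_congr rfl fun i _ => Finset.sum_congr rfl fun j _ => ?_
  have h := hp.isMetricOn.ricci_symm (mem_extChartAt_target x) i j
  change Coord.ricci (chartMetric x) _ i j = Coord.ricci (chartMetric x) _ j i at h
  rw [h]; ring

variable {V : Set (EuclideanSpace ℝ (Fin n))} {Φ : EuclideanSpace ℝ (Fin n) → M}
  {z : EuclideanSpace ℝ (Fin n)}

namespace IsParam

lemma span_coordVec (H : IsParam (n := n) V Φ) (hz : z ∈ V) :
    Submodule.span ℝ (Set.range (coordVec (n := n) Φ z)) = ⊤ :=
  (H.linearIndependent_coordVec hz).span_eq_top_of_card_eq_finrank' (by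
    rw [Fintype.card_fin]; exact (finrank_tangentSpace (Φ z)).symm)

lemma exists_eq_sum_coordVec (H : IsParam (n := n) V Φ) (hz : z ∈ V) (v : TangentSpace (𝓡 n) (Φ z)) :
    ∃ c : Fin n → ℝ, v = ∑ i, c i • coordVec (n := n) Φ z i := by
  have h : v ∈ Submodule.span ℝ (Set.range (coordVec (n := n) Φ z)) := by
    rw [H.span_coordVec hz]; trivial
  obtain ⟨c, hc⟩ := (Submodule.mem_span_range_iff_exists_fun ℝ).1 h
  exact ⟨c, hc.symm⟩

lemma inner_grad_sum (H : IsParam (n := n) V Φ) (hz : z ∈ V) {h : M → ℝ}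
    (hh : MDifferentiableAt (𝓡 n) 𝓘(ℝ, ℝ) h (Φ z)) (c : Fin n → ℝ) :
    inner ℝ (grad n h (Φ z)) (∑ i, c i • coordVec (n := n) Φ z i) = ∑ i, c i * pd i (h ∘ Φ) z := by
  rw [inner_sum]
  refine Finset.sum_congr rfl fun i _ => ?_
  rw [real_inner_smul_right, H.inner_grad_coordVec hz hh]

lemma grad_eq_sum_coordVec (H : IsParam (n := n) V Φ) (hz : z ∈ V) {h : M → ℝ}
    (hh : MDifferentiableAt (𝓡 n) 𝓘(ℝ, ℝ) h (Φ z)) :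
    grad n h (Φ z) = ∑ i, gradUp (pullbackMetric (n := n) Φ) (h ∘ Φ) i z • coordVec (n := n) Φ z i := by
  refine ext_inner_right ℝ fun v => ?_
  obtain ⟨c, rfl⟩ := H.exists_eq_sum_coordVec hz v
  rw [H.inner_grad_sum hz hh, inner_sum_coordVec, form]
  rw [Finset.sum_comm]
  refine Finset.sum_congr rfl fun b _ => ?_
  simp only [gradUp, Finset.mul_sum, Finset.sum_mul]
  rw [Finset.sum_comm]
  have h1 : ∀ j, ∑ i, pullbackMetric (n := n) Φ z b i * (pullbackMetric (n := n) Φ z)⁻¹ i j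
      = if b = j then 1 else 0 := fun j => H.isMetricOn.sum_mul_inv hz b j
  have h2 : ∀ j, ∑ i, pullbackMetric (n := n) Φ z i b *
      ((pullbackMetric (n := n) Φ z)⁻¹ i j * pd j (h ∘ Φ) z) * c b
      = (if b = j then 1 else 0) * (pd j (h ∘ Φ) z * c b) := by
    intro j
    rw [← h1, Finset.sum_mul]
    exact Finset.sum_congr rfl fun i _ => by rw [H.isMetricOn.symm z hz i b]; ring
  rw [Finset.sum_congr rfl fun j _ => h2 j]
  simp [mul_comm]

lemma inner_grad_grad (H : IsParam (n := n) V Φ) (hz : z ∈ V) {h k : M → ℝ}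
    (hh : MDifferentiableAt (𝓡 n) 𝓘(ℝ, ℝ) h (Φ z)) (hk : MDifferentiableAt (𝓡 n) 𝓘(ℝ, ℝ) k (Φ z)) :
    inner ℝ (grad n h (Φ z)) (grad n k (Φ z))
      = ∑ i, gradUp (pullbackMetric (n := n) Φ) (h ∘ Φ) i z * pd i (k ∘ Φ) z := by
  rw [real_inner_comm, H.grad_eq_sum_coordVec hz hh, H.inner_grad_sum hz hk]

lemma smooth_comp (H : IsParam (n := n) V Φ) {h : M → ℝ} (hh : ContMDiff (𝓡 n) 𝓘(ℝ, ℝ) ∞ h) :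
    SmoothOn V (h ∘ Φ) := fun _ hy =>
  ((hh _).comp _ (H.contMDiffAt hy)).contDiffAt

/-- A gradient shrinking soliton in coordinates. -/
lemma isSoliton (H : IsParam (n := n) V Φ) {f : M → ℝ} (hf : ContMDiff (𝓡 n) 𝓘(ℝ, ℝ) ∞ f)
    (hsol : ∀ (x : M) (v w : TangentSpace (𝓡 n) x),
      ricciForm x v w + hessianForm f x v w = (1 / 2) * inner ℝ v w)
    (hR : ∀ x : M, scalarCurvature n x = 3 / 2) (hnorm : ∀ x : M, ‖grad n f x‖ ^ 2 = f x) :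
    IsSoliton V (pullbackMetric (n := n) Φ) (f ∘ Φ) where
  metric := H.isMetricOn
  smooth := H.smooth_comp hf
  soliton y hy i j := by
    rw [← H.ricciForm_eq hy, ← H.hessianForm_eq hy isOpen_univ hf.contMDiffOn (Set.mem_univ _), hsol]
    rfl
  scalar y hy := by rw [← H.scalarCurvature_eq hy, hR]
  norm y hy := by
    have hd := (hf (Φ y)).mdifferentiableAt (by simp)
    have h1 := H.inner_grad_grad hy hd hd
    rw [real_inner_self_eq_norm_sq, hnorm] at h1
    rw [Function.comp, h1, Finset.sum_comm]
    refine Finset.sum_congr rfl fun i _ => ?_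
    rw [gradUp, Finset.sum_mul]
    refine Finset.sum_congr rfl fun j _ => ?_
    rw [H.isMetricOn.inv_symm hy]

end IsParam

/-- Coordinates which are normal at a point and adapted to an orthonormal frame of Ricci
eigenvectors. -/
lemma exists_adapted_coordinates (x : M) (e : Fin n → TangentSpace (𝓡 n) x) (he : Orthonormal ℝ e)
    {d : Fin n → ℝ} (hd : ∀ i j, ricciForm x (e i) (e j) = if i = j then d i else 0) :
    ∃ (V : Set (EuclideanSpace ℝ (Fin n))) (Φ : EuclideanSpace ℝ (Fin n) → M),
      IsParam (n := n) V Φ ∧ 0 ∈ V ∧ Φ 0 = x ∧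
      (∀ i, (coordVec (n := n) Φ 0 i : EuclideanSpace ℝ (Fin n)) = e i) ∧
      IsAdaptedAt (pullbackMetric (n := n) Φ) 0 d := by
  obtain ⟨V, Φ, H, h0, rfl, hc, hN⟩ := exists_normal_coordinates x e he
  refine ⟨V, Φ, H, h0, rfl, hc, hN, fun i j => ?_⟩
  rw [← H.ricciForm_eq h0, ← hd]
  exact congrArg₂ (ricciForm (Φ 0)) (hc i) (hc j)

lemma ricciEigenvalue_eq (x : M) (e : Fin n → TangentSpace (𝓡 n) x) (he : Orthonormal ℝ e)
    {d : Fin n → ℝ} (hd : ∀ i j, ricciForm x (e i) (e j) = if i = j then d i else 0)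
    (hm : Monotone d) (i : Fin n) : ricciEigenvalue n i x = d i := by
  obtain ⟨V, Φ, H, h0, rfl, -, A⟩ := exists_adapted_coordinates x e he hd
  have h1 : (pullbackMetric (n := n) Φ 0)⁻¹ * Matrix.of (Coord.ricci (pullbackMetric (n := n) Φ) 0)
      = Matrix.diagonal d := by
    rw [A.inv_eq_one, one_mul]
    ext i j
    rw [Matrix.of_apply, A.ricci_eq, Matrix.diagonal_apply]
  have h2 : (Matrix.diagonal d).charpoly.roots = Multiset.ofList (List.ofFn d) := by
    rw [Matrix.charpoly_diagonal]
    have := Polynomial.roots_multiset_prod_X_sub_C (Multiset.ofList (List.ofFn d))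
    rw [← this]
    congr 1
    rw [Multiset.map_coe, Multiset.prod_coe, List.map_ofFn, List.prod_ofFn]
    rfl
  rw [ricciEigenvalue, H.charpoly_eq h0, h1, h2]
  have h3 : (Multiset.ofList (List.ofFn d)).sort (· ≤ ·) = List.ofFn d := by
    refine List.Perm.eq_of_pairwise' (r := (· ≤ ·)) (Multiset.pairwise_sort _ _) (List.pairwise_ofFn.2 fun i j h => hm h.le) ?_
    exact Multiset.coe_eq_coe.1 (Multiset.sort_eq _ _)
  rw [h3]
  simp [List.getD_eq_getElem?_getD]

end Riem

namespace Riem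

set_option linter.unusedSectionVars false

open Coord

section

variable {n : ℕ} {M : Type*} [TopologicalSpace M] [ChartedSpace (EuclideanSpace ℝ (Fin n)) M]
  [RiemannianBundle (fun x : M => TangentSpace (𝓡 n) x)]

/-- `M` is a gradient shrinking soliton with potential `f` and scalar curvature `3 / 2`, normalized by
`|∇f|² = f`. -/
structure IsShrinker (n : ℕ) {M : Type*} [TopologicalSpace M]
    [ChartedSpace (EuclideanSpace ℝ (Fin n)) M]
    [RiemannianBundle (fun x : M => TangentSpace (𝓡 n) x)] (f : M → ℝ) : Prop where
  smooth : ContMDiff (𝓡 n) 𝓘(ℝ, ℝ) ∞ f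
  soliton : ∀ (x : M) (v w : TangentSpace (𝓡 n) x),
    ricciForm x v w + hessianForm f x v w = (1 / 2) * inner ℝ v w
  scalar : ∀ x : M, scalarCurvature n x = 3 / 2
  norm : ∀ x : M, ‖grad n f x‖ ^ 2 = f x

/-- An orthonormal frame that diagonalizes the Ricci tensor. -/
structure IsRicciFrame (x : M) (e : Fin n → TangentSpace (𝓡 n) x) (d : Fin n → ℝ) : Prop where
  orthonormal : Orthonormal ℝ e
  ricci_eq : ∀ i j, ricciForm x (e i) (e j) = if i = j then d i else 0

variable {f : M → ℝ} {x : M}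

lemma IsShrinker.mdifferentiableAt (S : IsShrinker n f) (x : M) :
    MDifferentiableAt (𝓡 n) 𝓘(ℝ, ℝ) f x := (S.smooth x).mdifferentiableAt (by simp)

lemma exists_eq_sum_of_orthonormal {e : Fin n → TangentSpace (𝓡 n) x} (he : Orthonormal ℝ e)
    (v : TangentSpace (𝓡 n) x) : ∃ c : Fin n → ℝ, v = ∑ i, c i • e i := by
  have h : v ∈ Submodule.span ℝ (Set.range e) := by
    rw [he.linearIndependent.span_eq_top_of_card_eq_finrank' (by
      rw [Fintype.card_fin]; exact (finrank_tangentSpace x).symm)]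
    trivial
  obtain ⟨c, hc⟩ := (Submodule.mem_span_range_iff_exists_fun ℝ).1 h
  exact ⟨c, hc.symm⟩

lemma IsRicciFrame.ricciForm_sum {e : Fin n → TangentSpace (𝓡 n) x} {d : Fin n → ℝ}
    (F : IsRicciFrame x e d) (c : Fin n → ℝ) :
    ricciForm x (∑ i, c i • e i) (∑ i, c i • e i) = ∑ i, d i * c i ^ 2 := by
  rw [← ricciBilin_apply, map_sum]
  refine Finset.sum_congr rfl fun i _ => ?_
  rw [map_sum, LinearMap.sum_apply, Finset.sum_eq_single i]
  · rw [map_smul, map_smul, LinearMap.smul_apply, ricciBilin_apply, F.ricci_eq, if_pos rfl,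
      smul_eq_mul, smul_eq_mul]
    ring
  · intro j _ hj
    rw [map_smul, map_smul, LinearMap.smul_apply, ricciBilin_apply, F.ricci_eq, if_neg hj,
      smul_zero, smul_zero]
  · simp

lemma norm_sq_sum_of_orthonormal {e : Fin n → TangentSpace (𝓡 n) x} (he : Orthonormal ℝ e)
    (c : Fin n → ℝ) : ‖∑ i, c i • e i‖ ^ 2 = ∑ i, c i ^ 2 := by
  rw [← real_inner_self_eq_norm_sq, he.inner_sum]
  exact Finset.sum_congr rfl fun i _ => by simp [pow_two]

variable [IsManifold (𝓡 n) ∞ M] [IsContMDiffRiemannianBundle (𝓡 n) ∞ (EuclideanSpace ℝ (Fin n))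
      (fun x : M => TangentSpace (𝓡 n) x)]

lemma IsParam.isSoliton_of_isShrinker {V : Set (EuclideanSpace ℝ (Fin n))}
    {Φ : EuclideanSpace ℝ (Fin n) → M} (H : IsParam (n := n) V Φ) (S : IsShrinker n f) :
    IsSoliton V (pullbackMetric (n := n) Φ) (f ∘ Φ) :=
  H.isSoliton S.smooth S.soliton S.scalar S.norm

lemma IsRicciFrame.sum_eq (S : IsShrinker n f) {e : Fin n → TangentSpace (𝓡 n) x} {d : Fin n → ℝ}
    (F : IsRicciFrame x e d) : ∑ i, d i = 3 / 2 ∧ ∑ i, d i ^ 2 = 3 / 4 := by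
  obtain ⟨V, Φ, H, h0, -, -, A⟩ := exists_adapted_coordinates x e F.orthonormal F.ricci_eq
  have HS := H.isSoliton_of_isShrinker S
  exact ⟨HS.sum_eigenvalues A h0, HS.sum_eigenvalues_sq A h0⟩

lemma exists_orthonormal_frame (x : M) : ∃ e : Fin n → TangentSpace (𝓡 n) x, Orthonormal ℝ e :=
  ⟨_, ((stdOrthonormalBasis ℝ (TangentSpace (𝓡 n) x)).reindex
    (finCongr (finrank_tangentSpace x))).orthonormal⟩

lemma IsShrinker.ricciForm_grad (S : IsShrinker n f) (x : M) (w : TangentSpace (𝓡 n) x) :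
    ricciForm x (grad n f x) w = 0 := by
  obtain ⟨e, he⟩ := exists_orthonormal_frame (n := n) x
  obtain ⟨V, Φ, H, h0, rfl, -, -⟩ := exists_normal_coordinates x e he
  obtain ⟨c, rfl⟩ := H.exists_eq_sum_coordVec h0 w
  rw [H.grad_eq_sum_coordVec h0 (S.mdifferentiableAt _), ← ricciBilin_apply, map_sum]
  refine Finset.sum_eq_zero fun k _ => ?_
  rw [map_smul, ricciBilin_apply, ricciForm_symm, ← ricciBilin_apply, map_sum]
  have := (H.isSoliton_of_isShrinker S).ricci_gradUp h0 k
  simp only [map_smul, ricciBilin_apply, H.ricciForm_eq h0, smul_eq_mul]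
  simp only [mul_comm (gradUp _ _ _ _), this, mul_zero]

end

variable {M : Type*} [TopologicalSpace M] [ChartedSpace (EuclideanSpace ℝ (Fin 5)) M]
  [IsManifold (𝓡 5) ∞ M] [RiemannianBundle (fun x : M => TangentSpace (𝓡 5) x)]
  [IsContMDiffRiemannianBundle (𝓡 5) ∞ (EuclideanSpace ℝ (Fin 5))
      (fun x : M => TangentSpace (𝓡 5) x)] {f : M → ℝ} {x : M}

lemma nonneg_of_sum_eq {d : Fin 4 → ℝ} (h1 : ∑ i, d i = 3 / 2) (h2 : ∑ i, d i ^ 2 = 3 / 4)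
    (i : Fin 4) : 0 ≤ d i ∧ d i ≤ 3 / 4 := by
  simp only [Fin.sum_univ_four] at h1 h2
  have key : ∀ t a b c : ℝ, t + a + b + c = 3 / 2 → t ^ 2 + a ^ 2 + b ^ 2 + c ^ 2 = 3 / 4 →
      0 ≤ t ∧ t ≤ 3 / 4 := by
    intro t a b c h h'
    have h3 : t * (3 / 4 - t) ≥ 0 := by
      have e : a = 3 / 2 - t - b - c := by linarith
      subst e
      nlinarith [sq_nonneg (3 / 2 - t - b - c - b), sq_nonneg (b - c),
        sq_nonneg (3 / 2 - t - b - c - c)]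
    constructor <;> nlinarith
  fin_cases i
  · exact key _ _ _ _ h1 h2
  · exact key (d 1) (d 0) (d 2) (d 3) (by linarith) (by linarith)
  · exact key (d 2) (d 0) (d 1) (d 3) (by linarith) (by linarith)
  · exact key (d 3) (d 0) (d 1) (d 2) (by linarith) (by linarith)

lemma monotone_cons_zero {n : ℕ} {d : Fin n → ℝ} (hd : Monotone d) (h0 : ∀ i, 0 ≤ d i) :
    Monotone (Fin.cons 0 d : Fin (n + 1) → ℝ) := by
  intro i j hij
  refine Fin.cases (fun j _ => ?_) (fun i j hij => ?_) i j hij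
  · exact Fin.cases le_rfl h0 j
  · revert hij
    refine Fin.cases (fun hij => ?_) (fun j hij => hd (Fin.succ_le_succ_iff.1 hij)) j
    exact absurd hij (by simp)

/-- A Ricci frame which begins with the direction of the gradient. -/
lemma IsShrinker.exists_frame (S : IsShrinker 5 f) (hx : 0 < f x) :
    ∃ (e : Fin 5 → TangentSpace (𝓡 5) x) (d : Fin 5 → ℝ), IsRicciFrame x e d ∧
      e 0 = (‖grad 5 f x‖)⁻¹ • grad 5 f x ∧ d 0 = 0 ∧ Monotone d ∧
      ∀ i w, ricciForm x (e i) w = d i * inner ℝ (e i) w := by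
  have hfin : Module.finrank ℝ (TangentSpace (𝓡 5) x) = 4 + 1 := finrank_tangentSpace (n := 5) x
  have hg : ‖grad 5 f x‖ ≠ 0 := fun h => by
    have := S.norm x
    rw [h] at this
    norm_num at this
    exact hx.ne this
  obtain ⟨e, d, he, h0, hd, hB⟩ := exists_orthonormal_eigenbasis_cons (n := 4) hfin
    (ricciBilin x) (ricciForm_symm x) ((‖grad 5 f x‖)⁻¹ • grad 5 f x)
    (by rw [norm_smul, norm_inv, norm_norm, inv_mul_cancel₀ hg])
    (fun w => by
      rw [map_smul, LinearMap.smul_apply, ricciBilin_apply, S.ricciForm_grad, smul_zero])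
  have F : IsRicciFrame x e (Fin.cons 0 d : Fin 5 → ℝ) := by
    refine ⟨he, fun i j => ?_⟩
    rw [← ricciBilin_apply, hB, orthonormal_iff_ite.1 he]
    split_ifs <;> simp
  obtain ⟨h1, h2⟩ := F.sum_eq S
  rw [Fin.sum_univ_succ] at h1 h2
  simp only [Fin.cons_zero, Fin.cons_succ] at h1 h2
  have hnn := nonneg_of_sum_eq (d := d) (by linarith) (by linarith)
  exact ⟨e, _, F, h0, rfl, monotone_cons_zero hd fun i => (hnn i).1, hB⟩

lemma IsShrinker.exists_isAdaptedFrame (S : IsShrinker 5 f) (hx : 0 < f x) :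
    ∃ e : Fin 5 → TangentSpace (𝓡 5) x, IsAdaptedFrame f x e := by
  obtain ⟨e, d, F, h0, -, hd, hB⟩ := S.exists_frame hx
  refine ⟨e, F.orthonormal, fun i w => ?_, h0⟩
  rw [hB, ricciEigenvalue_eq x e F.orthonormal F.ricci_eq hd]

lemma IsAdaptedFrame.isRicciFrame {e : Fin 5 → TangentSpace (𝓡 5) x} (A : IsAdaptedFrame f x e) :
    IsRicciFrame x e (fun i => ricciEigenvalue 5 i x) := by
  refine ⟨A.orthonormal, fun i j => ?_⟩
  rw [A.eigenvector, orthonormal_iff_ite.1 A.orthonormal]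
  split_ifs <;> simp

lemma IsShrinker.monotone_ricciEigenvalue (S : IsShrinker 5 f) (hx : 0 < f x) :
    Monotone (fun i : Fin 5 => ricciEigenvalue 5 i x) := by
  obtain ⟨e, d, F, -, -, hd, -⟩ := S.exists_frame hx
  intro i j hij
  simp only [ricciEigenvalue_eq x e F.orthonormal F.ricci_eq hd]
  exact hd hij

lemma IsShrinker.ricciEigenvalue_zero (S : IsShrinker 5 f) (hx : 0 < f x) :
    ricciEigenvalue 5 0 x = 0 := by
  obtain ⟨e, d, F, -, h0, hd, -⟩ := S.exists_frame hx
  rw [ricciEigenvalue_eq x e F.orthonormal F.ricci_eq hd, h0]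

lemma IsAdaptedFrame.grad_eq (S : IsShrinker 5 f) (hx : 0 < f x)
    {e : Fin 5 → TangentSpace (𝓡 5) x} (A : IsAdaptedFrame f x e) :
    grad 5 f x = Real.sqrt (f x) • e 0 := by
  have h : ‖grad 5 f x‖ = Real.sqrt (f x) := by
    rw [← S.norm x, Real.sqrt_sq (norm_nonneg _)]
  have h' : Real.sqrt (f x) ≠ 0 := (Real.sqrt_pos.2 hx).ne'
  rw [A.normal, h, smul_smul, mul_inv_cancel₀ h', one_smul]

/-- The smallest Ricci eigenvalue on the complement of the gradient is a lower bound for the Ricci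
curvature there. -/
lemma IsShrinker.le_ricciForm (S : IsShrinker 5 f) (hx : 0 < f x) (X : TangentSpace (𝓡 5) x) :
    ricciEigenvalue 5 1 x * (‖X‖ ^ 2 - inner ℝ (grad 5 f x) X ^ 2 / f x) ≤ ricciForm x X X := by
  obtain ⟨e, A⟩ := S.exists_isAdaptedFrame hx
  have F := A.isRicciFrame
  obtain ⟨c, rfl⟩ := exists_eq_sum_of_orthonormal A.orthonormal X
  rw [F.ricciForm_sum, norm_sq_sum_of_orthonormal A.orthonormal, A.grad_eq S hx,
    real_inner_smul_left, A.orthonormal.inner_right_fintype, mul_pow, Real.sq_sqrt hx.le,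
    mul_div_cancel_left₀ _ hx.ne', Fin.sum_univ_succ,
    Fin.sum_univ_succ (f := fun i => ricciEigenvalue 5 i x * c i ^ 2), add_sub_cancel_left,
    S.ricciEigenvalue_zero hx, zero_mul, zero_add, Finset.mul_sum]
  refine Finset.sum_le_sum fun i _ => mul_le_mul_of_nonneg_right ?_ (sq_nonneg _)
  exact S.monotone_ricciEigenvalue hx (by simp [Fin.le_def])

end Riem

/-- Positive definiteness is an open condition at a diagonal matrix. -/
lemma eventually_form_pos {X : Type*} [TopologicalSpace X] {n : ℕ} {Q : X → Matrix (Fin n) (Fin n) ℝ}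
    {o : X} (hQ : ∀ i j, ContinuousAt (fun z => Q z i j) o) {d : Fin n → ℝ} (hd : ∀ i, 0 < d i)
    (h0 : ∀ i j, Q o i j = if i = j then d i else 0) :
    ∀ᶠ z in 𝓝 o, ∀ w : Fin n → ℝ, w ≠ 0 → 0 < Coord.form (Q z) w w := by
  obtain ⟨m, hm, hmd⟩ : ∃ m : ℝ, 0 < m ∧ ∀ i, m ≤ d i := by
    rcases isEmpty_or_nonempty (Fin n) with h | h
    · exact ⟨1, one_pos, fun i => (IsEmpty.false i).elim⟩
    · obtain ⟨i, hi⟩ := Finite.exists_min d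
      exact ⟨d i, hd i, hi⟩
  have hε : 0 < m / (n + 1) := by positivity
  have hev : ∀ᶠ z in 𝓝 o, ∀ i j, |Q z i j - Q o i j| < m / (n + 1) :=
    Filter.eventually_all.2 fun i => Filter.eventually_all.2 fun j =>
      (Metric.tendsto_nhds.1 (hQ i j) _ hε)
  filter_upwards [hev] with z hz w hw
  have hpos : 0 < ∑ i, w i ^ 2 := by
    obtain ⟨i, hi⟩ := Function.ne_iff.1 hw
    exact Finset.sum_pos' (fun _ _ => sq_nonneg _) ⟨i, Finset.mem_univ _, by
      have : w i ≠ 0 := hi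
      positivity⟩
  have h1 : ∀ i j, (if i = j then m * w i ^ 2 else 0) - m / (n + 1) * ((w i ^ 2 + w j ^ 2) / 2)
      ≤ Q z i j * w i * w j := by
    intro i j
    have h2 : |(Q z i j - Q o i j) * (w i * w j)| ≤ m / (n + 1) * ((w i ^ 2 + w j ^ 2) / 2) := by
      rw [abs_mul]
      refine mul_le_mul (hz i j).le ?_ (abs_nonneg _) hε.le
      rw [abs_mul]
      nlinarith [sq_nonneg (|w i| - |w j|), sq_abs (w i), sq_abs (w j)]
    have h3 := neg_le_of_abs_le h2
    have h4 := h0 i j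
    split_ifs at h4 ⊢ with hij
    · subst hij
      rw [h4] at h3
      nlinarith [mul_le_mul_of_nonneg_right (hmd i) (sq_nonneg (w i))]
    · rw [h4] at h3
      linarith
  have h5 : ∑ i, ∑ j, ((if i = j then m * w i ^ 2 else 0) - m / (n + 1) * ((w i ^ 2 + w j ^ 2) / 2))
      = m / (n + 1) * ∑ i, w i ^ 2 := by
    simp only [Finset.sum_sub_distrib, ← Finset.mul_sum, ← Finset.sum_div, Finset.sum_add_distrib,
      Finset.sum_const, Finset.card_univ, Fintype.card_fin, nsmul_eq_mul, Finset.sum_ite_eq,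
      Finset.mem_univ, if_true]
    field_simp
    ring
  calc 0 < m / (n + 1) * ∑ i, w i ^ 2 := by positivity
    _ ≤ Coord.form (Q z) w w := by
      rw [← h5]
      exact Finset.sum_le_sum fun i _ => Finset.sum_le_sum fun j _ => h1 i j

namespace Riem

set_option linter.unusedSectionVars false

open Coord

variable {M : Type*} [TopologicalSpace M] [ChartedSpace (EuclideanSpace ℝ (Fin 5)) M]
  [IsManifold (𝓡 5) ∞ M] [RiemannianBundle (fun x : M => TangentSpace (𝓡 5) x)]
  [IsContMDiffRiemannianBundle (𝓡 5) ∞ (EuclideanSpace ℝ (Fin 5))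
      (fun x : M => TangentSpace (𝓡 5) x)] {f : M → ℝ} {x : M}

lemma IsParam.ricciForm_sum_coordVec {V : Set (EuclideanSpace ℝ (Fin 5))}
    {Φ : EuclideanSpace ℝ (Fin 5) → M} {z : EuclideanSpace ℝ (Fin 5)} (H : IsParam (n := 5) V Φ)
    (hz : z ∈ V) (c : Fin 5 → ℝ) :
    ricciForm (Φ z) (∑ i, c i • coordVec (n := 5) Φ z i) (∑ i, c i • coordVec (n := 5) Φ z i)
      = form (Matrix.of (Coord.ricci (pullbackMetric (n := 5) Φ) z)) c c := by
  rw [← ricciBilin_apply, map_sum, form, Finset.sum_comm]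
  refine Finset.sum_congr rfl fun j _ => ?_
  rw [map_sum, LinearMap.sum_apply]
  refine Finset.sum_congr rfl fun i _ => ?_
  rw [map_smul, map_smul, LinearMap.smul_apply, ricciBilin_apply, H.ricciForm_eq hz, smul_eq_mul,
    smul_eq_mul, Matrix.of_apply]
  ring

/-- Coordinates at `x` which are normal and have the given adapted frame as coordinate vectors. -/
structure IsAdaptedParam (f : M → ℝ) (e : Fin 5 → TangentSpace (𝓡 5) x)
    (V : Set (EuclideanSpace ℝ (Fin 5))) (Φ : EuclideanSpace ℝ (Fin 5) → M) : Prop where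
  isParam : IsParam (n := 5) V Φ
  zero_mem : 0 ∈ V
  map_zero : Φ 0 = x
  coordVec_eq : ∀ i, (coordVec (n := 5) Φ 0 i : EuclideanSpace ℝ (Fin 5)) = e i
  adapted : IsAdaptedAt (pullbackMetric (n := 5) Φ) 0 (fun i => ricciEigenvalue 5 i x)
  pd_zero : pd 0 (f ∘ Φ) 0 = Real.sqrt (f x)
  pd_succ : ∀ i : Fin 4, pd i.succ (f ∘ Φ) 0 = 0
  pos : ∀ y ∈ V, 0 < f (Φ y)
  den_pos : ∀ y ∈ V, 0 < pullbackMetric (n := 5) Φ y 1 1 - pd 1 (f ∘ Φ) y ^ 2 / f (Φ y)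

lemma IsShrinker.exists_isAdaptedParam (S : IsShrinker 5 f) (hx : 0 < f x)
    {e : Fin 5 → TangentSpace (𝓡 5) x} (A : IsAdaptedFrame f x e) :
    ∃ V Φ, IsAdaptedParam f e V Φ := by
  have F := A.isRicciFrame
  obtain ⟨V, Φ, H, h0, hΦ, hc, hA⟩ := exists_adapted_coordinates x e F.orthonormal F.ricci_eq
  have hpd : ∀ i, pd i (f ∘ Φ) 0 = if i = 0 then Real.sqrt (f x) else 0 := by
    intro i
    subst hΦ
    rw [← H.inner_grad_coordVec h0 (S.mdifferentiableAt _), A.grad_eq S hx, real_inner_smul_left]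
    have h1 := orthonormal_iff_ite.1 A.orthonormal 0 i
    have h2 : inner ℝ (e 0) (coordVec (n := 5) Φ 0 i) = (if (0 : Fin 5) = i then 1 else 0 : ℝ) := by
      rw [← h1]
      exact congrArg (metricAt (n := 5) (Φ 0) (e 0)) (hc i)
    rw [h2]
    by_cases hi : i = 0
    · subst hi; simp
    · rw [if_neg hi, if_neg (Ne.symm hi), mul_zero]
  have sf := H.smooth_comp S.smooth
  have hV1 : IsOpen (V ∩ {y | 0 < (f ∘ Φ) y}) := SmoothOn.isOpen_gt H.isOpen sf 0
  set V1 := V ∩ {y | 0 < (f ∘ Φ) y} with hV1def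
  have sD : SmoothOn V1 (fun y => pullbackMetric (n := 5) Φ y 1 1 - pd 1 (f ∘ Φ) y ^ 2 / (f ∘ Φ) y) :=
    ((H.isMetricOn.smooth 1 1).mono Set.inter_subset_left).sub
      ((((sf.pd 1).mono Set.inter_subset_left).pow 2).div (sf.mono Set.inter_subset_left)
        fun y hy => hy.2.ne')
  have hV2 := SmoothOn.isOpen_gt hV1 sD 0
  have h01 : (0 : EuclideanSpace ℝ (Fin 5)) ∈ V1 := ⟨h0, by
    rw [Set.mem_ofPred_eq, Function.comp, hΦ]; exact hx⟩
  refine ⟨_, Φ, H.mono hV2 fun y hy => hy.1.1, ⟨h01, ?_⟩, hΦ, hc, hA, hpd 0,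
    fun i => (hpd i.succ).trans (if_neg (Fin.succ_ne_zero i)), fun y hy => hy.1.2, fun y hy => hy.2⟩
  rw [Set.mem_ofPred_eq, hpd, hA.eq_one]
  norm_num

namespace IsAdaptedParam

variable {e : Fin 5 → TangentSpace (𝓡 5) x} {V : Set (EuclideanSpace ℝ (Fin 5))}
  {Φ : EuclideanSpace ℝ (Fin 5) → M}

/-- The barrier function in coordinates. -/
lemma le_ricciQuotient (S : IsShrinker 5 f) (P : IsAdaptedParam f e V Φ)
    {y : EuclideanSpace ℝ (Fin 5)} (hy : y ∈ V) :
    ricciEigenvalue 5 0 (Φ y) + ricciEigenvalue 5 1 (Φ y)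
      ≤ ricciQuotient (pullbackMetric (n := 5) Φ) (f ∘ Φ) 1 y := by
  have h := S.le_ricciForm (P.pos y hy) (coordVec (n := 5) Φ y 1)
  rw [S.ricciEigenvalue_zero (P.pos y hy), zero_add, ricciQuotient]
  refine (le_div_iff₀ (P.den_pos y hy)).2 ?_
  rw [P.isParam.ricciForm_eq hy, P.isParam.inner_grad_coordVec hy (S.mdifferentiableAt _),
    ← real_inner_self_eq_norm_sq] at h
  exact h

lemma smooth_ricciQuotient (S : IsShrinker 5 f) (P : IsAdaptedParam f e V Φ) :
    SmoothOn V (ricciQuotient (pullbackMetric (n := 5) Φ) (f ∘ Φ) 1) := by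
  have sf := P.isParam.smooth_comp S.smooth
  exact (P.isParam.isMetricOn.smooth_ricci 1 1).div ((P.isParam.isMetricOn.smooth 1 1).sub
    (((sf.pd 1).pow 2).div sf fun y hy => (P.pos y hy).ne')) fun y hy => (P.den_pos y hy).ne'

lemma ricciQuotient_zero (P : IsAdaptedParam f e V Φ) :
    ricciQuotient (pullbackMetric (n := 5) Φ) (f ∘ Φ) 1 0 = ricciEigenvalue 5 1 x := by
  have h := P.pd_succ 0
  rw [Fin.succ_zero_eq_one] at h
  simp [ricciQuotient, P.adapted.ricci_eq, P.adapted.eq_one, h]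

lemma exists_barrier (S : IsShrinker 5 f) (hx : 0 < f x) (P : IsAdaptedParam f e V Φ) :
    ∃ v : M → ℝ, IsUpperBarrierAt 5 (fun y => ricciEigenvalue 5 0 y + ricciEigenvalue 5 1 y) v x ∧
      v ∘ Φ =ᶠ[𝓝 0] ricciQuotient (pullbackMetric (n := 5) Φ) (f ∘ Φ) 1 := by
  obtain ⟨O, χ, hO, h0O, hχ, hχV, hr, hl, hl'⟩ := P.isParam.exists_local_inverse P.zero_mem
  rw [P.map_zero] at h0O hl
  refine ⟨fun y => ricciQuotient (pullbackMetric (n := 5) Φ) (f ∘ Φ) 1 (χ y),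
    ⟨O, hO, h0O, ?_, ?_, ?_⟩, ?_⟩
  · intro y hy
    have h1 := (P.smooth_ricciQuotient S (χ y) (hχV y hy)).contMDiffAt
    exact (h1.comp y (hχ.contMDiffAt (hO.mem_nhds hy))).contMDiffWithinAt
  · simp only [hl, P.ricciQuotient_zero, S.ricciEigenvalue_zero hx, zero_add]
  · intro y hy
    have := P.le_ricciQuotient S (hχV y hy)
    rwa [hr y hy] at this
  · filter_upwards [hl'] with w hw
    simp only [Function.comp, hw]

lemma eventually_lt (S : IsShrinker 5 f) (hx : 0 < f x) (P : IsAdaptedParam f e V Φ) {c : ℝ}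
    (hc : c < ricciEigenvalue 5 1 x) : ∀ᶠ y in 𝓝 x, c < ricciEigenvalue 5 1 y := by
  obtain ⟨O, χ, hO, h0O, hχ, hχV, hr, hl, -⟩ := P.isParam.exists_local_inverse P.zero_mem
  rw [P.map_zero] at h0O hl
  have sf := P.isParam.smooth_comp S.smooth
  set b : ℝ := (|c| + 1) / f x
  have hb : b * f x = |c| + 1 := div_mul_cancel₀ _ hx.ne'
  set Q : EuclideanSpace ℝ (Fin 5) → Matrix (Fin 5) (Fin 5) ℝ := fun z => Matrix.of fun i j =>
    Coord.ricci (pullbackMetric (n := 5) Φ) z i j - c * pullbackMetric (n := 5) Φ z i j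
      + b * (pd i (f ∘ Φ) z * pd j (f ∘ Φ) z) with hQdef
  have hQ : ∀ i j, ContinuousAt (fun z => Q z i j) 0 := fun i j =>
    ((((P.isParam.isMetricOn.smooth_ricci i j).sub ((SmoothOn.const c).mul
      (P.isParam.isMetricOn.smooth i j))).add ((SmoothOn.const b).mul ((sf.pd i).mul (sf.pd j))))
      0 P.zero_mem).continuousAt
  have hpos : ∀ i, 0 < (Fin.cons (|c| + 1 - c) fun i : Fin 4 => ricciEigenvalue 5 i.succ x - c :
      Fin 5 → ℝ) i := by
    intro i
    refine Fin.cases ?_ (fun i => ?_) i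
    · rw [Fin.cons_zero]; linarith [le_abs_self c]
    · rw [Fin.cons_succ]
      have := S.monotone_ricciEigenvalue hx (show (1 : Fin 5) ≤ i.succ by simp [Fin.le_def])
      simp only at this
      linarith
  have hev := eventually_form_pos hQ hpos (by
    intro i j
    simp only [hQdef, Matrix.of_apply, P.adapted.ricci_eq, P.adapted.eq_one, Matrix.one_apply]
    refine Fin.cases ?_ (fun i => ?_) i <;> refine Fin.cases ?_ (fun j => ?_) j
    · simp only [if_true, P.pd_zero, Real.mul_self_sqrt hx.le, hb, S.ricciEigenvalue_zero hx,
        Fin.cons_zero]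
      ring
    · simp [P.pd_succ, (Fin.succ_ne_zero j).symm]
    · simp [P.pd_succ]
    · simp only [P.pd_succ, Fin.cons_succ]
      split_ifs <;> simp)
  have hcont : Filter.Tendsto χ (𝓝 x) (𝓝 0) := by
    have := (hχ.contMDiffAt (hO.mem_nhds h0O)).continuousAt
    rwa [ContinuousAt, hl] at this
  filter_upwards [hcont.eventually hev, hO.mem_nhds h0O] with y hy hyO
  have hpy := P.pos _ (hχV y hyO)
  have H := P.isParam
  have hzV := hχV y hyO
  obtain ⟨z, hz⟩ : ∃ z, χ y = z := ⟨_, rfl⟩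
  have hzy := hr y hyO
  rw [hz] at hy hzy hpy hzV
  subst hzy
  obtain ⟨e', A'⟩ := S.exists_isAdaptedFrame hpy
  have F' := A'.isRicciFrame
  obtain ⟨w, hw⟩ := H.exists_eq_sum_coordVec hzV (e' 1)
  have h1 : ricciForm (Φ z) (e' 1) (e' 1) = ricciEigenvalue 5 1 (Φ z) := by
    rw [F'.ricci_eq, if_pos rfl]
  have h2 : inner ℝ (e' 1) (e' 1) = (1 : ℝ) := by
    rw [orthonormal_iff_ite.1 A'.orthonormal, if_pos rfl]
  have h3 : inner ℝ (grad 5 f (Φ z)) (e' 1) = (0 : ℝ) := by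
    rw [A'.grad_eq S hpy, real_inner_smul_left, orthonormal_iff_ite.1 A'.orthonormal,
      if_neg (by decide), mul_zero]
  have hw0 : w ≠ 0 := by
    rintro rfl
    rw [hw] at h2
    simp at h2
  have h4 := hy w hw0
  rw [hw, H.inner_grad_sum hzV (S.mdifferentiableAt _)] at h3
  rw [hw, IsParam.inner_sum_coordVec] at h2
  rw [hw, H.ricciForm_sum_coordVec hzV] at h1
  have h5 : form (Q z) w w = ricciEigenvalue 5 1 (Φ z) - c * 1 + b * (0 * 0) := by
    rw [← h1, ← h2, ← h3, Finset.sum_mul_sum]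
    simp only [form, hQdef, Matrix.of_apply, Finset.mul_sum, ← Finset.sum_add_distrib,
      ← Finset.sum_sub_distrib]
    exact Finset.sum_congr rfl fun i _ => Finset.sum_congr rfl fun j _ => by ring
  linarith

end IsAdaptedParam

lemma IsShrinker.continuousOn (S : IsShrinker 5 f) :
    ContinuousOn (fun y : M => ricciEigenvalue 5 0 y + ricciEigenvalue 5 1 y) {x : M | 0 < f x} := by
  have hO : IsOpen {x : M | 0 < f x} := isOpen_lt continuous_const S.smooth.continuous
  refine ContinuousOn.congr (f := fun y : M => ricciEigenvalue 5 1 y) ?_ fun y hy => by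
    simp only [S.ricciEigenvalue_zero hy, zero_add]
  intro x hx
  refine ContinuousAt.continuousWithinAt ?_
  obtain ⟨e, A⟩ := S.exists_isAdaptedFrame hx
  obtain ⟨V, Φ, P⟩ := S.exists_isAdaptedParam hx A
  refine tendsto_order.2 ⟨fun c hc => P.eventually_lt S hx hc, fun c hc => ?_⟩
  obtain ⟨v, ⟨U, hU, hxU, hv, hvx, huv⟩, -⟩ := P.exists_barrier S hx
  have hcont := (hv.contMDiffAt (hU.mem_nhds hxU)).continuousAt
  have hvc : v x < c := by
    simp only [S.ricciEigenvalue_zero hx, zero_add] at hvx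
    rw [← hvx]; exact hc
  filter_upwards [hcont.eventually (gt_mem_nhds hvc), hU.mem_nhds hxU, hO.mem_nhds hx]
    with y h1 h2 h3
  have := huv y h2
  simp only [S.ricciEigenvalue_zero h3, zero_add] at this
  exact this.trans_lt h1

end Riem

namespace Coord

variable {m : ℕ}

section levelSet

variable {U : Set (EuclideanSpace ℝ (Fin (m + 1)))}
  {G : EuclideanSpace ℝ (Fin (m + 1)) → Matrix (Fin (m + 1)) (Fin (m + 1)) ℝ}
  {V : Set (EuclideanSpace ℝ (Fin m))} {g : EuclideanSpace ℝ (Fin m) → Matrix (Fin m) (Fin m) ℝ}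
  {ψ : EuclideanSpace ℝ (Fin m) → EuclideanSpace ℝ (Fin (m + 1))} {z : EuclideanSpace ℝ (Fin m)}
  {h : EuclideanSpace ℝ (Fin (m + 1)) → ℝ} {μ : Fin (m + 1) → ℝ} {c : ℝ}

namespace IsPullback

lemma metric_eq_one (H : IsPullback U G V g ψ) (hz : z ∈ V)
    (hJ : ∀ i a, jac ψ i a z = if a = i.succ then 1 else 0) (hG : G (ψ z) = 1) : g z = 1 := by
  ext i j
  rw [H.eq z hz, hG]
  simp [form, hJ, Matrix.one_apply]

/-- The second fundamental form of a level set. -/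
lemma secondFund_levelSet (H : IsPullback U G V g ψ) (hz : z ∈ V)
    (hJ : ∀ i a, jac ψ i a z = if a = i.succ then 1 else 0) (HS : IsSoliton U G h)
    (A : IsAdaptedAt G (ψ z) μ) (hc : ∀ y ∈ V, h (ψ y) = c) (h0 : pd 0 h (ψ z) ≠ 0)
    (hs : ∀ i : Fin m, pd i.succ h (ψ z) = 0) (i j : Fin m) (a : Fin (m + 1)) :
    secondFund G g ψ z i j a
      = if a = 0 then (if i = j then - (1 / 2 - μ i.succ) / pd 0 h (ψ z) else 0) else 0 := by
  have h1 : ∀ k : Fin m, secondFund G g ψ z i j k.succ = 0 := by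
    intro k
    have := H.form_secondFund_jac hz i j k
    rw [A.eq_one] at this
    simpa [form, hJ, Matrix.one_apply] using this
  have h2 : hessian g (fun z => h (ψ z)) z i j = 0 := by
    have e : (fun z => h (ψ z)) =ᶠ[𝓝 z] fun _ => c := by
      filter_upwards [H.metric'.isOpen.mem_nhds hz] with y hy using hc y hy
    rw [Riem.hessian_congr e]
    have e2 : ∀ j, pd j (fun _ : EuclideanSpace ℝ (Fin m) => c) = fun _ => 0 :=
      fun j => funext fun y => pd_const _ _
    simp [hessian, e2, pd_const]
  rw [H.hessian_eq hz HS.smooth, Fin.sum_univ_succ] at h2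
  simp only [hs, zero_mul, Finset.sum_const_zero, add_zero] at h2
  have h3 : form (Matrix.of (hessian G h (ψ z))) (fun a => jac ψ i a z) (fun a => jac ψ j a z)
      = if i = j then 1 / 2 - μ i.succ else 0 := by
    have h4 : hessian G h (ψ z) i.succ j.succ = pd i.succ (pd j.succ h) (ψ z) := by
      simp [hessian, A.christoffel_eq_zero]
    rw [HS.pd_pd_eq A (H.mapsTo z hz)] at h4
    simp only [Fin.succ_inj] at h4
    rw [← h4]
    simp [form, hJ]
  rw [h3] at h2
  refine Fin.cases ?_ (fun k => ?_) a
  · rw [if_pos rfl]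
    split_ifs at h2 ⊢ with hij
    · rw [eq_div_iff h0]; linarith
    · rw [zero_add] at h2
      exact (mul_eq_zero.1 h2).resolve_left h0
  · rw [h1, if_neg (Fin.succ_ne_zero k)]

/-- The Gauss equation for a level set. -/
lemma sectional_levelSet (H : IsPullback U G V g ψ) (hz : z ∈ V)
    (hJ : ∀ i a, jac ψ i a z = if a = i.succ then 1 else 0) (HS : IsSoliton U G h)
    (A : IsAdaptedAt G (ψ z) μ) (hc : ∀ y ∈ V, h (ψ y) = c) (h0 : pd 0 h (ψ z) ≠ 0)
    (hs : ∀ i : Fin m, pd i.succ h (ψ z) = 0) {i j : Fin m} (hij : i ≠ j) :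
    riemann g z i j i j = riemann G (ψ z) i.succ j.succ i.succ j.succ
      + (1 / 2 - μ i.succ) * (1 / 2 - μ j.succ) / pd 0 h (ψ z) ^ 2 := by
  have h1 := H.secondFund_levelSet hz hJ HS A hc h0 hs
  rw [H.riemann_eq hz, A.eq_one]
  simp only [riemannForm, form, hJ, h1, Matrix.one_apply, hij, hij.symm, if_true, if_false]
  simp
  field_simp
  ring

end IsPullback

end levelSet

lemma weyl_eq_of_eq_one {g : EuclideanSpace ℝ (Fin 4) → Matrix (Fin 4) (Fin 4) ℝ}
    {y : EuclideanSpace ℝ (Fin 4)} (hg : g y = 1) {i k : Fin 4} (hik : i ≠ k) :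
    weyl g y i k i k = riemann g y i k i k
      - 1 / 2 * (∑ j, riemann g y j k j k + ∑ j, riemann g y j i j i)
      + 1 / 6 * ∑ l, ∑ j, riemann g y j l j l := by
  have hr : ∀ l, ricci g y l l = ∑ j, riemann g y j l j l := fun l => by
    simp [ricci, hg, Matrix.one_apply]
  have hs : scalar g y = ∑ l, ∑ j, riemann g y j l j l := by
    simp [scalar, hg, Matrix.one_apply, ← hr]
  rw [weyl, hs, hg, hr, hr]
  simp only [Matrix.one_apply, hik, hik.symm, if_true, if_false]
  norm_num

/-- The algebraic identity between the drift Laplacian of the barrier and the curvature of the level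
sets. -/
lemma curvature_identity {K : Fin 5 → Fin 5 → ℝ} {S : Fin 4 → Fin 4 → ℝ} {μ p : Fin 5 → ℝ} {F : ℝ}
    (hF : F ≠ 0) (hK : ∀ i j, K i j = K j i) (hK0 : ∀ i, K i i = 0)
    (hR : ∀ i, ∑ j, K j i = μ i) (hp : ∀ i, F * K 0 i = p i + μ i * (1 / 2 - μ i))
    (h0 : μ 0 = 0) (h1 : ∑ i, μ i = 3 / 2) (h2 : ∑ i, μ i ^ 2 = 3 / 4) (h3 : ∑ i, μ i * p i = 0)
    (hS0 : ∀ i, S i i = 0)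
    (hS : ∀ i j, i ≠ j → S i j = K i.succ j.succ + (1 / 2 - μ i.succ) * (1 / 2 - μ j.succ) / F) :
    μ 1 - 2 * ∑ i, K i 1 * μ i + 2 * μ 1 * (1 / 2 - μ 1) ^ 2 / F
      = - μ 1 + 2 * μ 1 ^ 2 + 3 / (2 * F) * p 1 - 2 / F * μ 1 * p 1
        - 2 * ∑ k : Fin 3, (S 0 k.succ - 1 / 2 * (∑ j, S j k.succ + ∑ j, S j 0)
          + 1 / 6 * ∑ l, ∑ j, S j l) * μ k.succ.succ := by
  have hsum : ∑ i : Fin 4, μ i.succ = 3 / 2 := by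
    rw [Fin.sum_univ_succ, h0, zero_add] at h1; exact h1
  have hSr : ∀ k, ∑ j, S j k = μ k.succ - p k.succ / F := by
    intro k
    have e1 : ∀ j, S j k = K j.succ k.succ + (1 / 2 - μ j.succ) * (1 / 2 - μ k.succ) / F
        - if j = k then (1 / 2 - μ k.succ) ^ 2 / F else 0 := by
      intro j
      split_ifs with hjk
      · subst hjk; rw [hS0, hK0]; ring
      · rw [hS j k hjk, sub_zero]
    have e2 := hR k.succ
    rw [Fin.sum_univ_succ] at e2
    have e3 := hp k.succ
    rw [Finset.sum_congr rfl fun j _ => e1 j, Finset.sum_sub_distrib, Finset.sum_add_distrib,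
      ← Finset.sum_div, ← Finset.sum_mul, Finset.sum_sub_distrib, hsum, Finset.sum_ite_eq',
      if_pos (Finset.mem_univ _)]
    simp only [Finset.sum_const, Finset.card_univ, Fintype.card_fin, nsmul_eq_mul]
    have e4 : K 0 k.succ = (p k.succ + μ k.succ * (1 / 2 - μ k.succ)) / F := by
      rw [eq_div_iff hF, ← e3, mul_comm]
    rw [e4] at e2
    have e5 : ∑ i : Fin 4, K i.succ k.succ
        = μ k.succ - (p k.succ + μ k.succ * (1 / 2 - μ k.succ)) / F := by linarith
    rw [e5]
    field_simp
    ring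
  have hps : ∑ k : Fin 4, p k.succ = 0 := by
    have e1 : ∑ i, F * K 0 i = F * μ 0 := by
      rw [← Finset.mul_sum, ← hR 0]; simp only [hK 0]
    simp only [hp, mul_sub, Finset.sum_add_distrib, Finset.sum_sub_distrib, ← Finset.sum_mul, h1,
      ← pow_two, h2, h0] at e1
    have e2 := hp 0
    rw [hK0, h0] at e2
    rw [Fin.sum_univ_succ] at e1
    linarith
  have hsc : ∑ l, ∑ j, S j l = 3 / 2 := by
    simp only [hSr, Finset.sum_sub_distrib, hsum, ← Finset.sum_div, hps]
    ring
  rw [hsc, hSr 0]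
  simp only [hSr]
  have hS' : ∀ k : Fin 3, S 0 k.succ = K 1 k.succ.succ
      + (1 / 2 - μ 1) * (1 / 2 - μ k.succ.succ) / F := fun k => hS 0 k.succ (Fin.succ_ne_zero k).symm
  simp only [hS']
  simp only [hK _ 1]
  simp only [Fin.sum_univ_succ, Fin.sum_univ_zero] at h1 h2 h3 ⊢
  simp only [Fin.succ_zero_eq_one, h0, hK0, Fin.succ_one_eq_two, zero_mul, zero_add, add_zero] at *
  obtain ⟨r, hr⟩ : ∃ r : ℝ, r = F⁻¹ := ⟨_, rfl⟩
  simp only [div_eq_mul_inv, mul_inv, ← hr]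
  linear_combination (r * (1 / 2 - μ 1) - μ 1 + r * p 1 + 1 / 2) * h1
    - (2 * r * (1 / 2 - μ 1) + 1) * h2 + r * h3

end Coord

namespace Coord

variable {m : ℕ}

/-- Coordinates which straighten the level sets of `h`: a local parametrization of the level set of `h`
through `o`, in which the last coordinates are kept. -/
lemma exists_levelSet_parametrization {V : Set (EuclideanSpace ℝ (Fin (m + 1)))} (hV : IsOpen V)
    {h : EuclideanSpace ℝ (Fin (m + 1)) → ℝ} (hh : SmoothOn V h) (hz : 0 ∈ V)
    (h0 : pd 0 h 0 ≠ 0) :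
    ∃ (U : Set (EuclideanSpace ℝ (Fin m)))
      (ψ : EuclideanSpace ℝ (Fin m) → EuclideanSpace ℝ (Fin (m + 1))),
      IsOpen U ∧ 0 ∈ U ∧ (∀ a, SmoothOn U (fun y => ψ y a)) ∧ (∀ y ∈ U, ψ y ∈ V) ∧ ψ 0 = 0 ∧
      (∀ y ∈ U, h (ψ y) = h 0) ∧ ∀ y ∈ U, ∀ k : Fin m, ψ y k.succ = y k := by
  set F : EuclideanSpace ℝ (Fin (m + 1)) → EuclideanSpace ℝ (Fin (m + 1)) := fun z =>
    WithLp.toLp 2 (Fin.cons (h z - h 0) fun k : Fin m => z k.succ) with hFdef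
  have hF0 : ∀ z, F z 0 = h z - h 0 := fun z => rfl
  have hFs : ∀ z (k : Fin m), F z k.succ = z k.succ := fun z k => rfl
  have sF : ∀ a, SmoothOn V (fun z => F z a) := by
    intro a
    refine Fin.cases ?_ (fun k => ?_) a
    · exact hh.sub (SmoothOn.const _)
    · exact SmoothOn.coord k.succ
  have hFzero : F 0 = 0 := by
    ext a
    refine Fin.cases ?_ (fun k => ?_) a
    · rw [hF0, sub_self, PiLp.zero_apply]
    · rfl
  have hJ0 : ∀ i, jac F i 0 0 = pd i h 0 := by
    intro i
    have : jac F i 0 0 = pd i (fun z => h z - h 0) 0 := rfl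
    rw [this, pd_sub hh (SmoothOn.const _) hz, pd_const, sub_zero]
  have hJs : ∀ i (k : Fin m), jac F i k.succ 0 = if k.succ = i then 1 else 0 :=
    fun i k => pd_coord i k.succ
  have hdet : (jacMatrix F 0).det ≠ 0 := by
    refine fun hd => ?_
    obtain ⟨v, hv, hv0⟩ := Matrix.exists_mulVec_eq_zero_iff.2 hd
    have hvs : ∀ k : Fin m, v k.succ = 0 := by
      intro k
      have := congrFun hv0 k.succ
      simpa [Matrix.mulVec, dotProduct, jacMatrix, hJs] using this
    have hv1 : v 0 = 0 := by
      have := congrFun hv0 0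
      simp only [Matrix.mulVec, dotProduct, jacMatrix, Matrix.of_apply, hJ0, Fin.sum_univ_succ, hvs,
        mul_zero, Finset.sum_const_zero, add_zero, Pi.zero_apply] at this
      exact (mul_eq_zero.1 this).resolve_left h0
    exact hv (funext fun a => Fin.cases hv1 hvs a)
  obtain ⟨W, χ, hW, h0W, hχ, hm, hr, hl, -⟩ := exists_local_inverse hV sF hz hdet
  rw [hFzero] at h0W hl
  set ι : EuclideanSpace ℝ (Fin m) → EuclideanSpace ℝ (Fin (m + 1)) := fun y =>
    WithLp.toLp 2 (Fin.cons 0 fun k : Fin m => y k) with hιdef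
  have sι : ∀ (U : Set (EuclideanSpace ℝ (Fin m))) a, SmoothOn U (fun y => ι y a) := by
    intro U a
    refine Fin.cases ?_ (fun k => ?_) a
    · exact SmoothOn.const 0
    · exact SmoothOn.coord k
  have cι : Continuous ι := continuous_iff_continuousAt.2 fun y =>
    (contDiffAt_euclidean.2 fun a => sι Set.univ a y (Set.mem_univ y)).continuousAt
  have ι0 : ι 0 = 0 := by
    ext a; exact Fin.cases rfl (fun k => rfl) a
  refine ⟨ι ⁻¹' W, fun y => χ (ι y), hW.preimage cι, ?_, fun a =>
    (hχ a).comp (sι _) (fun y hy => hy), fun y hy => hm _ hy, ?_, fun y hy => ?_, fun y hy k => ?_⟩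
  · rw [Set.mem_preimage, ι0]; exact h0W
  · change χ (ι 0) = 0
    rw [ι0, hl]
  · have := hF0 (χ (ι y))
    rw [hr _ hy] at this
    have h2 : ι y 0 = 0 := rfl
    rw [h2] at this
    linarith
  · have := hFs (χ (ι y)) k
    rw [hr _ hy] at this
    exact this.symm

/-- The tangent space of a level set is the kernel of the differential. -/
lemma jac_zero_of_level {V : Set (EuclideanSpace ℝ (Fin (m + 1)))}
    {U : Set (EuclideanSpace ℝ (Fin m))} (hU : IsOpen U) {h : EuclideanSpace ℝ (Fin (m + 1)) → ℝ}
    (hh : SmoothOn V h) {ψ : EuclideanSpace ℝ (Fin m) → EuclideanSpace ℝ (Fin (m + 1))}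
    (hψ : ∀ a, SmoothOn U (fun y => ψ y a)) (hm : ∀ y ∈ U, ψ y ∈ V) {c : ℝ}
    (hc : ∀ y ∈ U, h (ψ y) = c) {y : EuclideanSpace ℝ (Fin m)} (hy : y ∈ U)
    (h0 : pd 0 h (ψ y) ≠ 0) (hs : ∀ k : Fin m, pd k.succ h (ψ y) = 0) (i : Fin m) :
    jac ψ i 0 y = 0 := by
  have h1 := pd_comp hh hψ hm hy i
  rw [pd_congr hU hy hc, pd_const, Fin.sum_univ_succ] at h1
  simp only [hs, zero_mul, Finset.sum_const_zero, add_zero] at h1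
  exact (mul_eq_zero.1 h1.symm).resolve_left h0

end Coord

namespace Riem

set_option linter.unusedSectionVars false

open Coord

section

variable {n m : ℕ} {M : Type*} [TopologicalSpace M] [ChartedSpace (EuclideanSpace ℝ (Fin n)) M]

lemma IsParam.congr {V : Set (EuclideanSpace ℝ (Fin m))} {Φ Ψ : EuclideanSpace ℝ (Fin m) → M}
    (H : IsParam (n := n) V Φ) (h : ∀ y ∈ V, Ψ y = Φ y) : IsParam (n := n) V Ψ where
  isOpen := H.isOpen
  smooth := H.smooth.congr h
  injective y hy := by
    have he : Ψ =ᶠ[𝓝 y] Φ := by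
      filter_upwards [H.isOpen.mem_nhds hy] with z hz using h z hz
    have h1 : (mfderiv (𝓡 m) (𝓡 n) Ψ y : EuclideanSpace ℝ (Fin m) →L[ℝ] EuclideanSpace ℝ (Fin n))
      = mfderiv (𝓡 m) (𝓡 n) Φ y := he.mfderiv_eq
    intro u v huv
    have h2 := fun w => congrArg (fun L : EuclideanSpace ℝ (Fin m) →L[ℝ] EuclideanSpace ℝ (Fin n) =>
      L w) h1
    exact H.injective y hy ((h2 u).symm.trans (Eq.trans huv (h2 v)))

end

variable {M : Type*} [TopologicalSpace M] [ChartedSpace (EuclideanSpace ℝ (Fin 5)) M]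
  [IsManifold (𝓡 5) ∞ M] [RiemannianBundle (fun x : M => TangentSpace (𝓡 5) x)]
  [IsContMDiffRiemannianBundle (𝓡 5) ∞ (EuclideanSpace ℝ (Fin 5))
      (fun x : M => TangentSpace (𝓡 5) x)] {f : M → ℝ} {x : M}

namespace IsAdaptedParam

variable {e : Fin 5 → TangentSpace (𝓡 5) x} {V : Set (EuclideanSpace ℝ (Fin 5))}
  {Φ : EuclideanSpace ℝ (Fin 5) → M}

lemma pd_zero_ne (P : IsAdaptedParam f e V Φ) : pd 0 (f ∘ Φ) 0 ≠ 0 := by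
  have h := P.pos 0 P.zero_mem
  rw [P.map_zero] at h
  rw [P.pd_zero]; exact (Real.sqrt_pos.2 h).ne'

lemma coordVec_comp_eq_sum (P : IsAdaptedParam f e V Φ) {U : Set (EuclideanSpace ℝ (Fin 4))}
    (hU : IsOpen U) (h0U : 0 ∈ U) {φ : EuclideanSpace ℝ (Fin 4) → M}
    {ψ : EuclideanSpace ℝ (Fin 4) → EuclideanSpace ℝ (Fin 5)}
    (hψ : ∀ a, SmoothOn U (fun y => ψ y a)) (hm : ∀ y ∈ U, ψ y ∈ V) (hψ0 : ψ 0 = 0)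
    (he : ∀ y ∈ U, Φ (ψ y) = φ y) (i : Fin 4) :
    (coordVec (n := 5) φ 0 i : EuclideanSpace ℝ (Fin 5))
      = (∑ a, jac ψ i a 0 • e a : TangentSpace (𝓡 5) x) := by
  rw [IsParam.coordVec_comp_eq P.isParam hU hψ hm he h0U i, hψ0]
  have h1 : ∀ a, (jac ψ i a 0 • coordVec (n := 5) Φ 0 a : TangentSpace (𝓡 5) (Φ 0))
      = (jac ψ i a 0 • e a : TangentSpace (𝓡 5) x) := fun a =>
    congrArg (fun v : EuclideanSpace ℝ (Fin 5) => jac ψ i a 0 • v) (P.coordVec_eq a)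
  exact Finset.sum_congr (M := EuclideanSpace ℝ (Fin 5)) rfl fun a _ => h1 a

lemma exists_isLevelParametrization (S : IsShrinker 5 f) (A : IsAdaptedFrame f x e)
    (P : IsAdaptedParam f e V Φ) :
    ∃ φ : EuclideanSpace ℝ (Fin 4) → M, IsLevelParametrization f x (fun i : Fin 4 => e i.succ) φ := by
  have sf := P.isParam.smooth_comp S.smooth
  obtain ⟨U, ψ, hU, h0U, hψ, hm, hψ0, hc, hs⟩ :=
    exists_levelSet_parametrization P.isParam.isOpen sf P.zero_mem P.pd_zero_ne
  have hJ0 : ∀ i, jac ψ i 0 0 = 0 := fun i =>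
    jac_zero_of_level hU sf hψ hm hc h0U (by rw [hψ0]; exact P.pd_zero_ne)
      (fun k => by rw [hψ0]; exact P.pd_succ k) i
  have hJs : ∀ i k : Fin 4, jac ψ i k.succ 0 = if k = i then 1 else 0 := fun i k =>
    (pd_congr hU h0U (fun y hy => hs y hy k) i).trans (pd_coord i k)
  refine ⟨fun y => Φ (ψ y), rfl, A.orthonormal.linearIndependent.comp _ (Fin.succ_injective 4), ?_,
    ⟨U, hU, h0U, fun y hy => ?_, fun y hy => ?_⟩, fun i => ?_⟩
  · rw [hψ0, P.map_zero]
  · have h1 : ContDiffAt ℝ ∞ ψ y := contDiffAt_euclidean.2 fun a => hψ a y hy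
    exact ((P.isParam.contMDiffAt (hm y hy)).comp y h1.contMDiffAt).contMDiffWithinAt
  · have := hc y hy
    simp only [Function.comp] at this
    rw [this, P.map_zero]
  · refine (P.coordVec_comp_eq_sum hU h0U hψ hm hψ0 (fun _ _ => rfl) i).trans ?_
    rw [Fin.sum_univ_succ]
    simp only [hJ0, hJs, zero_smul, zero_add, ite_smul, one_smul, Finset.sum_ite_eq', Finset.mem_univ,
      if_true]
    rfl

/-- A parametrization of the level set in adapted coordinates. -/
lemma exists_isPullback (A : IsAdaptedFrame f x e)
    (P : IsAdaptedParam f e V Φ) {φ : EuclideanSpace ℝ (Fin 4) → M}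
    (L : IsLevelParametrization f x (fun i : Fin 4 => e i.succ) φ) :
    ∃ (U : Set (EuclideanSpace ℝ (Fin 4))) (ψ : EuclideanSpace ℝ (Fin 4) → EuclideanSpace ℝ (Fin 5)),
      0 ∈ U ∧ ψ 0 = 0 ∧ IsPullback V (pullbackMetric (n := 5) Φ) U (pullbackMetric (n := 5) φ) ψ ∧
      (∀ i a, jac ψ i a 0 = if a = i.succ then 1 else 0) ∧ ∀ y ∈ U, (f ∘ Φ) (ψ y) = f x := by
  obtain ⟨U, hU, h0U, hφ, hlev⟩ := L.smooth_level
  obtain ⟨O, χ, hO, h0O, hχ, hχV, hr, hl, -⟩ := P.isParam.exists_local_inverse P.zero_mem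
  rw [P.map_zero] at h0O hl
  have hU1 : IsOpen (U ∩ φ ⁻¹' O) := hφ.continuousOn.isOpen_inter_preimage hU hO
  set U1 := U ∩ φ ⁻¹' O
  have h01 : (0 : EuclideanSpace ℝ (Fin 4)) ∈ U1 := ⟨h0U, by rw [Set.mem_preimage, L.map_zero]; exact h0O⟩
  set ψ : EuclideanSpace ℝ (Fin 4) → EuclideanSpace ℝ (Fin 5) := fun y => χ (φ y)
  have hψ : ∀ a, SmoothOn U1 (fun y => ψ y a) := fun a y hy => by
    have h1 := (hχ.contMDiffAt (hO.mem_nhds hy.2)).comp y (hφ.contMDiffAt (hU.mem_nhds hy.1))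
    exact contDiffAt_euclidean.1 h1.contDiffAt a
  have hψ0 : ψ 0 = 0 := by
    change χ (φ 0) = 0
    rw [L.map_zero, hl]
  have hm : ∀ y ∈ U1, ψ y ∈ V := fun y hy => hχV _ hy.2
  have he : ∀ y ∈ U1, Φ (ψ y) = φ y := fun y hy => hr _ hy.2
  have hJ : ∀ i a, jac ψ i a 0 = if a = i.succ then 1 else 0 := by
    intro i
    have h1 := (P.coordVec_comp_eq_sum hU1 h01 hψ hm hψ0 he i).symm.trans (L.deriv i)
    have h2 : (∑ a, jac ψ i a 0 • e a : TangentSpace (𝓡 5) x)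
        = ∑ a, (if a = i.succ then (1 : ℝ) else 0) • e a := by
      refine Eq.trans h1 ?_
      simp only [ite_smul, one_smul, zero_smul, Finset.sum_ite_eq', Finset.mem_univ, if_true]
    have h3 := Fintype.linearIndependent_iff.1 A.orthonormal.linearIndependent
      (fun a => jac ψ i a 0 - if a = i.succ then (1 : ℝ) else 0)
      (by simp only [sub_smul, Finset.sum_sub_distrib]; rw [h2, sub_self])
    exact fun a => sub_eq_zero.1 (h3 a)
  set τ : EuclideanSpace ℝ (Fin 4) → EuclideanSpace ℝ (Fin 4) := fun y =>
    WithLp.toLp 2 fun k : Fin 4 => ψ y k.succ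
  have hτ : ∀ k, SmoothOn U1 (fun y => τ y k) := fun k => hψ k.succ
  have hτJ : jacMatrix τ 0 = 1 := by
    ext k i
    have : jacMatrix τ 0 k i = jac ψ i k.succ 0 := rfl
    rw [this, hJ, Matrix.one_apply]
    simp only [Fin.succ_inj]
  have hU2 := SmoothOn.isOpen_ne hU1 (smooth_det_jacMatrix hτ) 0
  set U2 := U1 ∩ {y | (jacMatrix τ y).det ≠ 0}
  have h02 : (0 : EuclideanSpace ℝ (Fin 4)) ∈ U2 := ⟨h01, by simp [hτJ]⟩
  have hψ2 : ∀ a, SmoothOn U2 (fun y => ψ y a) := fun a => (hψ a).mono Set.inter_subset_left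
  have hinj : ∀ y ∈ U2, Function.Injective (fderiv ℝ ψ y) := by
    intro y hy u v huv
    refine injective_fderiv hτ hy.1 hy.2 ?_
    ext k
    rw [fderiv_coord hτ hy.1, fderiv_coord hτ hy.1]
    have h1 := fun v => fderiv_coord hψ hy.1 v k.succ
    exact (h1 u).symm.trans ((congrArg (fun w : EuclideanSpace ℝ (Fin 5) => w k.succ) huv).trans (h1 v))
  have HΦ := P.isParam.comp hU2 hψ2 (fun y hy => hm y hy.1) hinj
  have Hφ : IsParam (n := 5) U2 φ := HΦ.congr fun y hy => (he y hy.1).symm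
  refine ⟨U2, ψ, h02, hψ0, P.isParam.isPullback_comp Hφ hψ2 (fun y hy => hm y hy.1)
    (fun y hy => he y hy.1), hJ, fun y hy => ?_⟩
  rw [Function.comp, he y hy.1, hlev y hy.1.1]

end IsAdaptedParam

end Riem

namespace Riem

set_option linter.unusedSectionVars false

open Coord

lemma IsParam.trace_ricci_sq {n : ℕ} {M : Type*} [TopologicalSpace M]
    [ChartedSpace (EuclideanSpace ℝ (Fin n)) M] [IsManifold (𝓡 n) ∞ M]
    [RiemannianBundle (fun x : M => TangentSpace (𝓡 n) x)]
    [IsContMDiffRiemannianBundle (𝓡 n) ∞ (EuclideanSpace ℝ (Fin n))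
      (fun x : M => TangentSpace (𝓡 n) x)]
    {V : Set (EuclideanSpace ℝ (Fin n))} {Φ : EuclideanSpace ℝ (Fin n) → M}
    {z : EuclideanSpace ℝ (Fin n)} (H : IsParam (n := n) V Φ) (hz : z ∈ V) :
    (((pullbackMetric (n := n) Φ z)⁻¹ * Matrix.of (Coord.ricci (pullbackMetric (n := n) Φ) z))
      * ((pullbackMetric (n := n) Φ z)⁻¹
        * Matrix.of (Coord.ricci (pullbackMetric (n := n) Φ) z))).trace
    = (((chartMetric (n := n) (Φ z) (extChartAt (𝓡 n) (Φ z) (Φ z)))⁻¹ *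
        Matrix.of (Coord.ricci (chartMetric (n := n) (Φ z)) (extChartAt (𝓡 n) (Φ z) (Φ z))))
      * ((chartMetric (n := n) (Φ z) (extChartAt (𝓡 n) (Φ z) (Φ z)))⁻¹ *
        Matrix.of (Coord.ricci (chartMetric (n := n) (Φ z)) (extChartAt (𝓡 n) (Φ z) (Φ z))))).trace := by
  obtain ⟨W, -, hzW, HW, hW⟩ := H.exists_chart hz
  have hpb := HW.isPullback _ hW
  have hJ := isUnit_iff_ne_zero.2 (hpb.det_jacMatrix_ne hzW)
  rw [hpb.ricci_endomorphism_eq hzW]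
  set J := jacMatrix (fun w => extChartAt (𝓡 n) (Φ z) (Φ w)) z
  have h1 : ∀ B : Matrix (Fin n) (Fin n) ℝ, (J⁻¹ * B * J) * (J⁻¹ * B * J) = J⁻¹ * (B * B * J) := by
    intro B
    calc (J⁻¹ * B * J) * (J⁻¹ * B * J) = J⁻¹ * B * (J * J⁻¹) * (B * J) := by
          simp only [Matrix.mul_assoc]
      _ = _ := by rw [Matrix.mul_nonsing_inv _ hJ, mul_one]; simp only [Matrix.mul_assoc]
  rw [h1, Matrix.trace_mul_comm, Matrix.mul_assoc, Matrix.mul_nonsing_inv _ hJ, mul_one]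

variable {M : Type*} [TopologicalSpace M] [ChartedSpace (EuclideanSpace ℝ (Fin 5)) M]
  [IsManifold (𝓡 5) ∞ M] [RiemannianBundle (fun x : M => TangentSpace (𝓡 5) x)]
  [IsContMDiffRiemannianBundle (𝓡 5) ∞ (EuclideanSpace ℝ (Fin 5))
      (fun x : M => TangentSpace (𝓡 5) x)] {f : M → ℝ} {x : M}

lemma IsShrinker.trace_ricci_sq (S : IsShrinker 5 f) {V : Set (EuclideanSpace ℝ (Fin 5))}
    {Φ : EuclideanSpace ℝ (Fin 5) → M} {z : EuclideanSpace ℝ (Fin 5)} (H : IsParam (n := 5) V Φ)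
    (hz : z ∈ V) (hpos : 0 < f (Φ z)) :
    (((pullbackMetric (n := 5) Φ z)⁻¹ * Matrix.of (Coord.ricci (pullbackMetric (n := 5) Φ) z))
      * ((pullbackMetric (n := 5) Φ z)⁻¹
        * Matrix.of (Coord.ricci (pullbackMetric (n := 5) Φ) z))).trace = 3 / 4 := by
  rw [H.trace_ricci_sq hz]
  obtain ⟨y, hy⟩ : ∃ y, Φ z = y := ⟨_, rfl⟩
  rw [hy] at hpos ⊢
  obtain ⟨e, A⟩ := S.exists_isAdaptedFrame hpos
  have F := A.isRicciFrame
  obtain ⟨V', Ψ, H', h0, rfl, -, A'⟩ := exists_adapted_coordinates y e F.orthonormal F.ricci_eq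
  rw [← H'.trace_ricci_sq h0, ← (F.sum_eq S).2, A'.inv_eq_one, one_mul]
  have : Matrix.of (Coord.ricci (pullbackMetric (n := 5) Ψ) 0)
      = Matrix.diagonal fun i => ricciEigenvalue 5 i (Ψ 0) := by
    ext i j
    rw [Matrix.of_apply, A'.ricci_eq, Matrix.diagonal_apply]
  rw [this, Matrix.diagonal_mul_diagonal, Matrix.trace_diagonal]
  simp only [pow_two]

namespace IsAdaptedParam

variable {e : Fin 5 → TangentSpace (𝓡 5) x} {V : Set (EuclideanSpace ℝ (Fin 5))}
  {Φ : EuclideanSpace ℝ (Fin 5) → M}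

/-- The Weyl curvature of the level set in adapted coordinates. -/
lemma levelWeyl_eq (S : IsShrinker 5 f) (A : IsAdaptedFrame f x e) (P : IsAdaptedParam f e V Φ) :
    ∃ R : Fin 4 → Fin 4 → ℝ, (∀ i, R i i = 0) ∧
      (∀ i j, i ≠ j → R i j = riemann (pullbackMetric (n := 5) Φ) 0 i.succ j.succ i.succ j.succ
        + (1 / 2 - ricciEigenvalue 5 i.succ x) * (1 / 2 - ricciEigenvalue 5 j.succ x) / f x) ∧
      ∀ k : Fin 3, levelWeyl f x (fun i : Fin 4 => e i.succ) 0 k.succ 0 k.succ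
        = R 0 k.succ - 1 / 2 * (∑ j, R j k.succ + ∑ j, R j 0) + 1 / 6 * ∑ l, ∑ j, R j l := by
  have H := P.exists_isLevelParametrization S A
  have hW : ∀ k : Fin 3, levelWeyl f x (fun i : Fin 4 => e i.succ) 0 k.succ 0 k.succ
      = Coord.weyl (pullbackMetric (n := 5) H.choose) 0 0 k.succ 0 k.succ := fun k => dif_pos H
  obtain ⟨U, ψ, h0U, hψ0, hpb, hJ, hc⟩ := P.exists_isPullback A H.choose_spec
  have hA := P.adapted
  have hne := P.pd_zero_ne
  have hsq : pd 0 (f ∘ Φ) 0 ^ 2 = f x := by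
    have h := P.pos 0 P.zero_mem
    rw [P.map_zero] at h
    rw [P.pd_zero, Real.sq_sqrt h.le]
  have hs := P.pd_succ
  rw [← hψ0] at hA hne
  refine ⟨fun i j => riemann (pullbackMetric (n := 5) H.choose) 0 i j i j, fun i => ?_,
    fun i j hij => ?_, fun k => ?_⟩
  · have := IsMetricOn.riemann_antisymm_left (g := pullbackMetric (n := 5) H.choose)
      (y := 0) i i i i
    simp only
    linarith
  · have h1 := hpb.sectional_levelSet h0U hJ (P.isParam.isSoliton_of_isShrinker S) hA hc hne
      (fun i => by rw [hψ0]; exact hs i) hij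
    rw [hψ0, hsq] at h1
    exact h1
  · rw [hW, weyl_eq_of_eq_one (hpb.metric_eq_one h0U hJ hA.eq_one) (Fin.succ_ne_zero k).symm]

/-- The drift Laplacian of the barrier. -/
lemma weightedLaplacian_eq (S : IsShrinker 5 f) (A : IsAdaptedFrame f x e)
    (P : IsAdaptedParam f e V Φ) {u v : M → ℝ} (hv : IsUpperBarrierAt 5 u v x)
    (hvΦ : v ∘ Φ =ᶠ[𝓝 0] ricciQuotient (pullbackMetric (n := 5) Φ) (f ∘ Φ) 1) :
    weightedLaplacian 5 f v x = - ricciEigenvalue 5 1 x + 2 * ricciEigenvalue 5 1 x ^ 2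
      + 3 / (2 * f x) * inner ℝ (grad 5 f x) (grad 5 v x)
      - 1 / f x * inner ℝ (grad 5 f x) (grad 5 (fun y => v y ^ 2) x)
      - 2 * ∑ k : Fin 3, levelWeyl f x (fun i : Fin 4 => e i.succ) 0 k.succ 0 k.succ
        * ricciEigenvalue 5 k.succ.succ x := by
  obtain ⟨R, hR0, hR, hW⟩ := P.levelWeyl_eq S A
  obtain ⟨O, hO, hxO, hvO, -, -⟩ := hv
  have hΦ := P.map_zero
  subst hΦ
  have H := P.isParam
  have h0 := P.zero_mem
  have hA := P.adapted
  have hpos := P.pos 0 h0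
  have HS := H.isSoliton_of_isShrinker S
  have hfd := S.mdifferentiableAt (Φ 0)
  have hvd : MDifferentiableAt (𝓡 5) 𝓘(ℝ, ℝ) v (Φ 0) :=
    (hvO.contMDiffAt (hO.mem_nhds hxO)).mdifferentiableAt (by simp)
  have hv2O : ContMDiffOn (𝓡 5) 𝓘(ℝ, ℝ) ∞ (fun y => v y ^ 2) O := hvO.pow 2
  have hv2d : MDifferentiableAt (𝓡 5) 𝓘(ℝ, ℝ) (fun y => v y ^ 2) (Φ 0) :=
    (hv2O.contMDiffAt (hO.mem_nhds hxO)).mdifferentiableAt (by simp)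
  set G := pullbackMetric (n := 5) Φ with hG
  set W := ricciQuotient G (f ∘ Φ) 1 with hWdef
  set μ : Fin 5 → ℝ := fun i => ricciEigenvalue 5 i (Φ 0) with hμ
  set p : Fin 5 → ℝ := fun k => ∑ l, pd l (f ∘ Φ) 0 * pd l (fun z => Coord.ricci G z k k) 0 with hp
  have hpd1 : pd 1 (f ∘ Φ) 0 = 0 := P.pd_succ 0
  obtain ⟨hdW, hLW⟩ := HS.laplacian_ricciQuotient hA h0 1 hpd1 (fun y hy => (P.pos y hy).ne')
    (fun y hy => (P.den_pos y hy).ne')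
  have hW0 : W 0 = μ 1 := P.ricciQuotient_zero
  have sW : SmoothOn V W := P.smooth_ricciQuotient S
  have hlap : laplacian 5 v (Φ 0) = Coord.laplacian G W 0 := by
    rw [H.laplacian_eq h0 hO hvO hxO]
    simp only [Coord.laplacian, hessian_congr hvΦ]
    rfl
  have hgv : inner ℝ (grad 5 f (Φ 0)) (grad 5 v (Φ 0)) = p 1 := by
    rw [H.inner_grad_grad h0 hfd hvd]
    refine Finset.sum_congr rfl fun i _ => ?_
    rw [IsSoliton.gradUp_eq hA, pd_congr_of_eventuallyEq i hvΦ, hdW]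
  have hgv2 : inner ℝ (grad 5 f (Φ 0)) (grad 5 (fun y => v y ^ 2) (Φ 0)) = 2 * μ 1 * p 1 := by
    rw [H.inner_grad_grad h0 hfd hv2d, hp, Finset.mul_sum]
    refine Finset.sum_congr rfl fun i _ => ?_
    have e1 : (fun y => v y ^ 2) ∘ Φ =ᶠ[𝓝 0] fun z => W z * W z := by
      filter_upwards [hvΦ] with z hz
      simp only [Function.comp] at hz ⊢
      rw [hz, pow_two]
    rw [IsSoliton.gradUp_eq hA, pd_congr_of_eventuallyEq i e1, pd_mul sW sW h0, hdW, hW0]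
    ring
  have hsq : pd 0 (f ∘ Φ) 0 * pd 0 (f ∘ Φ) 0 = f (Φ 0) := by
    rw [P.pd_zero, Real.mul_self_sqrt hpos.le]
  have key := curvature_identity (K := fun i j => riemann G 0 i j i j) (S := R) (μ := μ) (p := p)
    hpos.ne' ?_ ?_ ?_ ?_ ?_ ?_ ?_ ?_ hR0 hR
  · rw [weightedLaplacian, hlap, hgv, hgv2]
    have e1 : ∑ i, pd i (f ∘ Φ) 0 * pd i W 0 = p 1 :=
      Finset.sum_congr rfl fun i _ => by rw [hdW]
    rw [e1] at hLW
    simp only [hW]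
    linear_combination hLW.trans key
  · intro i j
    rw [IsMetricOn.riemann_antisymm_left, HS.metric.riemann_antisymm_right h0, neg_neg]
  · intro i
    have := IsMetricOn.riemann_antisymm_left (g := G) (y := 0) i i i i
    linarith
  · exact fun i => HS.sum_sectional_eq hA h0 i
  · intro i
    have h1 := HS.radial_curvature hA h0 i
    rw [Fin.sum_univ_succ, Fin.sum_univ_succ] at h1
    simp only [P.pd_succ, mul_zero, zero_mul, Finset.sum_const_zero, add_zero] at h1
    rw [mul_assoc, hsq] at h1
    rw [mul_comm]
    exact h1
  · exact S.ricciEigenvalue_zero hpos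
  · exact HS.sum_eigenvalues hA h0
  · exact HS.sum_eigenvalues_sq hA h0
  · have h1 := HS.sum_eigenvalue_mul_pd_ricci hA h0
      (fun y hy => S.trace_ricci_sq H hy (P.pos y hy))
    simp only [hp, Finset.mul_sum]
    rw [Finset.sum_comm]
    refine Finset.sum_eq_zero fun l _ => ?_
    have h2 : ∀ k, μ k * (pd l (f ∘ Φ) 0 * pd l (fun z => Coord.ricci G z k k) 0)
        = pd l (f ∘ Φ) 0 * (μ k * pd l (fun z => Coord.ricci G z k k) 0) := fun k => by ring
    rw [Finset.sum_congr rfl fun k _ => h2 k, ← Finset.mul_sum, h1, mul_zero]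

end IsAdaptedParam

end Riem

theorem mainTheorem5 {M : Type*} [MetricSpace M] [ConnectedSpace M]
    [ChartedSpace (EuclideanSpace ℝ (Fin 5)) M] [IsManifold (𝓡 5) ∞ M]
    [RiemannianBundle (fun x : M => TangentSpace (𝓡 5) x)]
    [IsContMDiffRiemannianBundle (𝓡 5) ∞ (EuclideanSpace ℝ (Fin 5))
      (fun x : M => TangentSpace (𝓡 5) x)]
    [IsRiemannianManifold (𝓡 5) M] [CompleteSpace M] [NoncompactSpace M]
    (f : M → ℝ) (hf : ContMDiff (𝓡 5) 𝓘(ℝ, ℝ) ∞ f)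
    (hsol : ∀ (x : M) (v w : TangentSpace (𝓡 5) x),
      Riem.ricciForm x v w + Riem.hessianForm f x v w = (1 / 2) * inner ℝ v w)
    (hR : ∀ x : M, Riem.scalarCurvature 5 x = 3 / 2)
    (hnorm : ∀ x : M, ‖Riem.grad 5 f x‖ ^ 2 = f x) :
    ∃ a : ℝ, 0 < a ∧
      ContinuousOn (fun y : M => Riem.ricciEigenvalue 5 0 y + Riem.ricciEigenvalue 5 1 y)
        {x : M | a < f x} ∧
      ∀ x : M, a < f x →
        (∃ e : Fin 5 → TangentSpace (𝓡 5) x, Riem.IsAdaptedFrame f x e) ∧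
        ∀ e : Fin 5 → TangentSpace (𝓡 5) x, Riem.IsAdaptedFrame f x e →
          ∃ v : M → ℝ,
            Riem.IsUpperBarrierAt 5
              (fun y : M => Riem.ricciEigenvalue 5 0 y + Riem.ricciEigenvalue 5 1 y) v x ∧
            Riem.weightedLaplacian 5 f v x ≤
              -(Riem.ricciEigenvalue 5 0 x + Riem.ricciEigenvalue 5 1 x)
              + 2 * (Riem.ricciEigenvalue 5 0 x + Riem.ricciEigenvalue 5 1 x) ^ 2
              + 3 / (2 * f x) * inner ℝ (Riem.grad 5 f x) (Riem.grad 5 v x)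
              - 1 / f x * inner ℝ (Riem.grad 5 f x) (Riem.grad 5 (fun y => v y ^ 2) x)
              + 2 / f x * (Riem.ricciEigenvalue 5 0 x + Riem.ricciEigenvalue 5 1 x)
                * (1 - (Riem.ricciEigenvalue 5 0 x + Riem.ricciEigenvalue 5 1 x))
                * (3 / 2 - (Riem.ricciEigenvalue 5 0 x + Riem.ricciEigenvalue 5 1 x))
              - 2 * ∑ k : Fin 3,
                  Riem.levelWeyl f x (fun i : Fin 4 => e i.succ) 0 k.succ 0 k.succ
                    * Riem.ricciEigenvalue 5 k.succ.succ x := by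
  have S : Riem.IsShrinker 5 f := ⟨hf, hsol, hR, hnorm⟩
  refine ⟨1, one_pos, S.continuousOn.mono fun x (hx : 1 < f x) => (one_pos.trans hx : 0 < f x), fun x hx => ?_⟩
  have hpos : 0 < f x := one_pos.trans hx
  refine ⟨S.exists_isAdaptedFrame hpos, fun e A => ?_⟩
  obtain ⟨V, Φ, P⟩ := S.exists_isAdaptedParam hpos A
  obtain ⟨v, hv, hvΦ⟩ := P.exists_barrier S hpos
  refine ⟨v, hv, ?_⟩
  rw [P.weightedLaplacian_eq S A hv hvΦ, S.ricciEigenvalue_zero hpos, zero_add]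
  have F := A.isRicciFrame.sum_eq S
  simp only [Fin.sum_univ_succ, Fin.sum_univ_zero, S.ricciEigenvalue_zero hpos] at F
  have hu := Riem.nonneg_of_sum_eq (d := fun i : Fin 4 => Riem.ricciEigenvalue 5 i.succ x)
    (by simp only [Fin.sum_univ_succ, Fin.sum_univ_zero]; linarith [F.1])
    (by simp only [Fin.sum_univ_succ, Fin.sum_univ_zero]; linarith [F.2]) 0
  rw [Fin.succ_zero_eq_one] at hu
  have h1 : 0 ≤ 2 / f x * Riem.ricciEigenvalue 5 1 x * (1 - Riem.ricciEigenvalue 5 1 x)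
      * (3 / 2 - Riem.ricciEigenvalue 5 1 x) :=
    mul_nonneg (mul_nonneg (mul_nonneg (by positivity) hu.1) (by linarith [hu.2]))
      (by linarith [hu.2])
  linarith
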